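/- Write $\log$ for $\log_2$. Let $f=\sum_{j=1}^k f_jx^{e_j}\in\mathbb R[x]$ be an $(n,k,\tau)$-nomial with $k\ge 2$, i.e. $0\le e_1<\dots<e_k\le n$ and $2^{-\tau}\le|f_j|\le 2^{\tau}$ for all $j$. Let $\Delta=\Delta_r(m)\subset\mathbb C$ be the open disk with center $m\in\mathbb C$ and radius $r>0$, write $f(m+rx)=\sum_{i=0}^n a_ix^i$, and assume $\sum_{i>k^2}|a_i|\le\frac{|a_0|}{128}$. For $K\ge1$ say that $T_l(\Delta,K,f)$ succeeds if $\left|\frac{f^{(l)}(m)r^l}{l!}\right|-K\sum_{i\ne l}\left|\frac{f^{(i)}(m)r^i}{i!}\right|>0$. For $0\le l\le k$ put $E_\ell=|a_l|$ and $E_r=\frac{65}{64}\sum_{i\ne l,\,i\le k^2}|a_i|$. The $\tilde T_l$-test returns the output of a soft predicate for $E_\ell>E_r$ with parameter $\delta=\frac1{128}$, that is, one of True, False, Undecided, such that $E_\ell>E_r$ in case of True, $E_\ell\le E_r$ in case of False, and $\frac{1}{1+\delta}E_\ell<E_r\le(1+\delta)E_\ell$ in case of Undecided. An $L$-bit approximation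 of a real number $E$ is a number $\tilde E$ with $|\tilde E-E|<2^{-L}$. An output is justified by a pair of $L$-bit approximations $\tilde E_\ell,\tilde E_r$ if it satisfies this specification for every pair of non-negative numbers of which $\tilde E_\ell,\tilde E_r$ are $L$-bit approximations. Let $$L(m,r,f):=2\cdot\bigl(4+\max(1,\;1+\log n-\log\max_i|a_i|)\bigr),$$ which equals $2(5+\log n-\log\max_i|a_i|)$ whenever $\max_i|a_i|\le n$. Then, for every $l$ with $0\le l\le k$: 1. There is a positive integer $L\le L(m,r,f)$ such that any $L$-bit approximations of $E_\ell$ and $E_r$ justify an output of the $\tilde T_l$-test. 2. If the $\tilde T_l$-test returns True, then $\Delta$ contains exactly $l$ roots of $f$, counted with multiplicity. 3. If $T_l(\Delta,\frac32,f)$ succeeds, then the $\tilde T_l$-test returns True. 4. There is one program which, given $n$, $k$, the exponents $e_j$, and oracles that return, for every requested positive integer $\kappa$, dyadic approximations with error less than $2^{-\kappa}$ (integer multiples of $2^{-\kappa-1}$) of the numbers $f_j$, $\operatorname{Re} m$, $\operatorname{Im} m$ and $r$, runs the $\tilde T_l$-test for all $l=0,\dots,k$: for each $l$ it computes $L_l$-bit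 approximations of $E_\ell$ and $E_r$ with $1\le L_l\le L(m,r,f)$ together with an output that they justify. The number of bit operations is $$\tilde O\Bigl(k^{2}(k+\log n)\bigl(L(m,r,f)+\tau+n\log\max(1,|m|)+k^2(\log n+\log\max(1,r))\bigr)\Bigr).$$ Here $\tilde O(T)$ means at most $C\,T\,(\log T)^{d}$ with absolute constants $C,d$. Bit operations are counted on a random access machine over the integers on which each instruction costs the total bit length of the numbers involved, except that a multiplication or division of integers of $s$ bits in total costs $s\,(1+\lfloor\log s\rfloor)^2$, and an oracle call is charged for $\kappa$ and for the length of the query and of the answer. -/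

import Mathlib

open Polynomial

noncomputable section

namespace SparseRoots

/-! ### Sparse polynomials, disks and the coefficients of the shifted polynomial -/

/-- The real polynomial `f = ∑ⱼ cⱼ x ^ eⱼ`. -/
def sparsePoly {k : ℕ} (e : Fin k → ℕ) (c : Fin k → ℝ) : ℝ[X] :=
  ∑ j, C (c j) * X ^ e j

/-- The data `e, c` describe an `(n, k, τ)`-nomial with at least two terms:
`e₁ < ⋯ < e_k ≤ n` and `2 ^ (-τ) ≤ |cⱼ| ≤ 2 ^ τ`. -/
structure IsNomial (n k : ℕ) (τ : ℝ) (e : Fin k → ℕ) (c : Fin k → ℝ) : Prop where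
  two_le : 2 ≤ k
  strictMono : StrictMono e
  exponent_le : ∀ j, e j ≤ n
  le_abs : ∀ j, (2 : ℝ) ^ (-τ) ≤ |c j|
  abs_le : ∀ j, |c j| ≤ (2 : ℝ) ^ τ

/-- A real polynomial, regarded as a complex one. -/
def toComplex (f : ℝ[X]) : ℂ[X] := f.map (algebraMap ℝ ℂ)

/-- `a_i`, the `i`-th coefficient of `f_Δ(x) = f(m + r x)`, where `Δ = Δ_r(m)`. -/
def diskCoeff (f : ℝ[X]) (m : ℂ) (r : ℝ) (i : ℕ) : ℂ :=
  ((toComplex f).comp (C m + C (r : ℂ) * X)).coeff i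

/-- `max_{0 ≤ i ≤ n} |a_i|`. -/
def maxCoeff (f : ℝ[X]) (m : ℂ) (r : ℝ) (n : ℕ) : ℝ :=
  (Finset.range (n + 1)).sup' Finset.nonempty_range_add_one (fun i => ‖diskCoeff f m r i‖)

/-- The number of roots of `f` in the open disk `Δ_r(m)`, counted with multiplicity. -/
def rootsInDisk (f : ℝ[X]) (m : ℂ) (r : ℝ) : ℕ :=
  open scoped Classical in
  ((toComplex f).roots.filter (fun z => z ∈ Metric.ball m r)).card

/-- `F^{(i)}(m) r^i / i!` -/
def taylorTerm (F : ℂ[X]) (m : ℂ) (r : ℝ) (i : ℕ) : ℂ :=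
  (derivative^[i] F).eval m * (r : ℂ) ^ i / (i.factorial : ℂ)

/-- `T_l(Δ_r(m), K, F)` succeeds:
`|F^{(l)}(m) r^l / l!| - K ∑_{i ≠ l} |F^{(i)}(m) r^i / i!| > 0`. -/
def PelletSucceeds (l : ℕ) (m : ℂ) (r K : ℝ) (F : ℂ[X]) : Prop :=
  0 < ‖taylorTerm F m r l‖
    - K * ∑ i ∈ (Finset.range (F.natDegree + 1)).erase l, ‖taylorTerm F m r i‖

/-! ### The truncated soft test -/

/-- The tail assumption `∑_{i > k²} |a_i| ≤ |a₀| / 128`. -/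
def TailAssumption (n k : ℕ) (f : ℝ[X]) (m : ℂ) (r : ℝ) : Prop :=
  ∑ i ∈ Finset.Ioc (k ^ 2) n, ‖diskCoeff f m r i‖ ≤ ‖diskCoeff f m r 0‖ / 128

/-- `E_ℓ = |a_l|` -/
def lhsExpr (f : ℝ[X]) (m : ℂ) (r : ℝ) (l : ℕ) : ℝ := ‖diskCoeff f m r l‖

/-- `E_r = (65/64) ∑_{i ≠ l, i ≤ k²} |a_i|` -/
def rhsExpr (k : ℕ) (f : ℝ[X]) (m : ℂ) (r : ℝ) (l : ℕ) : ℝ :=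
  65 / 64 * ∑ i ∈ (Finset.range (k ^ 2 + 1)).erase l, ‖diskCoeff f m r i‖

/-- The possible answers of a soft predicate (`True`, `False`, `Undecided`). -/
inductive Verdict
  | yes
  | no
  | undecided

/-- The output specification of the soft version, with parameter `δ`, of the predicate
`E > E'`. -/
def SoftSpec (δ E E' : ℝ) : Verdict → Prop
  | .yes => E' < E
  | .no => E ≤ E'
  | .undecided => 1 / (1 + δ) * E < E' ∧ E' ≤ (1 + δ) * E

/-- `x` is an `L`-bit approximation of `E`. -/
def IsBitApprox (L : ℕ) (x E : ℝ) : Prop := |x - E| < 1 / (2 : ℝ) ^ L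

/-- The verdict `v` is justified by the two `L`-bit approximations `x` and `y` alone: it is
correct for all non-negative values `E`, `E'` that `x`, `y` approximate to `L` bits. -/
def Certifies (δ : ℝ) (L : ℕ) (x y : ℝ) (v : Verdict) : Prop :=
  ∀ E E' : ℝ, 0 ≤ E → 0 ≤ E' → IsBitApprox L x E → IsBitApprox L y E' → SoftSpec δ E E' v

/-- `L(m, r, f) = 2 (4 + max (1, 1 + log n - log max_i |a_i|))`, which is
`2 (5 + log n - log max_i |a_i|)` as long as `max_i |a_i| ≤ n`. -/
def precisionBound (n : ℕ) (f : ℝ[X]) (m : ℂ) (r : ℝ) : ℝ :=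
  2 * (4 + max 1 (1 + Real.logb 2 n - Real.logb 2 (maxCoeff f m r n)))

/-! ### Programs and their bit cost

Random access programs over the integers with a real-number oracle. A state consists of
registers (addressed directly) and a memory (addressed through registers). The cost of an
instruction is measured in the bit lengths of the numbers involved: linear for all operations,
except that a multiplication or division of integers of `s` bits in total is charged
`s (1 + log s) ^ 2`. -/

/-- Commands; the natural numbers are register names. -/
inductive Cmd
  | skip
  | const (d : ℕ) (z : ℤ)
  | add (d a b : ℕ)
  | sub (d a b : ℕ)
  | mul (d a b : ℕ)
  | div (d a b : ℕ)
  | load (d a : ℕ)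
  | store (a b : ℕ)
  | query (d a b : ℕ)
  | seq (p q : Cmd)
  | ite (a : ℕ) (p q : Cmd)
  | loop (a : ℕ) (p : Cmd)

/-- Registers and memory. -/
structure State where
  reg : ℕ → ℤ
  mem : ℕ → ℤ

def State.setReg (s : State) (d : ℕ) (z : ℤ) : State :=
  ⟨Function.update s.reg d z, s.mem⟩

def State.setMem (s : State) (i : ℕ) (z : ℤ) : State :=
  ⟨s.reg, Function.update s.mem i z⟩

/-- Number of bits (with sign) of an integer. -/
def bits (z : ℤ) : ℕ := Nat.size z.natAbs + 1

/-- Cost of a multiplication or division. -/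
def mulCost (a b : ℤ) : ℕ :=
  (bits a + bits b) * (1 + Nat.log 2 (bits a + bits b)) ^ 2

/-- `Exec O p s t s'`: started in state `s`, the program `p` with oracle `O` halts in state `s'`
after bit cost `t`. The conditional and the loop test whether a register is positive. An oracle
query is charged for the query, for the requested number of bits and for the answer. -/
inductive Exec (O : ℕ → ℕ → ℤ) : Cmd → State → ℕ → State → Prop
  | skip (s : State) : Exec O .skip s 1 s
  | const (s : State) (d : ℕ) (z : ℤ) : Exec O (.const d z) s (bits z) (s.setReg d z)
  | add (s : State) (d a b : ℕ) :
      Exec O (.add d a b) s (bits (s.reg a) + bits (s.reg b)) (s.setReg d (s.reg a + s.reg b))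
  | sub (s : State) (d a b : ℕ) :
      Exec O (.sub d a b) s (bits (s.reg a) + bits (s.reg b)) (s.setReg d (s.reg a - s.reg b))
  | mul (s : State) (d a b : ℕ) :
      Exec O (.mul d a b) s (mulCost (s.reg a) (s.reg b)) (s.setReg d (s.reg a * s.reg b))
  | div (s : State) (d a b : ℕ) :
      Exec O (.div d a b) s (mulCost (s.reg a) (s.reg b)) (s.setReg d (s.reg a / s.reg b))
  | load (s : State) (d a : ℕ) :
      Exec O (.load d a) s (bits (s.reg a) + bits (s.mem (s.reg a).toNat))
        (s.setReg d (s.mem (s.reg a).toNat))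
  | store (s : State) (a b : ℕ) :
      Exec O (.store a b) s (bits (s.reg a) + bits (s.reg b))
        (s.setMem (s.reg a).toNat (s.reg b))
  | query (s : State) (d a b : ℕ) :
      Exec O (.query d a b) s
        (bits (s.reg a) + bits (s.reg b) + (s.reg b).toNat
          + bits (O (s.reg a).toNat (s.reg b).toNat))
        (s.setReg d (O (s.reg a).toNat (s.reg b).toNat))
  | seq {p q : Cmd} {s s' s'' : State} {t t' : ℕ} :
      Exec O p s t s' → Exec O q s' t' s'' → Exec O (.seq p q) s (t + t') s''
  | ite_pos {a : ℕ} {p q : Cmd} {s s' : State} {t : ℕ} :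
      0 < s.reg a → Exec O p s t s' → Exec O (.ite a p q) s (bits (s.reg a) + t) s'
  | ite_neg {a : ℕ} {p q : Cmd} {s s' : State} {t : ℕ} :
      s.reg a ≤ 0 → Exec O q s t s' → Exec O (.ite a p q) s (bits (s.reg a) + t) s'
  | loop_stop {a : ℕ} {p : Cmd} {s : State} :
      s.reg a ≤ 0 → Exec O (.loop a p) s (bits (s.reg a)) s
  | loop_step {a : ℕ} {p : Cmd} {s s' s'' : State} {t t' : ℕ} :
      0 < s.reg a → Exec O p s t s' → Exec O (.loop a p) s' t' s'' →
        Exec O (.loop a p) s (bits (s.reg a) + t + t') s''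

/-! ### Input, output and running time of the test -/

/-- `g` yields, for every positive `κ`, a dyadic approximation `g κ / 2 ^ (κ + 1)` of `x` with
error less than `2 ^ (-κ)`. -/
def ApproximatesReal (g : ℕ → ℤ) (x : ℝ) : Prop :=
  ∀ κ : ℕ, 1 ≤ κ → IsBitApprox κ ((g κ : ℝ) / 2 ^ (κ + 1)) x

/-- The oracle provides approximations of the `k` coefficients, of the real and the imaginary
part of `m`, and of `r`. -/
structure IsInputOracle {k : ℕ} (c : Fin k → ℝ) (m : ℂ) (r : ℝ) (O : ℕ → ℕ → ℤ) : Prop where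
  coeff : ∀ j : Fin k, ApproximatesReal (O j) (c j)
  center_re : ApproximatesReal (O k) m.re
  center_im : ApproximatesReal (O (k + 1)) m.im
  radius : ApproximatesReal (O (k + 2)) r

/-- Initially `n` and `k` are in the registers `0` and `1`, the exponents are in the memory, and
everything else is zero. -/
def initState (n k : ℕ) (e : Fin k → ℕ) : State where
  reg i := if i = 0 then n else if i = 1 then k else 0
  mem i := if h : i < k then e ⟨i, h⟩ else 0

def Verdict.code : Verdict → ℤ
  | .no => 0
  | .yes => 1
  | .undecided => 2

/-- The result of the `l`-th test is in the four memory cells from `4 l` on: the verdict, the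
precision `L`, and the integers `A`, `B` for which `A / 2 ^ (L + 1)` and `B / 2 ^ (L + 1)` are
the `L`-bit approximations of `E_ℓ` and `E_r` that justify the verdict
(for `δ = 1 / 128`). The precision is at most `L(m, r, f)`. -/
def IsTestResult (n k : ℕ) (f : ℝ[X]) (m : ℂ) (r : ℝ) (l : ℕ) (s : State) : Prop :=
  ∃ (v : Verdict) (L : ℕ) (A B : ℤ),
    s.mem (4 * l) = v.code ∧ s.mem (4 * l + 1) = L ∧
    s.mem (4 * l + 2) = A ∧ s.mem (4 * l + 3) = B ∧
    1 ≤ L ∧ (L : ℝ) ≤ precisionBound n f m r ∧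
    IsBitApprox L ((A : ℝ) / 2 ^ (L + 1)) (lhsExpr f m r l) ∧
    IsBitApprox L ((B : ℝ) / 2 ^ (L + 1)) (rhsExpr k f m r l) ∧
    Certifies (1 / 128) L ((A : ℝ) / 2 ^ (L + 1)) ((B : ℝ) / 2 ^ (L + 1)) v

/-- `k² (k + log n) (L(m,r,f) + τ + n log max(1,|m|) + k² (log n + log max(1,r)))` -/
def bitBound (n k : ℕ) (τ : ℝ) (f : ℝ[X]) (m : ℂ) (r : ℝ) : ℝ :=
  (k : ℝ) ^ 2 * (k + Real.logb 2 n) *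
    (precisionBound n f m r + τ + n * Real.logb 2 (max 1 ‖m‖)
      + (k : ℝ) ^ 2 * (Real.logb 2 n + Real.logb 2 (max 1 r)))

end SparseRoots

end

namespace SparseRoots

/-! ### Counting roots in a disk -/

/-! Root count. If |a_l| exceeds the sum of the other |a_i|, then on the boundary circle f differs
from the monomial a_l((z-m)/r)^l by less than |a_l|. Their quotient then has a logarithm along the
circle, and integrating logarithmic derivatives gives exactly l roots inside
(`card_roots_of_norm_sub_lt`). The test sees only the indices up to k²; the factor 65/64 pays for
the tail. Conversely, 3/2 exceeds 65/64·129/128, so a successful Pellet test with K = 3/2 leaves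
neither False nor Undecided as an admissible output.

Precision. Let M = max|a_i|. The tail assumption forces M to be attained at an index that the test
sees, so M ≤ max(E_ℓ, E_r) (`maxCoeff_le_max`), and L-bit approximations with 518·2^(-L) ≤ M
determine a verdict (`exists_certifies`). The precisions tried are L = 9 + x with x = 1, 2, 4, …. If
x/2 was too small, squaring the failed inequality yields 2^L M² ≤ 2^10, that is L ≤ 10 - 2 log M.
This is where the factor 2 in L(m,r,f) is used.

Algorithm. The a_i with i ≤ k² are evaluated in fixed point arithmetic with scale P = 2^(κ+1). For
each term, one binary powering gives m^(e - i₀) with i₀ = min(e, k²); the other powers and binomial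
coefficients follow by single multiplications and exact divisions while i decreases. Moduli come
from an integer Newton iteration. The predicate `Near` measures errors as (1+η)^s - 1 relative to a
majorant, where s counts roundings. The program knows no bound for τ, |m|, r or 1/M. It computes
from its own approximations a number D that bounds the errors, and squares the scale until D is
small against P and D·P is small against the square of the computed maximum (`GoodApprox`). The
square reflects that the output may need about twice as many bits as log(1/M).

Cost. Let b be the bit size L + τ + n log max(1,|m|) + k²(log n + log max(1,r)) rounded up, and W =
2^(2b). All quantities are bounded by small powers of W (`Setup`), and a round with P ≥ W^30 must
succeed (`lt_sq_of_scale_ge`), so P never exceeds W^60 and all operands have O(b) bits. Since κ + 1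
doubles in every round, the number of rounds is logarithmic in b. A round takes, up to constants,
k(k² + T₁) + k²T₁ instructions, where T₁ is log n plus a logarithm of b. Instructions are counted by
the triples `Tri`; operand sizes are tracked by the class `Sz`. -/

open Complex Metric in
theorem circleIntegral_inv_sub_eq_ite {m w : ℂ} {r : ℝ} (hr : 0 < r) (hw : w ∉ sphere m r)
    [Decidable (w ∈ ball m r)] :
    (∮ z in C(m, r), (z - w)⁻¹) = if w ∈ ball m r then 2 * Real.pi * I else 0 := by
  split_ifs with h
  · exact circleIntegral.integral_sub_inv_of_mem_ball h
  · have hne : ∀ z ∈ closedBall m r, z - w ≠ 0 := by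
      intro z hz h0
      rw [sub_eq_zero.1 h0] at hz
      rw [← ball_union_sphere] at hz
      exact hz.elim h hw
    refine circleIntegral_eq_zero_of_differentiable_on_off_countable hr.le Set.countable_empty
      ?_ ?_
    · exact ContinuousOn.inv₀ (by fun_prop) hne
    · intro z hz
      exact DifferentiableAt.inv (by fun_prop) (hne z (ball_subset_closedBall hz.1))

open Complex Metric in
theorem circleIntegral_sum_inv_sub {m : ℂ} {r : ℝ} (hr : 0 < r) [DecidablePred (· ∈ ball m r)]
    (s : Multiset ℂ) (hs : ∀ w ∈ s, w ∉ sphere m r) :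
    CircleIntegrable (fun z => (s.map fun w => (z - w)⁻¹).sum) m r ∧
    (∮ z in C(m, r), (s.map fun w => (z - w)⁻¹).sum)
      = (s.filter (· ∈ ball m r)).card * (2 * Real.pi * I) := by
  induction s using Multiset.induction_on with
  | empty => simp [circleIntegral]
  | cons w s ih =>
    obtain ⟨h1, h2⟩ := ih (fun v hv => hs v (Multiset.mem_cons_of_mem hv))
    have hw := hs w (Multiset.mem_cons_self w s)
    have h3 : CircleIntegrable (fun z => (z - w)⁻¹) m r := by
      refine ContinuousOn.circleIntegrable hr.le (ContinuousOn.inv₀ (by fun_prop) ?_)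
      intro z hz h0
      rw [sub_eq_zero.1 h0] at hz
      exact hw hz
    simp only [Multiset.map_cons, Multiset.sum_cons]
    refine ⟨h3.add h1, ?_⟩
    rw [circleIntegral.integral_add h3 h1, h2, circleIntegral_inv_sub_eq_ite hr hw,
      Multiset.filter_cons]
    split_ifs <;> simp [add_mul, add_comm]

open Complex Metric in
/-- Pellet's theorem, in the form of Rouché's theorem for a comparison with a monomial. -/
theorem card_roots_of_norm_sub_lt {F : ℂ[X]} {m a : ℂ} {r : ℝ} {l : ℕ} (hr : 0 < r)
    [DecidablePred (· ∈ ball m r)]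
    (h : ∀ z ∈ sphere m r, ‖F.eval z - a * ((z - m) / r) ^ l‖ < ‖a‖) :
    (F.roots.filter (· ∈ ball m r)).card = l := by
  have hrC : (r : ℂ) ≠ 0 := by exact_mod_cast hr.ne'
  have hzm : ∀ z ∈ sphere m r, z - m ≠ 0 := by
    intro z hz h0
    rw [mem_sphere_iff_norm, h0, norm_zero] at hz
    exact hr.ne hz
  have hnorm : ∀ z ∈ sphere m r, ‖((z - m) / r) ^ l‖ = 1 := by
    intro z hz
    rw [mem_sphere_iff_norm] at hz
    rw [norm_pow, norm_div, hz, norm_real, Real.norm_of_nonneg hr.le, div_self hr.ne', one_pow]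
  have ha : a ≠ 0 := by
    rintro rfl
    have := h (m + r) (by simp [abs_of_pos hr])
    simp only [norm_zero] at this
    exact absurd this (not_lt.2 (norm_nonneg _))
  have hF : ∀ z ∈ sphere m r, F.eval z ≠ 0 := by
    intro z hz h0
    have := h z hz
    rw [h0, zero_sub, norm_neg, norm_mul, hnorm z hz, mul_one] at this
    exact lt_irrefl _ this
  have hF0 : F ≠ 0 := by
    rintro rfl
    exact hF (m + r) (by simp [abs_of_pos hr]) (by simp)
  have hroots : ∀ w ∈ F.roots, w ∉ sphere m r := fun w hw hs =>
    hF w hs ((mem_roots hF0).1 hw)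
  obtain ⟨hi, hI⟩ := circleIntegral_sum_inv_sub hr F.roots hroots
  -- The integrand is the logarithmic derivative of F divided by the monomial. On the circle that
  -- quotient stays within distance less than 1 of the point 1, so its principal logarithm is a
  -- primitive.
  have hlog : (∮ z in C(m, r), ((F.roots.map fun w => (z - w)⁻¹).sum - l * (z - m)⁻¹)) = 0 := by
    refine circleIntegral.integral_eq_zero_of_hasDerivWithinAt
      (f := fun z => log (F.eval z / (a * ((z - m) / r) ^ l))) hr.le ?_
    intro z hz
    have hq : a * ((z - m) / r) ^ l ≠ 0 :=
      mul_ne_zero ha (pow_ne_zero _ (div_ne_zero (hzm z hz) hrC))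
    have hslit : F.eval z / (a * ((z - m) / r) ^ l) ∈ slitPlane := by
      have : F.eval z / (a * ((z - m) / r) ^ l)
          = 1 + (F.eval z - a * ((z - m) / r) ^ l) / (a * ((z - m) / r) ^ l) := by
        rw [sub_div (F.eval z), div_self hq]; ring
      rw [this]
      refine mem_slitPlane_of_norm_lt_one ?_
      rw [norm_div, norm_mul, hnorm z hz, mul_one, div_lt_one (norm_pos_iff.2 ha)]
      exact h z hz
    have h1 : HasDerivAt (fun z : ℂ => a * ((z - m) / r) ^ l)
        (a * (l * ((z - m) / r) ^ (l - 1) * (1 / r))) z :=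
      ((((hasDerivAt_id z).sub_const m).div_const (r : ℂ)).pow l).const_mul a
    have h2 := ((F.hasDerivAt z).fun_div h1 hq).clog hslit
    refine (h2.congr_deriv ?_).hasDerivWithinAt
    have h3 := (IsAlgClosed.splits F).eval_derivative_div_eval_of_ne_zero (hF z hz)
    simp only [one_div] at h3
    rw [← h3]
    have hFz := hF z hz
    have hz' := hzm z hz
    -- The derivative of the l-th power contains the truncated difference l - 1, so l = 0 is
    -- separate.
    rcases Nat.eq_zero_or_pos l with rfl | hl
    · simp; field_simp
    · obtain ⟨j, rfl⟩ : ∃ j, l = j + 1 := ⟨l - 1, by omega⟩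
      obtain ⟨w, hw⟩ : ∃ w, z - m = w * r := ⟨(z - m) / r, by field_simp⟩
      have hw0 : w ≠ 0 := by rintro rfl; exact hz' (by rw [hw, zero_mul])
      rw [hw, mul_div_cancel_right₀ _ hrC, Nat.add_sub_cancel]
      field_simp
      ring
  have hi2 : CircleIntegrable (fun z => (l : ℂ) * (z - m)⁻¹) m r := by
    refine ContinuousOn.circleIntegrable hr.le ?_
    exact ContinuousOn.mul continuousOn_const (ContinuousOn.inv₀ (by fun_prop) hzm)
  rw [circleIntegral.integral_sub hi hi2, hI, circleIntegral.integral_const_mul,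
    circleIntegral.integral_sub_center_inv m hr.ne', sub_eq_zero] at hlog
  have := mul_right_cancel₀ two_pi_I_ne_zero hlog
  exact_mod_cast this

/-! ### The coefficients of the shifted polynomial -/

theorem eval_eq_sum_diskCoeff (f : ℝ[X]) (m z : ℂ) {r : ℝ} (hr : 0 < r) {N : ℕ}
    (hN : f.natDegree ≤ N) :
    (toComplex f).eval z = ∑ i ∈ Finset.range (N + 1), diskCoeff f m r i * ((z - m) / r) ^ i := by
  have hrC : (r : ℂ) ≠ 0 := by exact_mod_cast hr.ne'
  have h1 : (toComplex f).eval z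
      = ((toComplex f).comp (C m + C (r : ℂ) * X)).eval ((z - m) / r) := by
    rw [eval_comp]; congr 1; simp; field_simp; ring
  rw [h1, eval_eq_sum_range' (n := N + 1)]
  · rfl
  · refine Nat.lt_succ_of_le (natDegree_comp_le.trans ?_)
    have : (C m + C (r : ℂ) * X).natDegree ≤ 1 := by compute_degree
    calc _ ≤ (toComplex f).natDegree * 1 := Nat.mul_le_mul_left _ this
      _ ≤ N := by rw [mul_one]; exact (natDegree_map_le).trans hN

theorem diskCoeff_eq_taylorTerm (f : ℝ[X]) (m : ℂ) (r : ℝ) (i : ℕ) :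
    diskCoeff f m r i = taylorTerm (toComplex f) m r i := by
  have h1 : (toComplex f).comp (C m + C (r : ℂ) * X)
      = (taylor m (toComplex f)).comp (C (r : ℂ) * X) := by
    rw [taylor_apply, comp_assoc]; congr 1; simp [add_comm]
  rw [diskCoeff, h1, comp_C_mul_X_coeff, taylor_coeff, taylorTerm, ← factorial_smul_hasseDeriv,
    LinearMap.smul_apply, eval_smul, nsmul_eq_mul]
  have : (i.factorial : ℂ) ≠ 0 := by exact_mod_cast Nat.factorial_ne_zero i
  field_simp

theorem diskCoeff_eq_zero (f : ℝ[X]) (m : ℂ) (r : ℝ) {i : ℕ} (h : f.natDegree < i) :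
    diskCoeff f m r i = 0 := by
  refine coeff_eq_zero_of_natDegree_lt (lt_of_le_of_lt natDegree_comp_le ?_)
  have : (C m + C (r : ℂ) * X).natDegree ≤ 1 := by compute_degree
  calc _ ≤ (toComplex f).natDegree * 1 := Nat.mul_le_mul_left _ this
    _ < i := by rw [mul_one]; exact (natDegree_map_le).trans_lt h

theorem natDegree_sparsePoly_le {n k : ℕ} {e : Fin k → ℕ} (c : Fin k → ℝ) (h : ∀ j, e j ≤ n) :
    (sparsePoly e c).natDegree ≤ n :=
  natDegree_sum_le_of_forall_le _ _ fun j _ => (natDegree_C_mul_X_pow_le _ _).trans (h j)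

theorem diskCoeff_sparsePoly {k : ℕ} (e : Fin k → ℕ) (c : Fin k → ℝ) (m : ℂ) (r : ℝ) (i : ℕ) :
    diskCoeff (sparsePoly e c) m r i
      = (∑ j, (c j : ℂ) * ((e j).choose i : ℂ) * m ^ (e j - i)) * (r : ℂ) ^ i := by
  rw [diskCoeff, toComplex, sparsePoly, Polynomial.map_sum, ← coe_compRingHom_apply, map_sum,
    finsetSum_coeff, Finset.sum_mul]
  refine Finset.sum_congr rfl fun j _ => ?_
  have : (compRingHom (C m + C (r : ℂ) * X)) (Polynomial.map (algebraMap ℝ ℂ) (C (c j) * X ^ e j))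
      = C (c j : ℂ) * ((X + C m) ^ e j).comp (C (r : ℂ) * X) := by
    simp [add_comm]
  rw [this, coeff_C_mul, comp_C_mul_X_coeff, coeff_X_add_C_pow]
  ring

theorem natDegree_eq_natDegree_toComplex (f : ℝ[X]) : (toComplex f).natDegree = f.natDegree :=
  natDegree_map _

theorem IsNomial.sparsePoly_ne_zero {n k : ℕ} {τ : ℝ} {e : Fin k → ℕ} {c : Fin k → ℝ}
    (h : IsNomial n k τ e c) : sparsePoly e c ≠ 0 := by
  have hk := h.two_le
  let j : Fin k := ⟨0, by omega⟩
  intro h0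
  have h1 : (sparsePoly e c).coeff (e j) = c j := by
    rw [sparsePoly, finsetSum_coeff, Finset.sum_eq_single j]
    · simp
    · intro b _ hb
      rw [coeff_C_mul_X_pow, if_neg fun h' => hb (h.strictMono.injective h'.symm)]
    · simp
  have h2 := h.le_abs j
  rw [← h1, h0, coeff_zero, abs_zero] at h2
  exact absurd h2 (not_le.2 (by positivity))

theorem IsNomial.natDegree_le {n k : ℕ} {τ : ℝ} {e : Fin k → ℕ} {c : Fin k → ℝ}
    (h : IsNomial n k τ e c) : (sparsePoly e c).natDegree ≤ n :=
  natDegree_sparsePoly_le c h.exponent_le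

theorem IsNomial.le_add_one {n k : ℕ} {τ : ℝ} {e : Fin k → ℕ} {c : Fin k → ℝ}
    (h : IsNomial n k τ e c) : k ≤ n + 1 := by
  have := Fintype.card_le_of_injective
    (fun j : Fin k => (⟨e j, Nat.lt_succ_of_le (h.exponent_le j)⟩ : Fin (n + 1)))
    (fun a b hab => h.strictMono.injective (by simpa using hab))
  simpa using this

/-! ### The test detects the number of roots -/

/-- On the boundary circle (z-m)/r has modulus 1, so the triangle inequality turns the coefficient
condition into the hypothesis of the comparison with a monomial. -/
theorem rootsInDisk_eq_of_sum_lt {f : ℝ[X]} {m : ℂ} {r : ℝ} (hr : 0 < r) {l N : ℕ} (hl : l ≤ N)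
    (hN : f.natDegree ≤ N)
    (h : ∑ i ∈ (Finset.range (N + 1)).erase l, ‖diskCoeff f m r i‖ < ‖diskCoeff f m r l‖) :
    rootsInDisk f m r = l := by
  classical
  unfold rootsInDisk
  have := card_roots_of_norm_sub_lt (F := toComplex f) (m := m) (a := diskCoeff f m r l) (l := l)
    hr ?_
  · convert this
  intro z hz
  have hw : ‖(z - m) / (r : ℂ)‖ = 1 := by
    rw [mem_sphere_iff_norm] at hz
    rw [norm_div, hz, Complex.norm_real, Real.norm_of_nonneg hr.le, div_self hr.ne']
  rw [eval_eq_sum_diskCoeff f m z hr hN, ← Finset.add_sum_erase _ _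
    (Finset.mem_range.2 (Nat.lt_succ_of_le hl)), add_sub_cancel_left]
  refine (norm_sum_le _ _).trans_lt (lt_of_eq_of_lt (Finset.sum_congr rfl fun i _ => ?_) h)
  rw [norm_mul, norm_pow, hw, one_pow, mul_one]

theorem rootsInDisk_eq_of_rhsExpr_lt {n k l : ℕ} {f : ℝ[X]} {m : ℂ} {r : ℝ} (hr : 0 < r)
    (hn : f.natDegree ≤ n) (hl : l ≤ k ^ 2) (htail : TailAssumption n k f m r)
    (h : rhsExpr k f m r l < lhsExpr f m r l) : rootsInDisk f m r = l := by
  refine rootsInDisk_eq_of_sum_lt hr (N := max n (k ^ 2)) (le_max_of_le_right hl)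
    (le_max_of_le_left hn) ?_
  have hsplit : (Finset.range (max n (k ^ 2) + 1)).erase l
      = (Finset.range (k ^ 2 + 1)).erase l ∪ Finset.Ioc (k ^ 2) n := by
    ext i
    simp only [Finset.mem_erase, Finset.mem_range, Finset.mem_union, Finset.mem_Ioc]
    omega
  have hdisj : Disjoint ((Finset.range (k ^ 2 + 1)).erase l) (Finset.Ioc (k ^ 2) n) := by
    rw [Finset.disjoint_left]
    intro i
    simp only [Finset.mem_erase, Finset.mem_range, Finset.mem_Ioc]
    omega
  rw [hsplit, Finset.sum_union hdisj]
  unfold TailAssumption at htail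
  unfold rhsExpr lhsExpr at h
  rcases Nat.eq_zero_or_pos l with rfl | hl0
  -- Here |a_0| is itself the large side, and 64/65 + 1/128 < 1.
  · have := norm_nonneg (diskCoeff f m r 0)
    have h3 : 0 ≤ ∑ i ∈ (Finset.range (k ^ 2 + 1)).erase 0, ‖diskCoeff f m r i‖ :=
      Finset.sum_nonneg fun i _ => norm_nonneg _
    linarith
  -- Now |a_0| is one of the summands, so the tail is at most 1/128 of the sum, less than the
  -- surplus 1/64.
  · have h2 : ‖diskCoeff f m r 0‖
        ≤ ∑ i ∈ (Finset.range (k ^ 2 + 1)).erase l, ‖diskCoeff f m r i‖ :=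
      Finset.single_le_sum (f := fun i => ‖diskCoeff f m r i‖) (fun i _ => norm_nonneg _)
        (by simp; omega)
    have := norm_nonneg (diskCoeff f m r 0)
    linarith

/-- The factor 3/2 exceeds 65/64, which excludes False, and 65/64·129/128, which excludes Undecided.
Coefficients beyond the degree vanish, so the sum up to k² is no larger than the one in the Pellet
test. -/
theorem SoftSpec.eq_yes_of_pelletSucceeds {k l : ℕ} {f : ℝ[X]} {m : ℂ} {r : ℝ} {v : Verdict}
    (hv : SoftSpec (1 / 128) (lhsExpr f m r l) (rhsExpr k f m r l) v)
    (h : PelletSucceeds l m r (3 / 2) (toComplex f)) : v = .yes := by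
  unfold PelletSucceeds at h
  simp only [← diskCoeff_eq_taylorTerm, natDegree_eq_natDegree_toComplex] at h
  have h1 : ∑ i ∈ (Finset.range (k ^ 2 + 1)).erase l, ‖diskCoeff f m r i‖
      ≤ ∑ i ∈ (Finset.range (f.natDegree + 1)).erase l, ‖diskCoeff f m r i‖ := by
    rw [← Finset.sum_filter_ne_zero]
    refine Finset.sum_le_sum_of_subset_of_nonneg (fun i hi => ?_) fun i _ _ => norm_nonneg _
    simp only [Finset.mem_filter, Finset.mem_erase, Finset.mem_range] at hi ⊢
    refine ⟨hi.1.1, ?_⟩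
    by_contra hlt
    exact hi.2 (by rw [diskCoeff_eq_zero f m r (by omega), norm_zero])
  have h3 : 0 ≤ ∑ i ∈ (Finset.range (k ^ 2 + 1)).erase l, ‖diskCoeff f m r i‖ :=
    Finset.sum_nonneg fun i _ => norm_nonneg _
  unfold lhsExpr rhsExpr SoftSpec at hv
  cases v with
  | yes => rfl
  | no => simp only at hv; linarith
  | undecided => simp only at hv; obtain ⟨hv1, -⟩ := hv; linarith

/-! ### Precision of the test -/

theorem certifies_yes {δ x y : ℝ} {L : ℕ} (h : 2 / (2 : ℝ) ^ L ≤ x - y) :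
    Certifies δ L x y .yes := by
  intro E E' _ _ h1 h2
  have h1' := abs_lt.1 h1
  have h2' := abs_lt.1 h2
  have h3 : 2 / (2 : ℝ) ^ L = 1 / 2 ^ L + 1 / 2 ^ L := by ring
  show E' < E
  linarith [h1'.1, h1'.2, h2'.1, h2'.2]

theorem certifies_no {δ x y : ℝ} {L : ℕ} (h : 2 / (2 : ℝ) ^ L ≤ y - x) :
    Certifies δ L x y .no := by
  intro E E' _ _ h1 h2
  have h1' := abs_lt.1 h1
  have h2' := abs_lt.1 h2
  have h3 : 2 / (2 : ℝ) ^ L = 1 / 2 ^ L + 1 / 2 ^ L := by ring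
  show E ≤ E'
  linarith [h1'.1, h1'.2, h2'.1, h2'.2]

/-- With ε = 2^(-L), the numbers F and F' differ by less than 4ε. Going from the larger of E, E'
through x and y to F or F' loses at most 4ε, so both are at least 514ε. Since 4·128 = 512, the
difference is below 1/128 of either. -/
theorem certifies_undecided {x y E E' : ℝ} {L : ℕ} (h : |x - y| < 2 / (2 : ℝ) ^ L)
    (hx : IsBitApprox L x E) (hy : IsBitApprox L y E') (hE : 518 / (2 : ℝ) ^ L ≤ max E E') :
    Certifies (1 / 128) L x y .undecided := by
  intro F F' _ _ h1 h2
  have hx' := abs_lt.1 hx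
  have hy' := abs_lt.1 hy
  have h1' := abs_lt.1 h1
  have h2' := abs_lt.1 h2
  have h' := abs_lt.1 h
  have h3 : 2 / (2 : ℝ) ^ L = 2 * (1 / 2 ^ L) := by ring
  have h4 : 518 / (2 : ℝ) ^ L = 518 * (1 / 2 ^ L) := by ring
  have h5 : (0 : ℝ) < 1 / 2 ^ L := by positivity
  rw [h3] at h'
  rw [h4] at hE
  generalize 1 / (2 : ℝ) ^ L = ε at *
  show 1 / (1 + 1 / 128) * F < F' ∧ F' ≤ (1 + 1 / 128) * F
  rcases le_max_iff.1 hE with hE | hE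
  · constructor <;> linarith [hx'.1, hx'.2, hy'.1, hy'.2, h1'.1, h1'.2, h2'.1, h2'.2, h'.1, h'.2]
  · constructor <;> linarith [hx'.1, hx'.2, hy'.1, hy'.2, h1'.1, h1'.2, h2'.1, h2'.2, h'.1, h'.2]

theorem exists_certifies {x y E E' : ℝ} {L : ℕ}
    (hx : IsBitApprox L x E) (hy : IsBitApprox L y E') (hE : 518 / (2 : ℝ) ^ L ≤ max E E') :
    ∃ v, Certifies (1 / 128) L x y v := by
  by_cases h1 : 2 / (2 : ℝ) ^ L ≤ x - y
  · exact ⟨_, certifies_yes h1⟩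
  by_cases h2 : 2 / (2 : ℝ) ^ L ≤ y - x
  · exact ⟨_, certifies_no h2⟩
  · exact ⟨_, certifies_undecided (abs_lt.2 ⟨by linarith, by linarith⟩) hx hy hE⟩

theorem norm_diskCoeff_le_maxCoeff (f : ℝ[X]) (m : ℂ) (r : ℝ) {n i : ℕ} (hn : f.natDegree ≤ n) :
    ‖diskCoeff f m r i‖ ≤ maxCoeff f m r n := by
  unfold maxCoeff
  rcases le_or_gt i n with hi | hi
  · exact Finset.le_sup' (fun i => ‖diskCoeff f m r i‖)
      (Finset.mem_range.2 (Nat.lt_succ_of_le hi))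
  · rw [diskCoeff_eq_zero f m r (hn.trans_lt hi), norm_zero]
    exact (norm_nonneg _).trans (Finset.le_sup' (fun i => ‖diskCoeff f m r i‖)
      (Finset.mem_range.2 (Nat.succ_pos n)))

/-- Beyond k² every |a_i| is at most |a_0|/128, so a maximum attained there is also attained at 0.
-/
theorem exists_norm_diskCoeff_eq_maxCoeff {n k : ℕ} {f : ℝ[X]} {m : ℂ} {r : ℝ}
    (hn : f.natDegree ≤ n) (htail : TailAssumption n k f m r) :
    ∃ i ≤ k ^ 2, ‖diskCoeff f m r i‖ = maxCoeff f m r n := by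
  obtain ⟨i, hi, h⟩ := Finset.exists_mem_eq_sup' Finset.nonempty_range_add_one
    (fun i => ‖diskCoeff f m r i‖) (s := Finset.range (n + 1))
  rw [Finset.mem_range] at hi
  rcases le_or_gt i (k ^ 2) with hik | hik
  · exact ⟨i, hik, h.symm⟩
  · refine ⟨0, Nat.zero_le _, le_antisymm (norm_diskCoeff_le_maxCoeff f m r hn) ?_⟩
    have h1 : ‖diskCoeff f m r i‖ ≤ ‖diskCoeff f m r 0‖ / 128 :=
      (Finset.single_le_sum (f := fun i => ‖diskCoeff f m r i‖) (fun i _ => norm_nonneg _)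
        (by simp; omega)).trans htail
    have h2 : maxCoeff f m r n = ‖diskCoeff f m r i‖ := h
    rw [h2]
    linarith [norm_nonneg (diskCoeff f m r 0)]

theorem maxCoeff_pos {n : ℕ} {f : ℝ[X]} {m : ℂ} {r : ℝ} (hr : 0 < r) (hf : f ≠ 0)
    (hn : f.natDegree ≤ n) : 0 < maxCoeff f m r n := by
  by_contra h
  have h0 : ∀ i, diskCoeff f m r i = 0 := fun i =>
    norm_le_zero_iff.1 ((norm_diskCoeff_le_maxCoeff f m r hn).trans (not_lt.1 h))
  have h1 : toComplex f = 0 := by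
    refine funext fun z => ?_
    rw [eval_eq_sum_diskCoeff f m z hr le_rfl]
    simp [h0]
  exact hf ((Polynomial.map_eq_zero _).1 h1)

/-- Each index up to k² is counted on one of the two sides of the test, hence the sides cannot both
be small compared to the largest coefficient. -/
theorem maxCoeff_le_max {n k l : ℕ} {f : ℝ[X]} {m : ℂ} {r : ℝ}
    (hn : f.natDegree ≤ n) (htail : TailAssumption n k f m r) :
    maxCoeff f m r n ≤ max (lhsExpr f m r l) (rhsExpr k f m r l) := by
  obtain ⟨i, hi, h⟩ := exists_norm_diskCoeff_eq_maxCoeff hn htail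
  rw [← h]
  by_cases hil : i = l
  · exact le_max_of_le_left (by rw [hil]; exact le_rfl)
  · refine le_max_of_le_right ?_
    have h1 : ‖diskCoeff f m r i‖
        ≤ ∑ i ∈ (Finset.range (k ^ 2 + 1)).erase l, ‖diskCoeff f m r i‖ :=
      Finset.single_le_sum (f := fun i => ‖diskCoeff f m r i‖) (fun i _ => norm_nonneg _)
        (by simp; omega)
    unfold rhsExpr
    linarith [norm_nonneg (diskCoeff f m r i)]

/-- The second alternative says L ≤ 10 - 2 log M, and log n ≥ 0; the first one is covered by the
least value 2·(4+1) of the bound. -/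
theorem le_precisionBound {n L : ℕ} {f : ℝ[X]} {m : ℂ} {r : ℝ} (hn : 1 ≤ n)
    (hM : 0 < maxCoeff f m r n)
    (h : L ≤ 10 ∨ (2 : ℝ) ^ L * maxCoeff f m r n ^ 2 ≤ 2 ^ 10) :
    (L : ℝ) ≤ precisionBound n f m r := by
  unfold precisionBound
  have hlog : 0 ≤ Real.logb 2 n := Real.logb_nonneg one_lt_two (by exact_mod_cast hn)
  rcases h with h | h
  · have h1 : (L : ℝ) ≤ 10 := by exact_mod_cast h
    linarith [le_max_left 1 (1 + Real.logb 2 n - Real.logb 2 (maxCoeff f m r n))]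
  · have h1 : Real.logb 2 ((2 : ℝ) ^ L * maxCoeff f m r n ^ 2) ≤ Real.logb 2 (2 ^ 10) :=
      Real.logb_le_logb_of_le one_lt_two (by positivity) h
    rw [Real.logb_mul (by positivity) (by positivity), Real.logb_pow, Real.logb_pow,
      Real.logb_pow, Real.logb_self_eq_one one_lt_two] at h1
    push_cast at h1
    linarith [le_max_right 1 (1 + Real.logb 2 n - Real.logb 2 (maxCoeff f m r n))]

theorem exists_precision {n k l : ℕ} {f : ℝ[X]} {m : ℂ} {r : ℝ} (h1n : 1 ≤ n)
    (hn : f.natDegree ≤ n) (htail : TailAssumption n k f m r) (hM : 0 < maxCoeff f m r n) :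
    ∃ L : ℕ, 1 ≤ L ∧ (L : ℝ) ≤ precisionBound n f m r ∧
      ∀ x y : ℝ, IsBitApprox L x (lhsExpr f m r l) → IsBitApprox L y (rhsExpr k f m r l) →
        ∃ v : Verdict, Certifies (1 / 128) L x y v := by
  have hex : ∃ t : ℕ, 518 ≤ (2 : ℝ) ^ (9 + 2 ^ t) * maxCoeff f m r n := by
    obtain ⟨t, ht⟩ := pow_unbounded_of_one_lt (518 / maxCoeff f m r n) one_lt_two
    refine ⟨t, ?_⟩
    rw [div_lt_iff₀ hM] at ht
    refine ht.le.trans (mul_le_mul_of_nonneg_right ?_ hM.le)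
    exact pow_le_pow_right₀ one_le_two (Nat.lt_two_pow_self.le.trans (Nat.le_add_left _ _))
  classical
  refine ⟨9 + 2 ^ Nat.find hex, Nat.le_add_right_of_le (by norm_num), le_precisionBound h1n hM ?_, fun x y hx hy => ?_⟩
  · rcases h : Nat.find hex with _ | t
    · left; norm_num
    · right
      -- The precision with half the exponent failed. Squaring that failure doubles the exponent and
      -- gives 2^L M² ≤ 518²/2^9 < 2^10.
      have ht := not_le.1 (Nat.find_min hex (m := t) (by omega))
      have h2 : ((2 : ℝ) ^ (9 + 2 ^ t) * maxCoeff f m r n) ^ 2 ≤ 518 ^ 2 :=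
        pow_le_pow_left₀ (by positivity) ht.le 2
      have h3 : ((2 : ℝ) ^ (9 + 2 ^ t) * maxCoeff f m r n) ^ 2
          = 2 ^ 9 * (2 ^ (9 + 2 ^ (t + 1)) * maxCoeff f m r n ^ 2) := by ring
      rw [h3] at h2
      linarith
  · refine exists_certifies hx hy (le_trans ?_ (maxCoeff_le_max hn htail))
    rw [div_le_iff₀ (by positivity), mul_comm]
    exact Nat.find_spec hex

end SparseRoots

namespace SparseRoots

/-! ### A program logic with cost bounds -/

/-- Sequential composition of a list of commands. -/
def Cmd.block : List Cmd → Cmd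
  | [] => .skip
  | p :: ps => .seq p (block ps)

/-- The registers a command may write to. -/
def Cmd.writes : Cmd → List ℕ
  | .skip => []
  | .const d _ => [d]
  | .add d _ _ => [d]
  | .sub d _ _ => [d]
  | .mul d _ _ => [d]
  | .div d _ _ => [d]
  | .load d _ => [d]
  | .store _ _ => []
  | .query d _ _ => [d]
  | .seq p q => p.writes ++ q.writes
  | .ite _ p q => p.writes ++ q.writes
  | .loop _ p => p.writes

/-- Does the command contain a `store`? -/
def Cmd.stores : Cmd → Bool
  | .store _ _ => true
  | .seq p q => p.stores || q.stores
  | .ite _ p q => p.stores || q.stores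
  | .loop _ p => p.stores
  | _ => false

@[simp] theorem State.setReg_reg (s : State) (d x : ℕ) (z : ℤ) :
    (s.setReg d z).reg x = if x = d then z else s.reg x := by
  simp [State.setReg, Function.update_apply]

@[simp] theorem State.setReg_mem (s : State) (d : ℕ) (z : ℤ) : (s.setReg d z).mem = s.mem := rfl

@[simp] theorem State.setMem_reg (s : State) (i : ℕ) (z : ℤ) : (s.setMem i z).reg = s.reg := rfl

@[simp] theorem State.setMem_mem (s : State) (i x : ℕ) (z : ℤ) :
    (s.setMem i z).mem x = if x = i then z else s.mem x := by
  simp [State.setMem, Function.update_apply]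

/-- `s'` agrees with `s` outside of what `p` may change. -/
def Frame (p : Cmd) (s s' : State) : Prop :=
  (∀ x, x ∉ p.writes → s'.reg x = s.reg x) ∧ (p.stores = false → s'.mem = s.mem)

theorem Frame.refl (p : Cmd) (s : State) : Frame p s s := ⟨fun _ _ => rfl, fun _ => rfl⟩

theorem Frame.trans {p : Cmd} {s s' s'' : State} (h : Frame p s s') (h' : Frame p s' s'') :
    Frame p s s'' :=
  ⟨fun x hx => (h'.1 x hx).trans (h.1 x hx), fun hp => (h'.2 hp).trans (h.2 hp)⟩

theorem Exec.frame {O : ℕ → ℕ → ℤ} {p : Cmd} {s s' : State} {t : ℕ} (h : Exec O p s t s') :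
    Frame p s s' := by
  induction h with
  | skip s => exact Frame.refl _ _
  | const s d z => exact ⟨fun x hx => by simp_all [Cmd.writes], fun _ => rfl⟩
  | add s d a b => exact ⟨fun x hx => by simp_all [Cmd.writes], fun _ => rfl⟩
  | sub s d a b => exact ⟨fun x hx => by simp_all [Cmd.writes], fun _ => rfl⟩
  | mul s d a b => exact ⟨fun x hx => by simp_all [Cmd.writes], fun _ => rfl⟩
  | div s d a b => exact ⟨fun x hx => by simp_all [Cmd.writes], fun _ => rfl⟩
  | load s d a => exact ⟨fun x hx => by simp_all [Cmd.writes], fun _ => rfl⟩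
  | store s a b => exact ⟨fun x hx => rfl, fun h => by simp [Cmd.stores] at h⟩
  | query s d a b => exact ⟨fun x hx => by simp_all [Cmd.writes], fun _ => rfl⟩
  | seq _ _ ih1 ih2 =>
    refine ⟨fun x hx => ?_, fun h => ?_⟩
    · simp only [Cmd.writes, List.mem_append, not_or] at hx
      rw [ih2.1 x hx.2, ih1.1 x hx.1]
    · simp only [Cmd.stores, Bool.or_eq_false_iff] at h
      rw [ih2.2 h.2, ih1.2 h.1]
  | ite_pos _ _ ih =>
    refine ⟨fun x hx => ?_, fun h => ?_⟩
    · simp only [Cmd.writes, List.mem_append, not_or] at hx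
      exact ih.1 x hx.1
    · simp only [Cmd.stores, Bool.or_eq_false_iff] at h
      exact ih.2 h.1
  | ite_neg _ _ ih =>
    refine ⟨fun x hx => ?_, fun h => ?_⟩
    · simp only [Cmd.writes, List.mem_append, not_or] at hx
      exact ih.1 x hx.2
    · simp only [Cmd.stores, Bool.or_eq_false_iff] at h
      exact ih.2 h.2
  | loop_stop _ => exact Frame.refl _ _
  | loop_step _ _ _ ih1 ih2 =>
    exact ⟨fun x hx => (ih2.1 x hx).trans (ih1.1 x hx), fun h => (ih2.2 h).trans (ih1.2 h)⟩

/-- A bound for the cost of an instruction, apart from those of its subcommands, all of whose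
operands have at most `b` bits. -/
def unitCost (b : ℕ) : ℕ := 4 * b * (1 + Nat.log 2 (2 * b)) ^ 2

/-- The factor 4 is set by the oracle query, whose charge has four parts of at most b each. -/
theorem mul_le_unitCost {b x : ℕ} (h : x ≤ 4 * b) : x ≤ unitCost b :=
  h.trans (Nat.le_mul_of_pos_right _ (by positivity))

theorem mulCost_le_unitCost {b : ℕ} {x y : ℤ} (hx : bits x ≤ b) (hy : bits y ≤ b) :
    mulCost x y ≤ unitCost b := by
  have h : bits x + bits y ≤ 2 * b := by omega
  exact Nat.mul_le_mul (by omega)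
    (Nat.pow_le_pow_left (Nat.add_le_add_left (Nat.log_mono_right h) _) 2)

/-- Started in `s`, the program `p` halts in a state with property `Q` at the cost of at most `N`
instructions with operands of `b` bits. -/
def Tri (O : ℕ → ℕ → ℤ) (b : ℕ) (p : Cmd) (N : ℕ) (s : State) (Q : State → Prop) : Prop :=
  ∃ t s', Exec O p s t s' ∧ t ≤ N * unitCost b ∧ Q s'

section Rules

variable {O : ℕ → ℕ → ℤ} {b : ℕ}

theorem Tri.mono {p : Cmd} {N N' : ℕ} {s : State} {Q Q' : State → Prop}
    (h : Tri O b p N s Q) (hN : N ≤ N') (hQ : ∀ s', Frame p s s' → Q s' → Q' s') :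
    Tri O b p N' s Q' := by
  obtain ⟨t, s', h1, h2, h3⟩ := h
  exact ⟨t, s', h1, h2.trans (Nat.mul_le_mul_right _ hN), hQ s' h1.frame h3⟩

theorem Tri.seq {p q : Cmd} {N N' : ℕ} {s : State} {R Q : State → Prop}
    (h : Tri O b p N s R) (h' : ∀ s', Frame p s s' → R s' → Tri O b q N' s' Q) :
    Tri O b (.seq p q) (N + N') s Q := by
  obtain ⟨t, s', h1, h2, h3⟩ := h
  obtain ⟨t', s'', h4, h5, h6⟩ := h' s' h1.frame h3
  exact ⟨t + t', s'', h1.seq h4, by rw [add_mul]; exact Nat.add_le_add h2 h5, h6⟩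

theorem Tri.cons {p : Cmd} {ps : List Cmd} {N N' : ℕ} {s : State} {R Q : State → Prop}
    (h : Tri O b p N s R) (h' : ∀ s', Frame p s s' → R s' → Tri O b (.block ps) N' s' Q) :
    Tri O b (.block (p :: ps)) (N + N') s Q :=
  Tri.seq h h'

theorem Tri.skip (hb : 1 ≤ b) {s : State} {Q : State → Prop} (h : Q s) : Tri O b .skip 1 s Q :=
  ⟨1, s, .skip s, by rw [one_mul]; exact mul_le_unitCost (by omega), h⟩

theorem Tri.nil (hb : 1 ≤ b) {s : State} {Q : State → Prop} (h : Q s) :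
    Tri O b (.block []) 1 s Q := Tri.skip hb h

theorem Tri.ite {a : ℕ} {p q : Cmd} {N N' : ℕ} {s : State} {Q : State → Prop}
    (ha : bits (s.reg a) ≤ b) (h1 : 0 < s.reg a → Tri O b p N s Q)
    (h2 : s.reg a ≤ 0 → Tri O b q N' s Q) : Tri O b (.ite a p q) (N + N' + 1) s Q := by
  have ha' : bits (s.reg a) ≤ unitCost b := mul_le_unitCost (by omega)
  rcases lt_or_ge 0 (s.reg a) with h | h
  · obtain ⟨t, s', h3, h4, h5⟩ := h1 h
    refine ⟨_, s', .ite_pos h h3, ?_, h5⟩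
    rw [add_mul, add_mul, one_mul]; omega
  · obtain ⟨t, s', h3, h4, h5⟩ := h2 h
    refine ⟨_, s', .ite_neg h h3, ?_, h5⟩
    rw [add_mul, add_mul, one_mul]; omega

/-- The invariant is indexed by an upper bound j for the number of iterations left: continuing
requires j to be a successor, while leaving early is always allowed. The frame condition relative to
the initial state spares the invariant all registers that the body does not write. -/
theorem Tri.loop {a : ℕ} {p : Cmd} {N : ℕ} {s₀ : State} {Q : State → Prop}
    (I : ℕ → State → Prop) (j₀ : ℕ) (h₀ : I j₀ s₀)
    (hstep : ∀ j s, I j s → Frame p s₀ s → bits (s.reg a) ≤ b ∧ (s.reg a ≤ 0 → Q s) ∧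
      (0 < s.reg a → ∃ j', j = j' + 1 ∧ Tri O b p N s (I j'))) :
    Tri O b (.loop a p) (j₀ * (N + 1) + 1) s₀ Q := by
  have key : ∀ j s, I j s → Frame p s₀ s → Tri O b (.loop a p) (j * (N + 1) + 1) s Q := by
    intro j
    induction j with
    | zero =>
      intro s hI hf
      obtain ⟨h1, h2, h3⟩ := hstep 0 s hI hf
      rcases lt_or_ge 0 (s.reg a) with h | h
      · obtain ⟨j', hj', -⟩ := h3 h
        omega
      · refine ⟨_, s, Exec.loop_stop h, ?_, h2 h⟩
        rw [zero_mul, zero_add, one_mul]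
        exact mul_le_unitCost (by omega)
    | succ j ih =>
      intro s hI hf
      obtain ⟨h1, h2, h3⟩ := hstep _ s hI hf
      have ha' : bits (s.reg a) ≤ unitCost b := mul_le_unitCost (by omega)
      rcases lt_or_ge 0 (s.reg a) with h | h
      · obtain ⟨j', hj', t, s', h4, h5, h6⟩ := h3 h
        obtain rfl : j = j' := by omega
        obtain ⟨t', s'', h7, h8, h9⟩ := ih s' h6 (hf.trans h4.frame)
        refine ⟨_, s'', .loop_step h h4 h7, ?_, h9⟩
        calc bits (s.reg a) + t + t'
            ≤ unitCost b + N * unitCost b + (j * (N + 1) + 1) * unitCost b := by omega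
          _ = ((j + 1) * (N + 1) + 1) * unitCost b := by ring
      · refine ⟨_, s, Exec.loop_stop h, ha'.trans ?_, h2 h⟩
        exact Nat.le_mul_of_pos_left _ (by positivity)
  exact key j₀ s₀ h₀ (Frame.refl _ _)

end Rules

/-- Number of instructions of a loop-free command. -/
def Cmd.length : Cmd → ℕ
  | .seq p q => p.length + q.length
  | .ite _ p q => p.length + q.length + 1
  | .loop _ _ => 0
  | _ => 1

/-- Weakest precondition of a loop-free command for halting in a state with property `Q`,
with all operands of at most `b` bits. -/
def wp (O : ℕ → ℕ → ℤ) (b : ℕ) : Cmd → State → (State → Prop) → Prop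
  | .skip, s, Q => Q s
  | .const d z, s, Q => bits z ≤ b ∧ Q (s.setReg d z)
  | .add d x y, s, Q => (bits (s.reg x) ≤ b ∧ bits (s.reg y) ≤ b) ∧
      ∀ v, v = s.reg x + s.reg y → Q (s.setReg d v)
  | .sub d x y, s, Q => (bits (s.reg x) ≤ b ∧ bits (s.reg y) ≤ b) ∧
      ∀ v, v = s.reg x - s.reg y → Q (s.setReg d v)
  | .mul d x y, s, Q => (bits (s.reg x) ≤ b ∧ bits (s.reg y) ≤ b) ∧
      ∀ v, v = s.reg x * s.reg y → Q (s.setReg d v)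
  | .div d x y, s, Q => (bits (s.reg x) ≤ b ∧ bits (s.reg y) ≤ b) ∧
      ∀ v, v = s.reg x / s.reg y → Q (s.setReg d v)
  | .load d x, s, Q => (bits (s.reg x) ≤ b ∧ bits (s.mem (s.reg x).toNat) ≤ b) ∧
      ∀ v, v = s.mem (s.reg x).toNat → Q (s.setReg d v)
  | .store x y, s, Q => (bits (s.reg x) ≤ b ∧ bits (s.reg y) ≤ b) ∧
      Q (s.setMem (s.reg x).toNat (s.reg y))
  | .query d x y, s, Q => ((bits (s.reg x) ≤ b ∧ bits (s.reg y) ≤ b) ∧ (s.reg y).toNat ≤ b ∧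
      bits (O (s.reg x).toNat (s.reg y).toNat) ≤ b) ∧
      ∀ v, v = O (s.reg x).toNat (s.reg y).toNat → Q (s.setReg d v)
  | .seq p q, s, Q => wp O b p s fun s' => wp O b q s' Q
  | .ite x p q, s, Q => bits (s.reg x) ≤ b ∧ (0 < s.reg x → wp O b p s Q) ∧
      (s.reg x ≤ 0 → wp O b q s Q)
  | .loop _ _, _, _ => False

/-- Reduces a loop-free block to symbolic evaluation, which the simplifier carries out together with
the operand bounds from `Sz`. -/
theorem Tri.of_wp {O : ℕ → ℕ → ℤ} {b : ℕ} (hb : 1 ≤ b) {p : Cmd} {s : State} {Q : State → Prop}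
    (h : wp O b p s Q) : Tri O b p p.length s Q := by
  induction p generalizing s Q with
  | skip => exact Tri.skip hb h
  | const d z =>
    exact ⟨_, _, .const s d z, by simp only [Cmd.length, one_mul]; exact mul_le_unitCost (by have := h.1; omega), h.2⟩
  | add d x y =>
    refine ⟨_, _, .add s d x y, ?_, h.2 _ rfl⟩
    simp only [Cmd.length, one_mul]; exact mul_le_unitCost (by have := h.1; omega)
  | sub d x y =>
    refine ⟨_, _, .sub s d x y, ?_, h.2 _ rfl⟩
    simp only [Cmd.length, one_mul]; exact mul_le_unitCost (by have := h.1; omega)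
  | mul d x y =>
    refine ⟨_, _, .mul s d x y, ?_, h.2 _ rfl⟩
    simp only [Cmd.length, one_mul]; exact mulCost_le_unitCost h.1.1 h.1.2
  | div d x y =>
    refine ⟨_, _, .div s d x y, ?_, h.2 _ rfl⟩
    simp only [Cmd.length, one_mul]; exact mulCost_le_unitCost h.1.1 h.1.2
  | load d x =>
    refine ⟨_, _, .load s d x, ?_, h.2 _ rfl⟩
    simp only [Cmd.length, one_mul]; exact mul_le_unitCost (by have := h.1; omega)
  | store x y =>
    refine ⟨_, _, .store s x y, ?_, h.2⟩
    simp only [Cmd.length, one_mul]; exact mul_le_unitCost (by have := h.1; omega)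
  | query d x y =>
    refine ⟨_, _, .query s d x y, ?_, h.2 _ rfl⟩
    simp only [Cmd.length, one_mul]; exact mul_le_unitCost (by have := h.1; omega)
  | seq p q ihp ihq => exact Tri.seq (ihp h) fun s' _ h' => ihq h'
  | ite x p q ihp ihq => exact Tri.ite h.1 (fun hx => ihp (h.2.1 hx)) fun hx => ihq (h.2.2 hx)
  | loop x p => exact h.elim

/-! ### Sizes of integers -/

/-- `|x| ≤ 2 ^ (i (v + 1))`. This is a class to let instance search bound the operands. -/
class Sz (v : ℕ) (i : outParam ℕ) (x : ℤ) : Prop where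
  le : |x| ≤ 2 ^ (i * (v + 1))

/-- The number of bits that all operands of the program will have at most. -/
def opBits (v : ℕ) : ℕ := 40 * (v + 1) + 20

theorem one_le_opBits (v : ℕ) : 1 ≤ opBits v := by unfold opBits; omega

namespace Sz

variable {v i j : ℕ} {x y : ℤ}

theorem mono (h : Sz v i x) (hij : i ≤ j) : Sz v j x :=
  ⟨h.le.trans (pow_le_pow_right₀ one_le_two (Nat.mul_le_mul_right _ hij))⟩

theorem bits_le [h : Sz v i x] (hi : i ≤ 40) : bits x ≤ opBits v := by
  have h1 : x.natAbs ≤ 2 ^ (40 * (v + 1)) := by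
    have := (h.mono hi).le
    zify; exact this
  have h2 : Nat.size x.natAbs ≤ 40 * (v + 1) + 1 :=
    Nat.size_le.2 (h1.trans_lt (Nat.pow_lt_pow_right (by norm_num) (by omega)))
  unfold bits opBits
  omega

instance mul [hx : Sz v i x] [hy : Sz v j y] : Sz v (i + j) (x * y) := by
  constructor
  rw [abs_mul, add_mul, pow_add]
  exact mul_le_mul hx.le hy.le (abs_nonneg _) (by positivity)

instance add [hx : Sz v i x] [hy : Sz v j y] : Sz v (max i j + 1) (x + y) := by
  have hx' := (hx.mono (le_max_left i j)).le
  have hy' := (hy.mono (le_max_right i j)).le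
  have h2 : (2 : ℤ) ^ (max i j * (v + 1)) * 2 ≤ 2 ^ ((max i j + 1) * (v + 1)) := by
    rw [add_mul, pow_add, one_mul, pow_succ]
    exact mul_le_mul_of_nonneg_left (le_mul_of_one_le_left (by norm_num)
      (one_le_pow₀ one_le_two)) (by positivity)
  exact ⟨by linarith [abs_add_le x y]⟩

instance neg [hx : Sz v i x] : Sz v i (-x) := ⟨by rw [abs_neg]; exact hx.le⟩

instance sub [hx : Sz v i x] [hy : Sz v j y] : Sz v (max i j + 1) (x - y) := by
  rw [sub_eq_add_neg]; infer_instance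

instance div [hx : Sz v i x] : Sz v i (x / y) := ⟨(Int.abs_ediv_le_abs x y).trans hx.le⟩

theorem lit (h : x.natAbs ≤ 2 ^ i) : Sz v i x := by
  have h1 : |x| ≤ 2 ^ i := by zify at h; exact h
  exact ⟨h1.trans (pow_le_pow_right₀ one_le_two (Nat.le_mul_of_pos_right _ (by omega)))⟩

instance zero : Sz v 0 0 := lit (by norm_num)
instance one : Sz v 0 1 := lit (by norm_num)
instance two : Sz v 1 2 := lit (by norm_num)
instance three : Sz v 2 3 := lit (by norm_num)
instance four : Sz v 2 4 := lit (by norm_num)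
instance nine : Sz v 4 9 := lit (by norm_num)
instance lit32 : Sz v 5 32 := lit (by norm_num)
instance lit64 : Sz v 6 64 := lit (by norm_num)
instance lit65 : Sz v 7 65 := lit (by norm_num)
instance lit512 : Sz v 9 512 := lit (by norm_num)
instance lit600 : Sz v 10 600 := lit (by norm_num)
instance lit1024 : Sz v 10 1024 := lit (by norm_num)
instance lit2048 : Sz v 11 2048 := lit (by norm_num)

theorem of_le [hy : Sz v i y] (h0 : 0 ≤ x) (h : x ≤ y) : Sz v i x := by
  constructor
  rw [abs_of_nonneg h0]
  exact h.trans ((le_abs_self y).trans hy.le)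

theorem of_real (h : |(x : ℝ)| ≤ 2 ^ (v + 1)) : Sz v 1 x := by
  constructor
  rw [one_mul]
  exact_mod_cast h

end Sz

end SparseRoots

namespace SparseRoots

/-! ### Fixed point arithmetic -/

/-- The complex number represented by a pair of integers in fixed point arithmetic. -/
noncomputable def cpx (P X Y : ℤ) : ℂ := ⟨X / P, Y / P⟩

/-- `w` approximates `z`, where `|z| ≤ B`, up to the relative error `(1 + η) ^ s - 1`. -/
structure Near (η : ℝ) (s : ℕ) (B : ℝ) (w z : ℂ) : Prop where
  err : ‖w - z‖ ≤ ((1 + η) ^ s - 1) * B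
  le : ‖z‖ ≤ B

namespace Near

variable {η : ℝ} {s s' : ℕ} {B B' : ℝ} {u w w' z z' : ℂ}

theorem nonneg (h : Near η s B w z) : 0 ≤ B := (norm_nonneg _).trans h.le

theorem mono (h : Near η s B w z) (hη : 0 ≤ η) (hs : s ≤ s') (hB : B ≤ B') :
    Near η s' B' w z := by
  refine ⟨h.err.trans ?_, h.le.trans hB⟩
  have h1 : (1 + η) ^ s ≤ (1 + η) ^ s' := pow_le_pow_right₀ (by linarith) hs
  have h2 : 1 ≤ (1 + η) ^ s := one_le_pow₀ (by linarith)
  have := h.nonneg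
  exact mul_le_mul (by linarith) hB this (by linarith)

theorem norm_le (h : Near η s B w z) : ‖w‖ ≤ (1 + η) ^ s * B := by
  have h1 := norm_add_le (w - z) z
  rw [sub_add_cancel] at h1
  linarith [h.err, h.le]

theorem of_eq (h : ‖z‖ ≤ B) : Near η 0 B z z := ⟨by simp, h⟩

theorem of_le (h : ‖w - z‖ ≤ η) (hB : ‖z‖ ≤ B) (h1 : 1 ≤ B) : Near η 1 B w z := by
  refine ⟨?_, hB⟩
  have := (norm_nonneg _).trans h
  rw [pow_one, add_sub_cancel_left]
  exact h.trans (le_mul_of_one_le_right this h1)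

/-- Relative errors multiply, and because the majorants are at least 1, the absolute rounding error
η costs at most one more factor 1 + η. So the exponents count roundings. -/
theorem mul (h : Near η s B w z) (h' : Near η s' B' w' z') (hη : 0 ≤ η) (h1 : 1 ≤ B)
    (h1' : 1 ≤ B') (hu : ‖u - w * w'‖ ≤ η) : Near η (s + s' + 1) (B * B') u (z * z') := by
  refine ⟨?_, by rw [norm_mul]; exact mul_le_mul h.le h'.le (norm_nonneg _) h.nonneg⟩
  have hp : 1 ≤ (1 + η) ^ s := one_le_pow₀ (by linarith)
  have hq : 1 ≤ (1 + η) ^ s' := one_le_pow₀ (by linarith)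
  have e1 : u - z * z' = (u - w * w') + ((w - z) * (w' - z') + (w - z) * z' + z * (w' - z')) := by
    ring
  have e2 := norm_add_le (u - w * w') ((w - z) * (w' - z') + (w - z) * z' + z * (w' - z'))
  have e3 := norm_add₃_le (a := (w - z) * (w' - z')) (b := (w - z) * z') (c := z * (w' - z'))
  rw [← e1] at e2
  simp only [norm_mul] at e3
  rw [pow_add, pow_add, pow_one]
  have a1 := h.err
  have a2 := h.le
  have b1 := h'.err
  have b2 := h'.le
  generalize (1 + η) ^ s = p at *
  generalize (1 + η) ^ s' = q at *
  have f1 : ‖w - z‖ * ‖w' - z'‖ ≤ ((p - 1) * B) * ((q - 1) * B') :=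
    mul_le_mul a1 b1 (norm_nonneg _) ((norm_nonneg _).trans a1)
  have f2 : ‖w - z‖ * ‖z'‖ ≤ ((p - 1) * B) * B' :=
    mul_le_mul a1 b2 (norm_nonneg _) ((norm_nonneg _).trans a1)
  have f3 : ‖z‖ * ‖w' - z'‖ ≤ B * ((q - 1) * B') :=
    mul_le_mul a2 b1 (norm_nonneg _) ((norm_nonneg _).trans a2)
  have f4 : η ≤ η * ((p * q) * (B * B')) := by
    refine le_mul_of_one_le_right hη ?_
    exact one_le_mul_of_one_le_of_one_le (one_le_mul_of_one_le_of_one_le hp hq)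
      (one_le_mul_of_one_le_of_one_le h1 h1')
  calc ‖u - z * z'‖ ≤ η * ((p * q) * (B * B')) + (((p - 1) * B) * ((q - 1) * B')
        + ((p - 1) * B) * B' + B * ((q - 1) * B')) := by linarith
    _ = (p * q * (1 + η) - 1) * (B * B') := by ring

/-- Addition of fixed point numbers is exact, so a common relative error persists and only the
majorants add up. -/
theorem add (h : Near η s B w z) (h' : Near η s B' w' z') :
    Near η s (B + B') (w + w') (z + z') := by
  refine ⟨?_, (norm_add_le _ _).trans (add_le_add h.le h'.le)⟩
  rw [add_sub_add_comm, mul_add]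
  exact (norm_add_le _ _).trans (add_le_add h.err h'.err)

theorem natCast_mul (h : Near η s B w z) (b : ℕ) : Near η s (b * B) (b * w) (b * z) := by
  have hb : ‖(b : ℂ)‖ = b := by simp
  refine ⟨?_, by rw [norm_mul, hb]; exact mul_le_mul_of_nonneg_left h.le (by positivity)⟩
  rw [← mul_sub, norm_mul, hb, mul_left_comm]
  exact mul_le_mul_of_nonneg_left h.err (by positivity)

end Near

theorem one_add_pow_sub_one_le {η : ℝ} {s : ℕ} (hη : 0 ≤ η) (h : s * η ≤ 1) :
    (1 + η) ^ s - 1 ≤ 2 * (s * η) := by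
  have h1 : (1 + η) ^ s ≤ Real.exp (s * η) := by
    rw [Real.exp_nat_mul]
    exact pow_le_pow_left₀ (by linarith) (by linarith [Real.add_one_le_exp η]) s
  have h0 : 0 ≤ s * η := by positivity
  have h2 := Real.abs_exp_sub_one_le (x := s * η) (by rwa [abs_of_nonneg h0])
  rw [abs_of_nonneg h0] at h2
  linarith [le_abs_self (Real.exp (s * η) - 1)]

theorem ediv_cast_bounds (a : ℤ) {P : ℤ} (hP : 0 < P) :
    (a : ℝ) / P - 1 < ((a / P : ℤ) : ℝ) ∧ ((a / P : ℤ) : ℝ) ≤ (a : ℝ) / P := by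
  have hP' : (0 : ℝ) < P := by exact_mod_cast hP
  have h1 := Int.mul_ediv_add_emod a P
  have h2 := Int.emod_nonneg a hP.ne'
  have h3 := Int.emod_lt_of_pos a hP
  have h1' : (P : ℝ) * ((a / P : ℤ) : ℝ) + ((a % P : ℤ) : ℝ) = a := by exact_mod_cast h1
  have h2' : (0 : ℝ) ≤ ((a % P : ℤ) : ℝ) := by exact_mod_cast h2
  have h3' : ((a % P : ℤ) : ℝ) < P := by exact_mod_cast h3
  constructor
  · rw [sub_lt_iff_lt_add, div_lt_iff₀ hP']; linarith
  · rw [le_div_iff₀ hP']; linarith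

theorem abs_ediv_div_sub_le (a : ℤ) {P : ℤ} (hP : 0 < P) :
    |((a / P : ℤ) : ℝ) / P - (a : ℝ) / P / P| ≤ 1 / P := by
  have hP' : (0 : ℝ) < P := by exact_mod_cast hP
  obtain ⟨h1, h2⟩ := ediv_cast_bounds a hP
  rw [← sub_div, abs_div, abs_of_pos hP']
  exact div_le_div_of_nonneg_right (abs_le.2 ⟨by linarith, by linarith⟩) hP'.le

/-- The two floors cost at most 1/P each. The weaker constant 4 agrees with the error of the complex
input, whose two coordinates are known up to 2/P. -/
theorem norm_cpx_ediv_sub_le (x y a b : ℤ) {P : ℤ} (hP : 0 < P) :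
    ‖cpx P ((x * a - y * b) / P) ((x * b + y * a) / P) - cpx P x y * cpx P a b‖ ≤ 4 / P := by
  have hP' : (0 : ℝ) < P := by exact_mod_cast hP
  refine (Complex.norm_le_abs_re_add_abs_im _).trans ?_
  have h1 := abs_ediv_div_sub_le (x * a - y * b) hP
  have h2 := abs_ediv_div_sub_le (x * b + y * a) hP
  have e1 : (cpx P ((x * a - y * b) / P) ((x * b + y * a) / P) - cpx P x y * cpx P a b).re
      = (((x * a - y * b) / P : ℤ) : ℝ) / P - ((x * a - y * b : ℤ) : ℝ) / P / P := by
    simp only [cpx, Complex.sub_re, Complex.mul_re]; push_cast; field_simp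
  have e2 : (cpx P ((x * a - y * b) / P) ((x * b + y * a) / P) - cpx P x y * cpx P a b).im
      = (((x * b + y * a) / P : ℤ) : ℝ) / P - ((x * b + y * a : ℤ) : ℝ) / P / P := by
    simp only [cpx, Complex.sub_im, Complex.mul_im]; push_cast; field_simp
  rw [e1, e2]
  calc _ ≤ 1 / (P : ℝ) + 1 / P := add_le_add h1 h2
    _ ≤ 4 / P := by rw [← add_div]; exact div_le_div_of_nonneg_right (by norm_num) hP'.le

theorem abs_fst_le_mul_norm_cpx (X Y : ℤ) {P : ℤ} (hP : 0 < P) : |(X : ℝ)| ≤ P * ‖cpx P X Y‖ := by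
  have hP' : (0 : ℝ) < P := by exact_mod_cast hP
  have := Complex.abs_re_le_norm (cpx P X Y)
  simp only [cpx] at this ⊢
  rwa [abs_div, abs_of_pos hP', div_le_iff₀' hP'] at this

theorem abs_snd_le_mul_norm_cpx (X Y : ℤ) {P : ℤ} (hP : 0 < P) : |(Y : ℝ)| ≤ P * ‖cpx P X Y‖ := by
  have hP' : (0 : ℝ) < P := by exact_mod_cast hP
  have := Complex.abs_im_le_norm (cpx P X Y)
  simp only [cpx] at this ⊢
  rwa [abs_div, abs_of_pos hP', div_le_iff₀' hP'] at this

theorem Near.sz {P X Y : ℤ} {η B : ℝ} {s v : ℕ} {z : ℂ} (h : Near η s B (cpx P X Y) z)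
    (hP : 0 < P) (hv : P * ((1 + η) ^ s * B) ≤ 2 ^ (v + 1)) : Sz v 1 X ∧ Sz v 1 Y := by
  have hP' : (0 : ℝ) < P := by exact_mod_cast hP
  have h1 := (mul_le_mul_of_nonneg_left h.norm_le hP'.le).trans hv
  exact ⟨Sz.of_real ((abs_fst_le_mul_norm_cpx X Y hP).trans h1),
    Sz.of_real ((abs_snd_le_mul_norm_cpx X Y hP).trans h1)⟩

theorem cpx_add (P X Y X' Y' : ℤ) : cpx P (X + X') (Y + Y') = cpx P X Y + cpx P X' Y' := by
  apply Complex.ext <;> simp [cpx, add_div]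

theorem cpx_natCast_mul (P X Y : ℤ) (b : ℕ) : cpx P (b * X) (b * Y) = b * cpx P X Y := by
  apply Complex.ext <;> simp [cpx, mul_div_assoc]

/-! ### Binomial coefficients and square roots of integers -/

/-- The division is exact because (i+1)·C(e,i+1) = (e-i)·C(e,i); the primed version reads the same
identity downwards. -/
theorem choose_mul_ediv {e i : ℕ} (h : i ≤ e) :
    ((e.choose i : ℤ) * (e - i)) / (i + 1) = (e.choose (i + 1) : ℤ) := by
  have h1 : (e.choose (i + 1) : ℤ) * (i + 1) = (e.choose i : ℤ) * (e - i) := by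
    have := Nat.choose_succ_right_eq e i
    zify [h] at this
    exact this
  rw [← h1, Int.mul_ediv_cancel _ (by positivity)]

theorem choose_mul_ediv' {e i : ℕ} (h : i < e) :
    ((e.choose (i + 1) : ℤ) * (i + 1)) / (e - (i + 1) + 1) = (e.choose i : ℤ) := by
  have h1 : (e.choose (i + 1) : ℤ) * (i + 1) = (e.choose i : ℤ) * (e - i) := by
    have := Nat.choose_succ_right_eq e i
    zify [h.le] at this
    exact this
  have h2 : (e : ℤ) - (i + 1) + 1 = e - i := by ring
  rw [h1, h2, Int.mul_ediv_cancel _ (by have : (i : ℤ) < e := by exact_mod_cast h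
                                        omega)]

/-- One step of Newton's iteration for the square root of `N`. -/
theorem newton_step {N x p : ℤ} {s : ℝ} (hs : s ^ 2 = N) (hs0 : 0 < s) (hx : 0 < x) (hp : 1 ≤ p)
    (h1 : s - 1 < x) (h2 : x - s ≤ max 1 (2 * s / p)) :
    0 < (x * x + N) / (x + x) ∧ s - 1 < ((x * x + N) / (x + x) : ℤ) ∧
      (((x * x + N) / (x + x) : ℤ) : ℝ) - s ≤ max 1 (2 * s / (p * p : ℤ)) := by
  have hx' : (0 : ℝ) < x := by exact_mod_cast hx
  have hx1 : (1 : ℝ) ≤ x := by exact_mod_cast hx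
  have hp' : (1 : ℝ) ≤ p := by exact_mod_cast hp
  obtain ⟨h3, h4⟩ := ediv_cast_bounds (x * x + N) (P := x + x) (by omega)
  have hN1 : (1 : ℝ) ≤ N := by
    have : (0 : ℝ) < N := by rw [← hs]; positivity
    have : 0 < N := by exact_mod_cast this
    exact_mod_cast this
  -- The exact Newton iterate lies above s by (x-s)²/(2x); only the floor can bring the result below
  -- s, and by less than 1.
  have h5 : ((x * x + N : ℤ) : ℝ) / ((x + x : ℤ) : ℝ) = s + (x - s) ^ 2 / (2 * x) := by
    push_cast; rw [← hs]; field_simp; ring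
  rw [h5] at h3 h4
  have h6 : 0 ≤ ((x : ℝ) - s) ^ 2 / (2 * x) := by positivity
  have hlow : s - 1 < (((x * x + N) / (x + x) : ℤ) : ℝ) := by linarith
  have hs1 : 1 ≤ s := by nlinarith
  refine ⟨?_, hlow, ?_⟩
  · have : (0 : ℝ) < (((x * x + N) / (x + x) : ℤ) : ℝ) := by linarith
    exact_mod_cast this
  -- An error of at most 1 stays at most 1, also from below; an error of at most 2s/p becomes at
  -- most (2s/p)²/(2s) = 2s/p².
  · have key : ((x : ℝ) - s) ^ 2 / (2 * x) ≤ max 1 (2 * s / (p * p : ℤ)) := by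
      rcases le_or_gt (x : ℝ) s with hxs | hxs
      · refine le_max_of_le_left ?_
        rw [div_le_one (by positivity)]
        nlinarith
      · rcases le_max_iff.1 h2 with h | h
        · refine le_max_of_le_left ?_
          rw [div_le_one (by positivity)]
          nlinarith
        · refine le_max_of_le_right ?_
          push_cast
          have h7 : ((x : ℝ) - s) ^ 2 ≤ (2 * s / p) ^ 2 := pow_le_pow_left₀ (by linarith) h 2
          calc ((x : ℝ) - s) ^ 2 / (2 * x) ≤ (2 * s / p) ^ 2 / (2 * s) := by gcongr
            _ = 2 * s / (p * p) := by field_simp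
    linarith

end SparseRoots

/-! ### Complex fixed point multiplication and binary powering -/

namespace SparseRoots

/-- Complex fixed point multiplication; the scale is in register 6. -/
def cmul (d d' x x' y y' : ℕ) : Cmd :=
  .block [.mul 90 x y, .mul 91 x' y', .sub 90 90 91, .mul 91 x y', .mul 92 x' y, .add 91 91 92,
    .div d 90 6, .div d' 91 6]

variable {O : ℕ → ℕ → ℤ} {v : ℕ}

theorem cmul_spec {d d' x x' y y' : ℕ} {s : State} (hd : d < 90) (hd6 : d ≠ 6) (hdd : d ≠ d')
    (hx : x < 90) (hx' : x' < 90) (hy : y < 90) (hy' : y' < 90)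
    (h6 : Sz v 1 (s.reg 6)) (sx : Sz v 1 (s.reg x)) (sx' : Sz v 1 (s.reg x'))
    (sy : Sz v 1 (s.reg y)) (sy' : Sz v 1 (s.reg y')) :
    Tri O (opBits v) (cmul d d' x x' y y') 9 s fun s' =>
      s'.reg d = (s.reg x * s.reg y - s.reg x' * s.reg y') / s.reg 6 ∧
      s'.reg d' = (s.reg x * s.reg y' + s.reg x' * s.reg y) / s.reg 6 := by
  refine Tri.of_wp (one_le_opBits v) ?_
  have e1 : x ≠ 90 := by omega
  have e2 : x' ≠ 90 := by omega
  have e3 : y ≠ 90 := by omega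
  have e4 : y' ≠ 90 := by omega
  have f1 : x ≠ 91 := by omega
  have f2 : x' ≠ 91 := by omega
  have f3 : y ≠ 91 := by omega
  have f4 : y' ≠ 91 := by omega
  have e5 : 91 ≠ d := by omega
  simp [cmul, Cmd.block, wp, Sz.bits_le, hd6.symm, *]

/-- Binary powering: multiplies the number in the registers 20, 21 by the `E`-th power of the number
in the registers 22, 23, where `E` is in register 24. -/
def powLoop : Cmd :=
  .loop 24 (.block [.block [.div 29 24 28, .add 27 29 29, .sub 27 24 27],
    .ite 27 (cmul 20 21 20 21 22 23) .skip, cmul 22 23 22 23 22 23, .add 24 29 2])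

/-- Invariant: the accumulator approximates z₀z^a, the running square z^f, and a + fE' = E for the
remaining exponent E'. The rounding exponents s₀ + 2a and 2f - 1 reproduce themselves: (s₀+2a) +
(2f-1) + 1 = s₀ + 2(a+f) and 2(2f-1) + 1 = 2(2f) - 1. The square is formed once more after its last
use, so f can overshoot to about 2E, which is why the size hypothesis `hv₂` has the doubled
exponent. -/
theorem powLoop_spec {s : State} {P : ℤ} {z₀ z : ℂ} {B₀ H : ℝ} {s₀ E T : ℕ} (hP : 0 < P)
    (h2 : s.reg 2 = 0) (h28 : s.reg 28 = 2) (h6 : s.reg 6 = P) (h24 : s.reg 24 = E)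
    (hB₀ : 1 ≤ B₀) (hH : 1 ≤ H) (hE : E < 2 ^ T) [Sz v 1 P] [Sz v 1 (E : ℤ)]
    (hacc : Near (4 / P) s₀ B₀ (cpx P (s.reg 20) (s.reg 21)) z₀)
    (hb : Near (4 / P) 1 H (cpx P (s.reg 22) (s.reg 23)) z)
    (hv₁ : P * ((1 + 4 / P : ℝ) ^ (s₀ + 2 * E) * (B₀ * H ^ E)) ≤ 2 ^ (v + 1))
    (hv₂ : P * ((1 + 4 / P : ℝ) ^ (4 * E + 1) * H ^ (2 * E + 1)) ≤ 2 ^ (v + 1)) :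
    Tri O (opBits v) powLoop (T * 30 + 1) s fun s' =>
      Near (4 / P) (s₀ + 2 * E) (B₀ * H ^ E) (cpx P (s'.reg 20) (s'.reg 21)) (z₀ * z ^ E) := by
  have hP' : (0 : ℝ) < P := by exact_mod_cast hP
  have hη : (0 : ℝ) ≤ 4 / P := by positivity
  refine Tri.loop (N := 29) (fun j s => ∃ a E' f : ℕ, s.reg 24 = E' ∧ E' < 2 ^ j ∧ a + f * E' = E ∧
    1 ≤ f ∧ f ≤ 2 * E + 1 ∧
    Near (4 / P) (s₀ + 2 * a) (B₀ * H ^ a) (cpx P (s.reg 20) (s.reg 21)) (z₀ * z ^ a) ∧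
    Near (4 / P) (2 * f - 1) (H ^ f) (cpx P (s.reg 22) (s.reg 23)) (z ^ f)) T
    ⟨0, E, 1, h24, hE, by omega, le_rfl, by omega, by simpa using hacc, by simpa using hb⟩ ?_
  rintro j t ⟨a, E', f, i24, hE', haE, hf1, hf2, iacc, ib⟩ hfr
  have i2 : t.reg 2 = 0 := (hfr.1 2 (by decide)).trans h2
  have i6 : t.reg 6 = P := (hfr.1 6 (by decide)).trans h6
  have i28 : t.reg 28 = 2 := (hfr.1 28 (by decide)).trans h28
  have hE'E : E' ≤ E := by nlinarith
  have szE' : Sz v 1 (E' : ℤ) := Sz.of_le (y := (E : ℤ)) (by positivity) (by exact_mod_cast hE'E)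
  have szb := (ib.mono hη (s' := 4 * E + 1) (by omega)
    (pow_le_pow_right₀ hH hf2)).sz hP hv₂
  have szacc := (iacc.mono hη (s' := s₀ + 2 * E) (B' := B₀ * H ^ E) (by nlinarith)
    (mul_le_mul_of_nonneg_left (pow_le_pow_right₀ hH (by nlinarith)) (by linarith))).sz hP hv₁
  obtain ⟨szb1, szb2⟩ := szb
  obtain ⟨sza1, sza2⟩ := szacc
  refine ⟨by rw [i24]; exact Sz.bits_le (by norm_num), fun h => ?_, fun h => ?_⟩
  · have : E' = 0 := by rw [i24] at h; exact_mod_cast le_antisymm h (by positivity)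
    subst this
    obtain rfl : a = E := by omega
    exact iacc
  · have hE0 : 0 < E' := by rw [i24] at h; exact_mod_cast h
    obtain ⟨j, rfl⟩ : ∃ j', j = j' + 1 := by
      rcases j with _ | j
      · simp at hE'; omega
      · exact ⟨j, rfl⟩
    refine ⟨j, rfl, ?_⟩
    have hff : f * E' ≤ E := by omega
    have hf3 : f ≤ E := le_trans (Nat.le_mul_of_pos_right _ hE0) hff
    refine Tri.mono (Tri.cons (R := fun u => u.reg 29 = (E' / 2 : ℕ) ∧ u.reg 27 = (E' % 2 : ℕ))
      (Tri.of_wp (one_le_opBits v) ?_) fun t₁ fr₁ ⟨h29, h27⟩ => ?_) (N := 4 + 24) (by norm_num)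
      fun _ _ h => h
    · have e1 : (E' : ℤ) - ((E' : ℤ) / 2 + (E' : ℤ) / 2) = E' % 2 := by omega
      simp [Cmd.block, wp, Sz.bits_le, *]
    have k20 := fr₁.1 20 (by decide)
    have k21 := fr₁.1 21 (by decide)
    have k22 := fr₁.1 22 (by decide)
    have k23 := fr₁.1 23 (by decide)
    have k6 := (fr₁.1 6 (by decide)).trans i6
    have k2 := (fr₁.1 2 (by decide)).trans i2
    rw [← k20] at sza1
    rw [← k21] at sza2
    rw [← k22] at szb1
    rw [← k23] at szb2
    rw [← k20, ← k21] at iacc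
    rw [← k22, ← k23] at ib
    have szP' : Sz v 1 (t₁.reg 6) := by rw [k6]; infer_instance
    have hHf : 1 ≤ H ^ f := one_le_pow₀ hH
    have hBa : 1 ≤ B₀ * H ^ a := one_le_mul_of_one_le_of_one_le hB₀ (one_le_pow₀ hH)
    refine Tri.cons (N := 11) (N' := 13) (R := fun u =>
      Near (4 / P) (s₀ + 2 * (a + f * (E' % 2))) (B₀ * H ^ (a + f * (E' % 2)))
        (cpx P (u.reg 20) (u.reg 21)) (z₀ * z ^ (a + f * (E' % 2)))) ?_ fun t₂ fr₂ hR => ?_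
    · refine Tri.ite (N := 9) (N' := 1) (by
        have : Sz v 0 ((E' % 2 : ℕ) : ℤ) := Sz.of_le (y := 1) (by positivity) (by omega)
        rw [h27]; exact Sz.bits_le (by norm_num)) (fun h' => ?_)
        (fun h' => ?_)
      · have h1 : E' % 2 = 1 := by rw [h27] at h'; omega
        refine (cmul_spec (by norm_num) (by norm_num) (by norm_num) (by norm_num) (by norm_num)
          (by norm_num) (by norm_num) szP' sza1 sza2 szb1 szb2).mono le_rfl fun u _ hu => ?_
        rw [h1, mul_one, hu.1, hu.2, k6]
        have := iacc.mul ib hη hBa hHf (norm_cpx_ediv_sub_le _ _ _ _ hP)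
        rw [pow_add, pow_add, ← mul_assoc, ← mul_assoc]
        exact this.mono hη (by omega) le_rfl
      · have h1 : E' % 2 = 0 := by rw [h27] at h'; omega
        refine Tri.skip (one_le_opBits v) ?_
        rw [h1, mul_zero, add_zero]
        exact iacc
    have l22 := fr₂.1 22 (by decide)
    have l23 := fr₂.1 23 (by decide)
    have l6 := (fr₂.1 6 (by decide))
    have l2 := (fr₂.1 2 (by decide)).trans k2
    have l29 := (fr₂.1 29 (by decide)).trans h29
    rw [← l6] at szP'
    rw [← l22] at szb1
    rw [← l23] at szb2
    rw [← l22, ← l23] at ib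
    refine Tri.cons (cmul_spec (by norm_num) (by norm_num) (by norm_num) (by norm_num) (by norm_num)
          (by norm_num) (by norm_num) szP' szb1 szb2 szb1 szb2) (N' := 4) fun t₃ fr₃ hR' => ?_
    have m2 := (fr₃.1 2 (by decide)).trans l2
    have m29 := (fr₃.1 29 (by decide)).trans l29
    have m20 := (fr₃.1 20 (by decide))
    have m21 := (fr₃.1 21 (by decide))
    rw [l6, k6] at hR'
    refine (Tri.of_wp (one_le_opBits v) (Q := fun u => u.reg 24 = (E' / 2 : ℕ) ∧ u.reg 20 = t₃.reg 20
      ∧ u.reg 21 = t₃.reg 21 ∧ u.reg 22 = t₃.reg 22 ∧ u.reg 23 = t₃.reg 23) ?_).mono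
      (by decide) fun u _ hu => ?_
    · simp [Cmd.block, wp, Sz.bits_le, *]
    · refine ⟨a + f * (E' % 2), E' / 2, f + f, hu.1, by omega, ?_, by omega, by omega, ?_, ?_⟩
      · rw [← haE]
        conv_rhs => rw [← Nat.mod_add_div E' 2]
        ring
      · rw [hu.2.1, hu.2.2.1, m20, m21]; exact hR
      · rw [hu.2.2.2.1, hu.2.2.2.2, hR'.1, hR'.2, pow_add, pow_add]
        exact (ib.mul ib hη hHf hHf (norm_cpx_ediv_sub_le _ _ _ _ hP)).mono hη (by omega) le_rfl

end SparseRoots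

/-! ### Binomial coefficients and the contribution of one term to all coefficients -/

namespace SparseRoots

variable {O : ℕ → ℕ → ℤ} {v : ℕ}

/-- Computes the binomial coefficient `e.choose i` in register 36, with `e` in register 32 and `i`
in register 38. -/
def chooseLoop : Cmd :=
  .loop 38 (.block [.sub 39 32 35, .mul 36 36 39, .add 35 35 3, .div 36 36 35, .sub 38 38 3])

theorem chooseLoop_spec {s : State} {e i₀ : ℕ} (h3 : s.reg 3 = 1) (h32 : s.reg 32 = e)
    (h35 : s.reg 35 = 0) (h36 : s.reg 36 = 1) (h38 : s.reg 38 = i₀) (hi : i₀ ≤ e)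
    [Sz v 1 (e : ℤ)] (hch : ∀ i ≤ i₀, Sz v 1 (e.choose i : ℤ)) :
    Tri O (opBits v) chooseLoop (i₀ * 7 + 1) s fun s' => s'.reg 36 = e.choose i₀ := by
  refine Tri.loop (N := 6) (fun j s => ∃ i : ℕ, i + j = i₀ ∧ s.reg 38 = j ∧ s.reg 35 = i ∧
    s.reg 36 = e.choose i) i₀ ⟨0, by omega, h38, h35, by simpa using h36⟩ ?_
  rintro j t ⟨i, hij, i38, i35, i36⟩ hfr
  have i3 : t.reg 3 = 1 := (hfr.1 3 (by decide)).trans h3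
  have i32 : t.reg 32 = e := (hfr.1 32 (by decide)).trans h32
  have sj : Sz v 1 (j : ℤ) := Sz.of_le (y := (e : ℤ)) (by positivity) (by omega)
  have si : Sz v 1 (i : ℤ) := Sz.of_le (y := (e : ℤ)) (by positivity) (by omega)
  have sc := hch i (by omega)
  refine ⟨by rw [i38]; exact Sz.bits_le (by norm_num), fun h => ?_, fun h => ?_⟩
  · obtain rfl : i = i₀ := by omega
    exact i36
  · obtain ⟨j, rfl⟩ : ∃ j', j = j' + 1 := ⟨j - 1, by omega⟩
    refine ⟨j, rfl, (Tri.of_wp (one_le_opBits v) (Q := fun u => u.reg 38 = j ∧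
      u.reg 35 = (i + 1 : ℕ) ∧ u.reg 36 = e.choose (i + 1)) ?_).mono (by decide) fun u _ hu =>
        ⟨i + 1, by omega, hu⟩⟩
    have := choose_mul_ediv (e := e) (i := i) (by omega)
    push_cast at sj
    simp [Cmd.block, wp, Sz.bits_le, *]

/-- Adds the contributions of one term of the polynomial to all the coefficients. -/
def accLoop : Cmd :=
  .loop 38 (.block [.block [.sub 35 38 3, .add 37 35 35, .add 37 37 5, .load 39 37, .mul 40 36 20,
    .add 39 39 40, .store 37 39, .add 37 37 3, .load 39 37, .mul 40 36 21, .add 39 39 40,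
    .store 37 39, .mul 36 36 35, .sub 39 32 35, .add 39 39 3, .div 36 36 39, .add 38 35 2],
    cmul 20 21 20 21 8 9])

/-- The index runs downwards from min(e,K), so m^(e-i) grows by one multiplication per step and only
the first power needs powering. Entries from q on are already updated, those below q are untouched.
The clause about the current power and binomial coefficient is vacuous at q = 0, so the superfluous
last update need not be described. -/
theorem accLoop_spec {s : State} {P mx my : ℤ} {c m : ℂ} {C H : ℝ} {e i₀ n K base : ℕ}
    {S : ℕ → ℂ} {B : ℕ → ℝ} (hP : 0 < P)
    (h2 : s.reg 2 = 0) (h3 : s.reg 3 = 1) (h5 : s.reg 5 = base) (h6 : s.reg 6 = P)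
    (h8 : s.reg 8 = mx) (h9 : s.reg 9 = my) (h32 : s.reg 32 = e)
    (h36 : s.reg 36 = e.choose i₀) (h38 : s.reg 38 = (i₀ + 1 : ℕ)) (hi : i₀ = min e K)
    (hen : e ≤ n) (hC : 1 ≤ C) (hH : 1 ≤ H)
    [Sz v 1 P] [Sz v 1 mx] [Sz v 1 my] [Sz v 1 (e : ℤ)] [Sz v 1 (base + 2 * K + 2 : ℤ)]
    (hch : ∀ i ≤ i₀, Sz v 1 (e.choose i : ℤ))
    (hacc : Near (4 / P) (1 + 2 * (e - i₀)) (C * H ^ (e - i₀)) (cpx P (s.reg 20) (s.reg 21))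
      (c * m ^ (e - i₀)))
    (hm : Near (4 / P) 1 H (cpx P mx my) m)
    (hS : ∀ i ≤ K, Near (4 / P) (2 * n + 1) (B i)
      (cpx P (s.mem (base + 2 * i)) (s.mem (base + 2 * i + 1))) (S i))
    (hv₁ : P * ((1 + 4 / P : ℝ) ^ (2 * n + 3) * (C * H ^ (n + 1))) ≤ 2 ^ (v + 1))
    (hv₂ : ∀ i ≤ K, P * ((1 + 4 / P : ℝ) ^ (2 * n + 1) * (B i)) ≤ 2 ^ (v + 1)) :
    Tri O (opBits v) accLoop ((i₀ + 1) * 29 + 1) s fun s' =>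
      (∀ i ≤ K, Near (4 / P) (2 * n + 1) (B i + e.choose i * (C * H ^ n))
        (cpx P (s'.mem (base + 2 * i)) (s'.mem (base + 2 * i + 1)))
        (S i + e.choose i * (c * m ^ (e - i)))) ∧
      ∀ a < base, s'.mem a = s.mem a := by
  have hP' : (0 : ℝ) < P := by exact_mod_cast hP
  have hη : (0 : ℝ) ≤ 4 / P := by positivity
  have hCH : ∀ j, 1 ≤ C * H ^ j := fun j =>
    one_le_mul_of_one_le_of_one_le hC (one_le_pow₀ hH)
  refine Tri.loop (N := 28) (fun q u => u.reg 38 = q ∧ q ≤ i₀ + 1 ∧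
    (∀ q', q = q' + 1 → u.reg 36 = e.choose q' ∧
      Near (4 / P) (1 + 2 * (e - q')) (C * H ^ (e - q')) (cpx P (u.reg 20) (u.reg 21))
        (c * m ^ (e - q'))) ∧
    (∀ i ≤ K, i < q → Near (4 / P) (2 * n + 1) (B i)
      (cpx P (u.mem (base + 2 * i)) (u.mem (base + 2 * i + 1))) (S i)) ∧
    (∀ i ≤ K, q ≤ i → Near (4 / P) (2 * n + 1) (B i + e.choose i * (C * H ^ n))
        (cpx P (u.mem (base + 2 * i)) (u.mem (base + 2 * i + 1)))
        (S i + e.choose i * (c * m ^ (e - i)))) ∧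
    ∀ a < base, u.mem a = s.mem a) (i₀ + 1) ⟨h38, le_rfl, ?_, fun i hi _ => hS i hi, ?_, fun _ _ => rfl⟩ ?_
  · intro q' hq
    obtain rfl : i₀ = q' := by omega
    exact ⟨h36, hacc⟩
  · intro i hiK hi'
    -- From min(e,K) < i ≤ K it follows that i > e, and the term does not contribute.
    rw [Nat.choose_eq_zero_of_lt (by omega)]
    simpa using hS i hiK
  rintro q t ⟨i38, hq, hcur, hold, hnew, hbase⟩ hfr
  have i2 := (hfr.1 2 (by decide)).trans h2
  have i3 := (hfr.1 3 (by decide)).trans h3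
  have i5 := (hfr.1 5 (by decide)).trans h5
  have i6 := (hfr.1 6 (by decide)).trans h6
  have i8 := (hfr.1 8 (by decide)).trans h8
  have i9 := (hfr.1 9 (by decide)).trans h9
  have i32 := (hfr.1 32 (by decide)).trans h32
  have sK : ∀ x : ℕ, x ≤ base + 2 * K + 2 → Sz v 1 (x : ℤ) := fun x hx =>
    Sz.of_le (y := (base + 2 * K + 2 : ℤ)) (by positivity) (by exact_mod_cast hx)
  have sq := sK q (by omega)
  refine ⟨by rw [i38]; exact Sz.bits_le (by norm_num), fun h => ?_, fun h => ?_⟩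
  · obtain rfl : q = 0 := by omega
    exact ⟨fun i hi => hnew i hi (Nat.zero_le _), hbase⟩
  obtain ⟨q, rfl⟩ : ∃ q', q = q' + 1 := ⟨q - 1, by omega⟩
  obtain ⟨i36, iacc⟩ := hcur q rfl
  have hqe : q ≤ e := by omega
  have hqK : q ≤ K := by omega
  have iS := hold q hqK (Nat.lt_succ_self q)
  obtain ⟨sa1, sa2⟩ := (iacc.mono hη (s' := 2 * n + 3) (B' := C * H ^ (n + 1)) (by omega)
    (mul_le_mul_of_nonneg_left (pow_le_pow_right₀ hH (by omega)) (by linarith))).sz hP hv₁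
  obtain ⟨sS1, sS2⟩ := iS.sz hP (hv₂ q hqK)
  have sc := hch q (by omega)
  have sq' := sK q (by omega)
  have sb := sK base (by omega)
  refine ⟨q, rfl, ?_⟩
  refine Tri.mono (Tri.cons (R := fun u => u.reg 38 = q ∧
      u.reg 36 = (e.choose q * q) / (e - q + 1 : ℤ) ∧ ∀ x, u.mem x =
        if x = base + 2 * q + 1 then t.mem (base + 2 * q + 1) + e.choose q * t.reg 21
        else if x = base + 2 * q then t.mem (base + 2 * q) + e.choose q * t.reg 20 else t.mem x)
      (N' := 10) (Tri.of_wp (one_le_opBits v) ?_) fun t₁ fr₁ ⟨k38, k36, kmem⟩ => ?_) (N := 18 + 10)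
      (by norm_num) fun _ _ h => h
  · have a1 : ((q : ℤ) + q + base).toNat = base + 2 * q := by omega
    have a2 : ((q : ℤ) + q + base + 1).toNat = base + 2 * q + 1 := by omega
    simp [Cmd.block, wp, Sz.bits_le, *]
  have k6 := (fr₁.1 6 (by decide)).trans i6
  have k8 := (fr₁.1 8 (by decide)).trans i8
  have k9 := (fr₁.1 9 (by decide)).trans i9
  have k20 := (fr₁.1 20 (by decide))
  have k21 := (fr₁.1 21 (by decide))
  refine Tri.cons (N' := 1) (cmul_spec (by norm_num) (by norm_num) (by norm_num) (by norm_num)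
    (by norm_num) (by norm_num) (by norm_num) (by rwa [k6]) (by rwa [k20]) (by rwa [k21])
    (by rwa [k8]) (by rwa [k9])) fun t₂ fr₂ ⟨l20, l21⟩ => Tri.nil (one_le_opBits v) ?_
  have l38 := (fr₂.1 38 (by decide)).trans k38
  have l36 := (fr₂.1 36 (by decide)).trans k36
  have lmem := fr₂.2 (by decide)
  rw [k6, k8, k9, k20, k21] at l20 l21
  have lmem' : ∀ i, i ≠ q → t₂.mem (base + 2 * i) = t.mem (base + 2 * i) ∧
      t₂.mem (base + 2 * i + 1) = t.mem (base + 2 * i + 1) := by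
    intro i hi
    rw [lmem, kmem, kmem, if_neg (by omega), if_neg (by omega), if_neg (by omega),
      if_neg (by omega)]
    exact ⟨rfl, rfl⟩
  refine ⟨l38, by omega, ?_, ?_, ?_, ?_⟩
  · rintro q' rfl
    refine ⟨?_, ?_⟩
    · rw [l36]
      push_cast
      exact choose_mul_ediv' (by omega)
    · rw [l20, l21]
      have := iacc.mul hm hη (hCH _) hH (norm_cpx_ediv_sub_le _ _ _ _ hP)
      have he : e - q' = e - (q' + 1) + 1 := by omega
      rw [he, pow_succ, pow_succ, ← mul_assoc, ← mul_assoc]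
      exact this.mono hη (by omega) le_rfl
  · intro i hiK hiq
    obtain ⟨r1, r2⟩ := lmem' i (by omega)
    rw [r1, r2]
    exact hold i hiK (by omega)
  · intro i hiK hiq
    rcases eq_or_ne i q with rfl | hne
    · rw [lmem, kmem, kmem, if_neg (by omega), if_pos rfl, if_pos rfl, cpx_add, cpx_natCast_mul]
      refine iS.add (Near.natCast_mul ?_ _)
      exact iacc.mono hη (by omega)
        (mul_le_mul_of_nonneg_left (pow_le_pow_right₀ hH (by omega)) (by linarith))
    · obtain ⟨r1, r2⟩ := lmem' i hne
      rw [r1, r2]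
      exact hnew i hiK (by omega)
  · intro a ha
    rw [lmem, kmem, if_neg (by omega), if_neg (by omega), hbase a ha]

end SparseRoots

/-! ### Moduli by Newton's iteration on integers -/

namespace SparseRoots

variable {O : ℕ → ℕ → ℤ} {v : ℕ}

/-- Absolute value of register `a`. -/
def absCmd (d a : ℕ) : Cmd := .block [.add d a 2, .ite d .skip (.sub d 2 a)]

theorem absCmd_spec {d a : ℕ} {s : State} (had : a ≠ d) (hd : 2 ≠ d) (h2 : s.reg 2 = 0) {i : ℕ}
    [Sz v i (s.reg a)] (hi : i ≤ 40) :
    Tri O (opBits v) (absCmd d a) 5 s fun s' => s'.reg d = |s.reg a| := by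
  refine Tri.of_wp (one_le_opBits v) ?_
  have := Sz.bits_le (v := v) (x := s.reg a) hi
  have h0 := Sz.bits_le (v := v) (x := 0) (by norm_num)
  simp [absCmd, Cmd.block, wp, *]
  exact ⟨fun h => (abs_of_pos h).symm, fun h => (abs_of_nonpos h).symm⟩

/-- Replaces register 13 by the maximum with register 44. -/
def maxCmd : Cmd := .block [.sub 39 44 13, .ite 39 (.add 13 44 2) .skip]

theorem maxCmd_spec {s : State} (h2 : s.reg 2 = 0) [Sz v 3 (s.reg 44)] [Sz v 3 (s.reg 13)] :
    Tri O (opBits v) maxCmd 5 s fun s' => s'.reg 13 = max (s.reg 44) (s.reg 13) := by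
  refine Tri.of_wp (one_le_opBits v) ?_
  simp [maxCmd, Cmd.block, wp, *, Sz.bits_le]
  exact fun h => h.le

/-- Newton's iteration. -/
def newtonLoop : Cmd :=
  .loop 48 (.block [.mul 50 44 44, .add 50 50 47, .add 44 44 44, .div 44 50 44, .mul 49 49 49,
    .sub 48 51 49])

/-- Computes the norm of the vector in the registers 42, 43 in register 44 with error at most 1. -/
def normCmd : Cmd :=
  .block [absCmd 44 42, absCmd 48 43, .block [.add 44 44 48, .mul 47 42 42, .mul 48 43 43,
    .add 47 47 48, .const 49 4, .add 51 44 44, .sub 48 51 49], newtonLoop]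

/-- Register 49 holds p = 4^(2^t), which certifies that the iterate exceeds √N by at most max(1,
2√N/p). From N ≤ x₀² ≤ 2N one gets x₀ ≤ (3/2)√N, hence the start p = 4. The loop ends when p ≥ 2x₀ ≥
2√N, where the bound is 1. The case N = 0 is kept apart because `newton_step` needs a positive root.
-/
theorem newtonLoop_spec {s : State} {N x₀ : ℤ} {T : ℕ} (h47 : s.reg 47 = N) (h44 : s.reg 44 = x₀)
    (h49 : s.reg 49 = 4) (h51 : s.reg 51 = x₀ + x₀) (h48 : s.reg 48 = x₀ + x₀ - 4)
    [Sz v 2 x₀] [Sz v 4 N] (hx₀ : 0 ≤ x₀) (hN : N ≤ x₀ * x₀) (hN' : x₀ * x₀ ≤ 2 * N)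
    (hT : x₀ + x₀ ≤ 4 ^ 2 ^ T) :
    Tri O (opBits v) newtonLoop (T * 8 + 1) s fun s' => 0 ≤ s'.reg 44 ∧
      |(s'.reg 44 : ℝ) - Real.sqrt N| ≤ 1 := by
  have hN0 : 0 ≤ N := by nlinarith
  have hNr : (0 : ℝ) ≤ N := by exact_mod_cast hN0
  have hs : Real.sqrt N ^ 2 = N := Real.sq_sqrt hNr
  have hs0 := Real.sqrt_nonneg N
  have hx₀r : (0 : ℝ) ≤ x₀ := by exact_mod_cast hx₀
  have hNx : (N : ℝ) ≤ x₀ * x₀ := by exact_mod_cast hN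
  have hNx' : (x₀ : ℝ) * x₀ ≤ 2 * N := by exact_mod_cast hN'
  have hsx : Real.sqrt N ≤ x₀ := by
    refine Real.sqrt_le_iff.2 ⟨hx₀r, by nlinarith⟩
  refine Tri.loop (N := 7) (fun j u => ∃ t : ℕ, t + j = T ∧ u.reg 49 = 4 ^ 2 ^ t ∧
    u.reg 48 = x₀ + x₀ - 4 ^ 2 ^ t ∧ (4 : ℤ) ^ 2 ^ t ≤ (x₀ + x₀) * (x₀ + x₀) + 4 ∧
    (N = 0 → u.reg 44 = 0) ∧ (0 < N → 0 < u.reg 44 ∧ Real.sqrt N - 1 < u.reg 44 ∧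
      u.reg 44 - Real.sqrt N ≤ max 1 (2 * Real.sqrt N / (4 ^ 2 ^ t : ℤ)))) T ?_ ?_
  · refine ⟨0, by omega, by simpa using h49, by simpa using h48, by rw [pow_zero, pow_one]; nlinarith, fun h => ?_,
      fun h => ⟨?_, ?_, ?_⟩⟩
    · rw [h44]; nlinarith
    · rw [h44]; by_contra h'; nlinarith
    · rw [h44]; linarith
    · refine le_max_of_le_right ?_
      rw [h44]
      have : (x₀ : ℝ) ≤ 3 / 2 * Real.sqrt N := by
        refine abs_le_of_sq_le_sq' ?_ (by positivity) |>.2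
        nlinarith
      push_cast
      linarith
  rintro j u ⟨t, htj, i49, i48, hp4, hNz, hNp⟩ hfr
  have i47 := (hfr.1 47 (by decide)).trans h47
  have i51 := (hfr.1 51 (by decide)).trans h51
  have hp1 : (4 : ℤ) ≤ 4 ^ 2 ^ t := le_self_pow₀ (by norm_num) (by positivity)
  have hp0 : (4 : ℝ) ≤ ((4 ^ 2 ^ t : ℤ) : ℝ) := by exact_mod_cast hp1
  have sp : Sz v 7 (4 ^ 2 ^ t : ℤ) :=
    (Sz.of_le (y := (x₀ + x₀) * (x₀ + x₀) + 4) (by positivity) hp4)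
  have hV0 : 0 ≤ u.reg 44 := by
    rcases hN0.eq_or_lt with h | h
    · exact (hNz h.symm).ge
    · exact (hNp h).1.le
  have sV : Sz v 4 (u.reg 44) := by
    refine Sz.of_le (y := x₀ + x₀ + 1) hV0 ?_
    rcases hN0.eq_or_lt with h | h
    · rw [hNz h.symm]; omega
    · obtain ⟨-, -, h3⟩ := hNp h
      have h4 : 2 * Real.sqrt N / (4 ^ 2 ^ t : ℤ) ≤ Real.sqrt N := by
        rw [div_le_iff₀ (by linarith)]; nlinarith
      have h5 : (u.reg 44 : ℝ) - Real.sqrt N ≤ 1 + Real.sqrt N :=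
        h3.trans (max_le (by linarith) (by linarith))
      have : (u.reg 44 : ℝ) ≤ x₀ + x₀ + 1 := by linarith
      exact_mod_cast this
  refine ⟨by rw [i48]; exact Sz.bits_le (by norm_num), fun h => ⟨hV0, ?_⟩, fun h => ?_⟩
  · rcases hN0.eq_or_lt with h' | h'
    · rw [hNz h'.symm, ← h']; simp
    · obtain ⟨-, h2, h3⟩ := hNp h'
      rw [i48] at h
      have h6 : ((x₀ + x₀ : ℤ) : ℝ) ≤ ((4 ^ 2 ^ t : ℤ) : ℝ) := by
        have : x₀ + x₀ ≤ 4 ^ 2 ^ t := by linarith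
        exact_mod_cast this
      have h4 : 2 * Real.sqrt N / (4 ^ 2 ^ t : ℤ) ≤ 1 := by
        rw [div_le_one (by linarith)]
        push_cast at h6 ⊢
        linarith
      rw [max_eq_left h4] at h3
      exact abs_le.2 ⟨by linarith, h3⟩
  · rw [i48] at h
    obtain ⟨j, rfl⟩ : ∃ j', j = j' + 1 := by
      rcases j with _ | j
      · obtain rfl : t = T := by omega
        omega
      · exact ⟨j, rfl⟩
    have hpp : (4 : ℤ) ^ 2 ^ t * 4 ^ 2 ^ t = 4 ^ 2 ^ (t + 1) := by
      rw [← pow_add]; congr 1; ring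
    -- The loop continues only while p < 2x₀, so the squared p stays below (2x₀)²; the summand 4 is
    -- for the initial value.
    have hp4' : (4 : ℤ) ^ 2 ^ (t + 1) ≤ (x₀ + x₀) * (x₀ + x₀) + 4 := by
      rw [← hpp]; nlinarith
    refine ⟨j, rfl, (Tri.of_wp (one_le_opBits v) (Q := fun u' =>
      u'.reg 49 = 4 ^ 2 ^ (t + 1) ∧ u'.reg 48 = x₀ + x₀ - 4 ^ 2 ^ (t + 1) ∧
      u'.reg 44 = (u.reg 44 * u.reg 44 + N) / (u.reg 44 + u.reg 44)) ?_).mono (by decide)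
      fun u' _ ⟨k49, k48, k44⟩ => ⟨t + 1, by omega, k49, k48, hp4', fun h0 => ?_, fun h0 => ?_⟩⟩
    · have sp' : Sz v 7 (4 ^ 2 ^ (t + 1) : ℤ) :=
        (Sz.of_le (y := (x₀ + x₀) * (x₀ + x₀) + 4) (by positivity) hp4')
      simp only [Cmd.block, wp, State.setReg_reg, i49, i47, i51]
      simp [Sz.bits_le, hpp]
    · rw [k44, hNz h0, h0]; simp
    · rw [k44, ← hpp]
      obtain ⟨h1, h2, h3⟩ := hNp h0
      exact newton_step hs (Real.sqrt_pos.2 (by exact_mod_cast h0)) h1 (by linarith) h2 h3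

/-- The start |x| + |y| is within a factor √2 of the modulus. Its double is at most 2^(v+3), and
4^(2^T) = 2^(2^(T+1)) reaches this after T squarings. -/
theorem normCmd_spec {s : State} {x y : ℤ} {T : ℕ} (h2 : s.reg 2 = 0) (h42 : s.reg 42 = x)
    (h43 : s.reg 43 = y) [sx : Sz v 1 x] [sy : Sz v 1 y] (hT : v + 3 ≤ 2 ^ (T + 1)) :
    Tri O (opBits v) normCmd (T * 8 + 20) s fun s' =>
      0 ≤ s'.reg 44 ∧ |(s'.reg 44 : ℝ) - Real.sqrt (x * x + y * y : ℤ)| ≤ 1 := by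
  have sx' : Sz v 1 (s.reg 42) := by rw [h42]; exact sx
  refine Tri.mono (Tri.cons (N' := T * 8 + 15) (absCmd_spec (by norm_num) (by norm_num) h2
    (i := 1) (by norm_num)) fun s₁ f₁ r44 => ?_) (by omega) fun _ _ h => h
  have h2₁ := (f₁.1 2 (by decide)).trans h2
  have h42₁ := (f₁.1 42 (by decide)).trans h42
  have h43₁ := (f₁.1 43 (by decide)).trans h43
  have sy' : Sz v 1 (s₁.reg 43) := by rw [h43₁]; exact sy
  refine Tri.mono (Tri.cons (N' := T * 8 + 10) (absCmd_spec (by norm_num) (by norm_num) h2₁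
    (i := 1) (by norm_num)) fun s₂ f₂ r48 => ?_) (by omega) fun _ _ h => h
  have h42₂ := (f₂.1 42 (by decide)).trans h42₁
  have h43₂ := (f₂.1 43 (by decide)).trans h43₁
  have h44₂ := (f₂.1 44 (by decide)).trans r44
  rw [h42] at h44₂
  rw [h43₁] at r48
  have sax : Sz v 1 |x| := ⟨by rw [abs_abs]; exact sx.le⟩
  have say : Sz v 1 |y| := ⟨by rw [abs_abs]; exact sy.le⟩
  refine Tri.mono (Tri.cons (N' := T * 8 + 2) (R := fun u => u.reg 47 = x * x + y * y ∧
    u.reg 44 = |x| + |y| ∧ u.reg 49 = 4 ∧ u.reg 51 = |x| + |y| + (|x| + |y|) ∧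
    u.reg 48 = |x| + |y| + (|x| + |y|) - 4) (Tri.of_wp (one_le_opBits v) ?_)
    fun s₃ f₃ ⟨k47, k44, k49, k51, k48⟩ => ?_) (by simp [Cmd.block, Cmd.length]; omega)
    fun _ _ h => h
  · simp only [Cmd.block, wp, State.setReg_reg, h42₂, h43₂, h44₂, r48]
    simp [Sz.bits_le]
  · have ax := abs_nonneg x
    have ay := abs_nonneg y
    have ax2 := abs_mul_abs_self x
    have ay2 := abs_mul_abs_self y
    have s0 : Sz v 2 (|x| + |y|) := inferInstanceAs (Sz v (max 1 1 + 1) _)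
    have s1 : Sz v 4 (x * x + y * y) := Sz.mono (i := max (1 + 1) (1 + 1) + 1) inferInstance
      (by norm_num)
    refine Tri.mono (Tri.cons (N' := 1) (newtonLoop_spec k47 k44 k49 k51 k48 (T := T)
      (by positivity) (by nlinarith) (by nlinarith [sq_nonneg (|x| - |y|)]) ?_)
      fun s₄ f₄ h => Tri.nil (one_le_opBits v) h) le_rfl fun _ _ h => h
    have e1 := sx.le
    have e2 := sy.le
    rw [one_mul] at e1 e2
    have e3 : (2 : ℤ) ^ (v + 3) ≤ 4 ^ 2 ^ T := by
      have : (4 : ℤ) = 2 ^ 2 := by norm_num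
      rw [this, ← pow_mul, ← pow_succ']
      exact pow_le_pow_right₀ one_le_two hT
    have e4 : (2 : ℤ) ^ (v + 3) = 2 ^ (v + 1) * 4 := by ring
    linarith

end SparseRoots

/-! ### Moduli of all coefficients, their sum and their maximum -/

namespace SparseRoots

variable {O : ℕ → ℕ → ℤ} {v : ℕ}

theorem norm_cpx (P x y : ℤ) (hP : 0 < P) :
    ‖cpx P x y‖ = Real.sqrt (x * x + y * y : ℤ) / P := by
  have hP' : (0 : ℝ) < P := by exact_mod_cast hP
  rw [Complex.norm_def, Complex.normSq_apply, cpx]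
  have : (x : ℝ) / P * (x / P) + y / P * (y / P) = ((x * x + y * y : ℤ) : ℝ) / P ^ 2 := by
    push_cast; field_simp
  simp only [this]
  rw [Real.sqrt_div' _ (by positivity), Real.sqrt_sq hP'.le]

theorem le_of_abs_sub_sqrt_le {V x y : ℤ} [sx : Sz v 1 x] [sy : Sz v 1 y]
    (h : |(V : ℝ) - Real.sqrt (x * x + y * y : ℤ)| ≤ 1) : V ≤ 2 ^ (3 * (v + 1)) := by
  have e1 := sx.le
  have e2 := sy.le
  rw [one_mul] at e1 e2
  have e3 : Real.sqrt (x * x + y * y : ℤ) ≤ |(x : ℝ)| + |(y : ℝ)| := by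
    refine Real.sqrt_le_iff.2 ⟨by positivity, ?_⟩
    push_cast
    nlinarith [abs_mul_abs_self (x : ℝ), abs_mul_abs_self (y : ℝ),
      mul_nonneg (abs_nonneg (x : ℝ)) (abs_nonneg (y : ℝ))]
  have e4 : V ≤ |x| + |y| + 1 := by
    have : (V : ℝ) ≤ |(x : ℝ)| + |(y : ℝ)| + 1 := by linarith [(abs_le.1 h).2]
    exact_mod_cast this
  have e5 : (2 : ℤ) ≤ 2 ^ (v + 1) := le_self_pow₀ (by norm_num) (by omega)
  have e6 : (2 : ℤ) ^ (3 * (v + 1)) = 2 ^ (v + 1) * 2 ^ (v + 1) * 2 ^ (v + 1) := by ring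
  rw [e6]
  generalize (2 : ℤ) ^ (v + 1) = t at *
  have e7 : 2 * 2 ≤ t * t := mul_le_mul e5 e5 (by norm_num) (by linarith)
  have e8 : 2 * 2 * t ≤ t * t * t := mul_le_mul_of_nonneg_right e7 (by linarith)
  linarith

theorem abs_div_sub_norm_le {P V x y : ℤ} {η B : ℝ} {k : ℕ} {z : ℂ} (hP : 0 < P)
    (h : |(V : ℝ) - Real.sqrt (x * x + y * y : ℤ)| ≤ 1) (hz : Near η k B (cpx P x y) z) :
    |(V : ℝ) / P - ‖z‖| ≤ ((1 + η) ^ k - 1) * B + 1 / P := by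
  have hP' : (0 : ℝ) < P := by exact_mod_cast hP
  have e1 := abs_norm_sub_norm_le (cpx P x y) z
  have e2 : |(V : ℝ) / P - ‖cpx P x y‖| ≤ 1 / P := by
    rw [norm_cpx P x y hP, ← sub_div, abs_div, abs_of_pos hP']
    exact div_le_div_of_nonneg_right h hP'.le
  have e3 := abs_sub_le ((V : ℝ) / P) ‖cpx P x y‖ ‖z‖
  linarith [hz.err]

/-- Computes the absolute values of the coefficients of the shifted polynomial, their sum and
their maximum, and part of the error bound. -/
def normLoop : Cmd :=
  .loop 38 (.block [.block [.add 37 35 35, .add 37 37 5, .load 42 37, .add 39 37 3, .load 43 39,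
      .mul 42 42 41, .div 42 42 6, .mul 43 43 41, .div 43 43 6],
    normCmd, .block [.store 37 44, .add 14 14 44], maxCmd,
    .block [.mul 41 41 10, .div 41 41 6, .mul 12 12 46, .add 35 35 3, .sub 38 38 3]])

-- Rounding exponents: 2n+1 for S_i, 2i for r^i and one for their product, at most 2n+2K+2 in all.
-- The integer modulus overwrites the cell of the real part, once both parts of that coefficient
-- have been read. The factor q^(K+1) of the error bound is built up along the way. The maximum
-- register starts at 0, so the invariant treats the empty range separately.
set_option maxHeartbeats 1000000 in
theorem normLoop_spec {s : State} {P mr q D₀ : ℤ} {r : ℝ} {R δ : ℝ} {n K base T : ℕ}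
    {S : ℕ → ℂ} {B : ℕ → ℝ} (hP : 0 < P)
    (h2 : s.reg 2 = 0) (h3 : s.reg 3 = 1) (h5 : s.reg 5 = base) (h6 : s.reg 6 = P)
    (h10 : s.reg 10 = mr) (h12 : s.reg 12 = D₀) (h13 : s.reg 13 = 0) (h14 : s.reg 14 = 0)
    (h35 : s.reg 35 = 0) (h38 : s.reg 38 = (K + 1 : ℕ)) (h41 : s.reg 41 = P) (h46 : s.reg 46 = q)
    (hR : 1 ≤ R) (hD₀ : 0 ≤ D₀) (hq : 1 ≤ q) (hT : v + 3 ≤ 2 ^ (T + 1))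
    [Sz v 1 P] [Sz v 1 mr] [Sz v 1 q] [Sz v 1 (D₀ * q ^ (K + 1))] [Sz v 1 (base + 2 * K + 2 : ℤ)]
    (hr : Near (4 / P) 1 R (cpx P mr 0) r) (hB1 : ∀ i ≤ K, 1 ≤ B i)
    (hS : ∀ i ≤ K, Near (4 / P) (2 * n + 1) (B i)
      (cpx P (s.mem (base + 2 * i)) (s.mem (base + 2 * i + 1))) (S i))
    (hv₁ : P * ((1 + 4 / P : ℝ) ^ (2 * K + 2) * R ^ (K + 1)) ≤ 2 ^ (v + 1))
    (hv₂ : ∀ i ≤ K, P * ((1 + 4 / P : ℝ) ^ (2 * n + 2 * K + 2) * (B i * R ^ i)) ≤ 2 ^ (v + 1))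
    (hδ : ∀ i ≤ K, ((1 + 4 / P : ℝ) ^ (2 * n + 2 * K + 2) - 1) * (B i * R ^ i) + 1 / P ≤ δ) :
    Tri O (opBits v) normLoop ((K + 1) * (T * 8 + 50) + 1) s fun s' =>
      (∀ i ≤ K, 0 ≤ s'.mem (base + 2 * i) ∧ s'.mem (base + 2 * i) ≤ 2 ^ (3 * (v + 1)) ∧
        |(s'.mem (base + 2 * i) : ℝ) / P - ‖S i * (r : ℂ) ^ i‖| ≤ δ) ∧
      s'.reg 14 = ∑ i ∈ Finset.range (K + 1), s'.mem (base + 2 * i) ∧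
      (∀ i ≤ K, s'.mem (base + 2 * i) ≤ s'.reg 13) ∧
      (∃ i ≤ K, s'.reg 13 = s'.mem (base + 2 * i)) ∧
      s'.reg 12 = D₀ * q ^ (K + 1) ∧ ∀ a < base, s'.mem a = s.mem a := by
  have hP' : (0 : ℝ) < P := by exact_mod_cast hP
  have hη : (0 : ℝ) ≤ 4 / P := by positivity
  refine Tri.mono (Tri.loop (N := T * 8 + 49) (fun j u => ∃ i : ℕ, i + j = K + 1 ∧ u.reg 35 = i ∧
    u.reg 38 = j ∧
    Near (4 / P) (2 * i) (R ^ i) (cpx P (u.reg 41) 0) ((r : ℂ) ^ i) ∧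
    (∀ i' ≤ K, i ≤ i' → Near (4 / P) (2 * n + 1) (B i')
      (cpx P (u.mem (base + 2 * i')) (u.mem (base + 2 * i' + 1))) (S i')) ∧
    (∀ i' < i, 0 ≤ u.mem (base + 2 * i') ∧ u.mem (base + 2 * i') ≤ 2 ^ (3 * (v + 1)) ∧
        |(u.mem (base + 2 * i') : ℝ) / P - ‖S i' * (r : ℂ) ^ i'‖| ≤ δ) ∧
    u.reg 14 = ∑ i' ∈ Finset.range i, u.mem (base + 2 * i') ∧
    (∀ i' < i, u.mem (base + 2 * i') ≤ u.reg 13) ∧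
    ((i = 0 ∧ u.reg 13 = 0) ∨ ∃ i' < i, u.reg 13 = u.mem (base + 2 * i')) ∧
    u.reg 12 = D₀ * q ^ i ∧ ∀ a < base, u.mem a = s.mem a) (K + 1) ?_ ?_) le_rfl fun _ _ h => h
  · refine ⟨0, by omega, h35, h38, ?_, fun i hi _ => hS i hi, by simp, by simpa using h14, by simp,
      Or.inl ⟨rfl, h13⟩, by simpa using h12, fun _ _ => rfl⟩
    have : cpx P (s.reg 41) 0 = (r : ℂ) ^ 0 := by
      rw [h41]; apply Complex.ext <;> simp [cpx, hP'.ne']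
    rw [this]
    exact Near.of_eq (by simp)
  rintro j u ⟨i, hij, i35, i38, irp, iS, iV, i14, imax, imax', i12, imem⟩ hfr
  have i2 := (hfr.1 2 (by decide)).trans h2
  have i3 := (hfr.1 3 (by decide)).trans h3
  have i5 := (hfr.1 5 (by decide)).trans h5
  have i6 := (hfr.1 6 (by decide)).trans h6
  have i10 := (hfr.1 10 (by decide)).trans h10
  have i46 := (hfr.1 46 (by decide)).trans h46
  have sK : ∀ x : ℕ, x ≤ base + 2 * K + 2 → Sz v 1 (x : ℤ) := fun x hx =>
    Sz.of_le (y := (base + 2 * K + 2 : ℤ)) (by positivity) (by exact_mod_cast hx)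
  have sj := sK j (by omega)
  refine ⟨by rw [i38]; exact Sz.bits_le (by norm_num), fun h => ?_, fun h => ?_⟩
  · obtain rfl : j = 0 := by omega
    obtain rfl : i = K + 1 := by omega
    refine ⟨fun i' hi' => iV i' (by omega), i14, fun i' hi' => imax i' (by omega), ?_, i12, imem⟩
    rcases imax' with h' | ⟨i', h', h''⟩
    · omega
    · exact ⟨i', by omega, h''⟩
  obtain ⟨j, rfl⟩ : ∃ j', j = j' + 1 := ⟨j - 1, by omega⟩
  have hiK : i ≤ K := by omega
  have nS := iS i hiK le_rfl
  have hR' : 1 ≤ R ^ i := one_le_pow₀ hR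
  have bS : P * ((1 + 4 / P : ℝ) ^ (2 * n + 1) * B i) ≤ 2 ^ (v + 1) := by
    refine le_trans (mul_le_mul_of_nonneg_left ?_ hP'.le) (hv₂ i hiK)
    exact mul_le_mul (pow_le_pow_right₀ (by linarith) (by omega))
      (le_mul_of_one_le_right (by linarith [hB1 i hiK]) hR') (by linarith [hB1 i hiK])
      (by positivity)
  obtain ⟨sS1, sS2⟩ := nS.sz hP bS
  obtain ⟨srp, -⟩ := (irp.mono hη (s' := 2 * K + 2) (B' := R ^ (K + 1)) (by omega)
    (pow_le_pow_right₀ hR (by omega))).sz hP hv₁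
  have si := sK i (by omega)
  have sb := sK base (by omega)
  set xx := u.mem (base + 2 * i) * u.reg 41 / P with hxx
  set yy := u.mem (base + 2 * i + 1) * u.reg 41 / P with hyy
  have na : Near (4 / P) (2 * n + 2 * K + 2) (B i * R ^ i) (cpx P xx yy) (S i * (r : ℂ) ^ i) := by
    have := nS.mul irp hη (hB1 i hiK) hR' (norm_cpx_ediv_sub_le _ _ _ _ hP)
    simp only [mul_zero, sub_zero, zero_add] at this
    exact this.mono hη (by omega) le_rfl
  obtain ⟨sxx, syy⟩ := na.sz hP (hv₂ i hiK)
  refine ⟨j, rfl, ?_⟩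
  refine Tri.mono (Tri.cons (N' := T * 8 + 39) (R := fun w => w.reg 37 = (base + 2 * i : ℕ) ∧
    w.reg 42 = xx ∧ w.reg 43 = yy) (Tri.of_wp (one_le_opBits v) ?_) fun s₁ f₁ ⟨a37, a42, a43⟩ => ?_)
    (by simp [Cmd.block, Cmd.length]; omega) fun _ _ h => h
  · have a1 : ((base : ℤ) + 2 * i).toNat = base + 2 * i := by omega
    have a2 : ((base : ℤ) + 2 * i + 1).toNat = base + 2 * i + 1 := by omega
    have a3 : (i : ℤ) + i + base = base + 2 * i := by ring
    simp only [Cmd.block, wp, State.setReg_reg, i35, i5, i3, i6]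
    simp [Sz.bits_le, a1, a2, hxx, hyy, a3]
  have b2 := (f₁.1 2 (by decide)).trans i2
  refine Tri.mono (Tri.cons (N' := T * 0 + 19) (normCmd_spec b2 a42 a43 hT)
    fun s₂ f₂ ⟨hV0, hV⟩ => ?_) (by omega) fun _ _ h => h
  set V := s₂.reg 44 with hVdef
  have hVle : V ≤ 2 ^ (3 * (v + 1)) := le_of_abs_sub_sqrt_le hV
  have hVerr : |(V : ℝ) / P - ‖S i * (r : ℂ) ^ i‖| ≤ δ :=
    (abs_div_sub_norm_le hP hV na).trans (hδ i hiK)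
  have sV : Sz v 3 V := ⟨by rw [abs_of_nonneg hV0]; exact hVle⟩
  have c37 := (f₂.1 37 (by decide)).trans a37
  have c14 := ((f₂.1 14 (by decide)).trans (f₁.1 14 (by decide)))
  have cmem : s₂.mem = u.mem := (f₂.2 (by decide)).trans (f₁.2 (by decide))
  have sadr : Sz v 1 ((base + 2 * i : ℕ) : ℤ) := sK _ (by omega)
  have ssum : Sz v 4 (u.reg 14) := by
    refine Sz.of_le (y := (i : ℤ) * 2 ^ (3 * (v + 1))) (hy := ?_) ?_ ?_
    · have : Sz v 3 (2 ^ (3 * (v + 1)) : ℤ) := ⟨by simp⟩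
      exact Sz.mono (i := 1 + 3) inferInstance (by norm_num)
    · rw [i14]; exact Finset.sum_nonneg fun i' hi' => (iV i' (Finset.mem_range.1 hi')).1
    · rw [i14]
      have := Finset.sum_le_card_nsmul (Finset.range i) (fun i' => u.mem (base + 2 * i'))
        (2 ^ (3 * (v + 1))) fun i' hi' => (iV i' (Finset.mem_range.1 hi')).2.1
      simpa using this
  refine Tri.mono (Tri.cons (N' := 16) (R := fun w => w.reg 14 = u.reg 14 + V ∧
      ∀ x, w.mem x = if x = base + 2 * i then V else u.mem x)
    (Tri.of_wp (one_le_opBits v) ?_) fun s₃ f₃ ⟨d14, dmem⟩ => ?_)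
    (by simp [Cmd.block, Cmd.length]) fun _ _ h => h
  · simp only [Cmd.block, wp, State.setReg_reg, State.setMem_reg, c37, c14, ← hVdef]
    have a1 : ((base : ℤ) + 2 * i).toNat = base + 2 * i := by omega
    simp [Sz.bits_le, cmem, a1]
  have d2 := (f₃.1 2 (by decide)).trans ((f₂.1 2 (by decide)).trans b2)
  have d44 := (f₃.1 44 (by decide))
  have d13 := (f₃.1 13 (by decide)).trans ((f₂.1 13 (by decide)).trans (f₁.1 13 (by decide)))
  have sd44 : Sz v 3 (s₃.reg 44) := by rw [d44]; exact sV
  have hmax0 : 0 ≤ u.reg 13 ∧ u.reg 13 ≤ 2 ^ (3 * (v + 1)) := by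
    rcases imax' with ⟨-, h'⟩ | ⟨i', h', h''⟩
    · rw [h']; exact ⟨le_rfl, by positivity⟩
    · rw [h'']; exact ⟨(iV i' h').1, (iV i' h').2.1⟩
  have sd13 : Sz v 3 (s₃.reg 13) := by
    rw [d13]; exact ⟨by rw [abs_of_nonneg hmax0.1]; exact hmax0.2⟩
  refine Tri.mono (Tri.cons (N' := 8) (maxCmd_spec d2) fun s₄ f₄ g13 => ?_) (by omega)
    fun _ _ h => h
  rw [d13, d44, ← hVdef] at g13
  have g3 := (f₄.1 3 (by decide)).trans ((f₃.1 3 (by decide)).trans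
    ((f₂.1 3 (by decide)).trans ((f₁.1 3 (by decide)).trans i3)))
  have g6 := (f₄.1 6 (by decide)).trans ((f₃.1 6 (by decide)).trans
    ((f₂.1 6 (by decide)).trans ((f₁.1 6 (by decide)).trans i6)))
  have g10 := (f₄.1 10 (by decide)).trans ((f₃.1 10 (by decide)).trans
    ((f₂.1 10 (by decide)).trans ((f₁.1 10 (by decide)).trans i10)))
  have g12 := (f₄.1 12 (by decide)).trans ((f₃.1 12 (by decide)).trans
    ((f₂.1 12 (by decide)).trans ((f₁.1 12 (by decide)).trans i12)))
  have g35 := (f₄.1 35 (by decide)).trans ((f₃.1 35 (by decide)).trans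
    ((f₂.1 35 (by decide)).trans ((f₁.1 35 (by decide)).trans i35)))
  have g38 := (f₄.1 38 (by decide)).trans ((f₃.1 38 (by decide)).trans
    ((f₂.1 38 (by decide)).trans ((f₁.1 38 (by decide)).trans i38)))
  have g41 := (f₄.1 41 (by decide)).trans ((f₃.1 41 (by decide)).trans
    ((f₂.1 41 (by decide)).trans (f₁.1 41 (by decide))))
  have g46 := (f₄.1 46 (by decide)).trans ((f₃.1 46 (by decide)).trans
    ((f₂.1 46 (by decide)).trans ((f₁.1 46 (by decide)).trans i46)))
  have g14 := (f₄.1 14 (by decide)).trans d14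
  have gmem := f₄.2 (by decide)
  have sD : Sz v 1 (D₀ * q ^ i) := Sz.of_le (y := D₀ * q ^ (K + 1)) (by positivity)
    (mul_le_mul_of_nonneg_left (pow_le_pow_right₀ hq (by omega)) hD₀)
  push_cast at sj g38
  refine Tri.mono (Tri.cons (N' := 1) (R := fun w => w.reg 41 = u.reg 41 * mr / P ∧
      w.reg 12 = D₀ * q ^ (i + 1) ∧ w.reg 35 = (i + 1 : ℕ) ∧ w.reg 38 = j ∧ w.reg 13 = s₄.reg 13 ∧
      w.reg 14 = s₄.reg 14 ∧ w.mem = s₄.mem)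
    (Tri.of_wp (one_le_opBits v) ?_) fun s₅ f₅ ⟨k41, k12, k35, k38, k13, k14, kmem⟩ =>
      Tri.nil (one_le_opBits v) ?_)
    (by simp [Cmd.block, Cmd.length]) fun _ _ h => h
  · simp only [Cmd.block, wp, State.setReg_reg, State.setReg_mem, g3, g6, g10, g12, g35, g38, g41,
      g46]
    simp [Sz.bits_le, pow_succ, mul_assoc]
  have kmem' : ∀ x, s₅.mem x = if x = base + 2 * i then V else u.mem x := fun x => by
    rw [kmem, gmem, dmem]
  have kold : ∀ i' < i, s₅.mem (base + 2 * i') = u.mem (base + 2 * i') := fun i' hi' => by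
    rw [kmem', if_neg (by omega)]
  have knew : s₅.mem (base + 2 * i) = V := by rw [kmem', if_pos rfl]
  rw [k13.symm] at g13
  refine ⟨i + 1, by omega, k35, k38, ?_, ?_, ?_, ?_, ?_, ?_, k12, ?_⟩
  · have := irp.mul hr hη hR' hR (norm_cpx_ediv_sub_le _ _ _ _ hP)
    simp only [mul_zero, sub_zero, zero_mul, add_zero, Int.zero_ediv] at this
    rw [k41, pow_succ, pow_succ]
    exact this.mono hη (by omega) le_rfl
  · intro i' hi' hii'
    rw [kmem', kmem', if_neg (by omega), if_neg (by omega)]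
    exact iS i' hi' (by omega)
  · intro i' hi'
    rcases Nat.lt_succ_iff_lt_or_eq.1 hi' with h' | rfl
    · rw [kold i' h']; exact iV i' h'
    · rw [knew]; exact ⟨hV0, hVle, hVerr⟩
  · rw [Finset.sum_range_succ, knew, k14, g14, i14]
    congr 1
    exact Finset.sum_congr rfl fun i' hi' => (kold i' (Finset.mem_range.1 hi')).symm
  · intro i' hi'
    rw [g13]
    rcases Nat.lt_succ_iff_lt_or_eq.1 hi' with h' | rfl
    · rw [kold i' h']; exact le_max_of_le_right (imax i' h')
    · rw [knew]; exact le_max_left _ _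
  · right
    rw [g13]
    rcases le_or_gt (u.reg 13) V with h' | h'
    · exact ⟨i, by omega, by rw [knew, max_eq_left h']⟩
    · rcases imax' with ⟨-, h0⟩ | ⟨i', h1, h2⟩
      · omega
      · exact ⟨i', by omega, by rw [kold i' h1, max_eq_right h'.le, h2]⟩
  · intro a ha
    rw [kmem', if_neg (by omega), imem a ha]

end SparseRoots

/-! ### Accumulating all terms of the polynomial -/

namespace SparseRoots

variable {O : ℕ → ℕ → ℤ} {v : ℕ}

/-- Clears an array. -/
def zeroLoop : Cmd := .loop 38 (.block [.block [.store 37 2, .add 37 37 3, .sub 38 38 3]])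

theorem zeroLoop_spec {s : State} {base N : ℕ} (h2 : s.reg 2 = 0) (h3 : s.reg 3 = 1)
    (h37 : s.reg 37 = base) (h38 : s.reg 38 = N) [Sz v 1 ((base + N : ℕ) : ℤ)] :
    Tri O (opBits v) zeroLoop (N * 6 + 1) s fun s' =>
      (∀ x, base ≤ x → x < base + N → s'.mem x = 0) ∧ ∀ x < base, s'.mem x = s.mem x := by
  refine Tri.loop (N := 5) (fun j u => ∃ i : ℕ, i + j = N ∧ u.reg 38 = j ∧
    u.reg 37 = (base + i : ℕ) ∧ (∀ x, base ≤ x → x < base + i → u.mem x = 0) ∧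
    ∀ x < base, u.mem x = s.mem x) N
    ⟨0, by omega, h38, h37, fun x h1 h2 => by omega, fun _ _ => rfl⟩ ?_
  rintro j u ⟨i, hij, i38, i37, iz, ib⟩ hfr
  have i2 := (hfr.1 2 (by decide)).trans h2
  have i3 := (hfr.1 3 (by decide)).trans h3
  have s1 : Sz v 1 (j : ℤ) := Sz.of_le (y := ((base + N : ℕ) : ℤ)) (by positivity) (by omega)
  have s2 : Sz v 1 ((base + i : ℕ) : ℤ) :=
    Sz.of_le (y := ((base + N : ℕ) : ℤ)) (by positivity) (by omega)
  refine ⟨by rw [i38]; exact Sz.bits_le (by norm_num), fun h => ?_, fun h => ?_⟩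
  · obtain rfl : i = N := by omega
    exact ⟨iz, ib⟩
  obtain ⟨j, rfl⟩ : ∃ j', j = j' + 1 := ⟨j - 1, by omega⟩
  refine ⟨j, rfl, (Tri.of_wp (one_le_opBits v) (Q := fun w => w.reg 38 = j ∧
    w.reg 37 = (base + (i + 1) : ℕ) ∧ ∀ x, w.mem x = if x = base + i then 0 else u.mem x)
    ?_).mono (by decide) fun w _ ⟨k38, k37, kmem⟩ => ⟨i + 1, by omega, k38, k37, ?_, ?_⟩⟩
  · simp only [Cmd.block, wp, State.setReg_reg, State.setMem_reg, i38, i37, i2, i3, Int.toNat_natCast]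
    push_cast at s1 s2
    simp [Sz.bits_le, add_assoc]
  · intro x h1 h2
    rw [kmem]
    split_ifs with h3
    · rfl
    · exact iz x h1 (by omega)
  · intro x hx
    rw [kmem, if_neg (by omega), ib x hx]

/-- Puts the minimum of the registers 32 and 4 into register 34. -/
def minCmd : Cmd := .block [.add 34 32 2, .sub 39 32 4, .ite 39 (.add 34 4 2) .skip]

theorem minCmd_spec {s : State} {e K : ℕ} (h2 : s.reg 2 = 0) (h32 : s.reg 32 = e)
    (h4 : s.reg 4 = K) [Sz v 1 (e : ℤ)] [Sz v 1 (K : ℤ)] :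
    Tri O (opBits v) minCmd 6 s fun s' => s'.reg 34 = (min e K : ℕ) := by
  refine Tri.of_wp (one_le_opBits v) ?_
  simp [minCmd, Cmd.block, wp, *, Sz.bits_le]
  exact fun h => h.le

/-- Processes one term of the polynomial. -/
def termCmd : Cmd :=
  .block [.block [.load 32 30, .query 33 30 7, .mul 91 33 33, .add 15 15 91, .add 20 33 2,
      .add 21 2 2, .add 22 8 2, .add 23 9 2],
    minCmd, .sub 24 32 34, powLoop, .block [.const 35 0, .const 36 1, .add 38 34 2], chooseLoop,
    .add 38 34 3, accLoop]

/-- The approximate coefficient enters with one rounding, powering raises this to 1 + 2(e - i₀), and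
each step down in i adds 2; since e ≤ n, the exponent 2n+1 covers every contribution. -/
theorem termCmd_spec {s : State} {P mx my Z : ℤ} {c m : ℂ} {C H : ℝ} {e n K base j κ T : ℕ}
    {S : ℕ → ℂ} {B : ℕ → ℝ} (hP : 0 < P)
    (h2 : s.reg 2 = 0) (h3 : s.reg 3 = 1) (h4 : s.reg 4 = K) (h5 : s.reg 5 = base)
    (h6 : s.reg 6 = P) (h7 : s.reg 7 = κ) (h8 : s.reg 8 = mx) (h9 : s.reg 9 = my)
    (h15 : s.reg 15 = Z) (h28 : s.reg 28 = 2) (h30 : s.reg 30 = j) (hj : s.mem j = e)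
    (hen : e ≤ n) (hC : 1 ≤ C) (hH : 1 ≤ H) (hT : n < 2 ^ T) (hκ : κ ≤ opBits v)
    [Sz v 1 P] [Sz v 1 mx] [Sz v 1 my] [Sz v 1 (n : ℤ)] [Sz v 1 (base + 2 * K + 2 : ℤ)]
    [Sz v 1 (κ : ℤ)] [Sz v 1 (j : ℤ)] [Sz v 3 Z]
    (hch : ∀ i ≤ K, Sz v 1 (e.choose i : ℤ))
    (hc : Near (4 / P) 1 C (cpx P (O j κ) 0) c)
    (hm : Near (4 / P) 1 H (cpx P mx my) m)
    (hS : ∀ i ≤ K, Near (4 / P) (2 * n + 1) (B i)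
      (cpx P (s.mem (base + 2 * i)) (s.mem (base + 2 * i + 1))) (S i))
    (hv₁ : P * ((1 + 4 / P : ℝ) ^ (2 * n + 3) * (C * H ^ (n + 1))) ≤ 2 ^ (v + 1))
    (hv₂ : P * ((1 + 4 / P : ℝ) ^ (4 * n + 1) * H ^ (2 * n + 1)) ≤ 2 ^ (v + 1))
    (hv₃ : ∀ i ≤ K, P * ((1 + 4 / P : ℝ) ^ (2 * n + 1) * (B i)) ≤ 2 ^ (v + 1)) :
    Tri O (opBits v) termCmd (T * 30 + K * 36 + 60) s fun s' =>
      s'.reg 15 = Z + O j κ * O j κ ∧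
      (∀ i ≤ K, Near (4 / P) (2 * n + 1) (B i + e.choose i * (C * H ^ n))
        (cpx P (s'.mem (base + 2 * i)) (s'.mem (base + 2 * i + 1)))
        (S i + e.choose i * (c * m ^ (e - i)))) ∧
      ∀ a < base, s'.mem a = s.mem a := by
  have hP' : (0 : ℝ) < P := by exact_mod_cast hP
  have hη : (0 : ℝ) ≤ 4 / P := by positivity
  have se : Sz v 1 (e : ℤ) := Sz.of_le (y := (n : ℤ)) (by positivity) (by omega)
  have sK : Sz v 1 (K : ℤ) := Sz.of_le (y := (base + 2 * K + 2 : ℤ)) (by positivity) (by omega)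
  obtain ⟨sc, -⟩ := (hc.mono hη (s' := 2 * n + 3) (B' := C * H ^ (n + 1)) (by omega)
    (le_mul_of_one_le_right (by linarith) (one_le_pow₀ hH))).sz hP hv₁
  set i₀ := min e K with hi₀
  have si₀ : Sz v 1 (i₀ : ℤ) := Sz.of_le (y := (n : ℤ)) (by positivity) (by omega)
  refine Tri.mono (Tri.cons (N' := T * 30 + i₀ * 36 + 50) (R := fun w => w.reg 32 = e ∧
      w.reg 15 = Z + O j κ * O j κ ∧ w.reg 20 = O j κ ∧ w.reg 21 = 0 ∧ w.reg 22 = mx ∧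
      w.reg 23 = my) (Tri.of_wp (one_le_opBits v) ?_)
      fun s₁ f₁ ⟨a32, a15, a20, a21, a22, a23⟩ => ?_)
    (by simp [Cmd.block, Cmd.length]; omega) fun _ _ h => h
  · simp only [Cmd.block, wp, State.setReg_reg, h30, h7, Int.toNat_natCast, hj]
    simp [Sz.bits_le, *]
  have a2 := (f₁.1 2 (by decide)).trans h2
  have a4 := (f₁.1 4 (by decide)).trans h4
  refine Tri.mono (Tri.cons (N' := T * 30 + i₀ * 36 + 44) (minCmd_spec a2 a32 a4)
    fun s₂ f₂ b34 => ?_) (by omega) fun _ _ h => h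
  rw [← hi₀] at b34
  have b32 := (f₂.1 32 (by decide)).trans a32
  refine Tri.mono (Tri.cons (N := 1) (N' := T * 30 + i₀ * 36 + 43)
    (R := fun w => w.reg 24 = (e - i₀ : ℕ)) (Tri.of_wp (one_le_opBits v) ?_)
    fun s₃ f₃ c24 => ?_) (by omega) fun _ _ h => h
  · simp only [wp, State.setReg_reg, b32, b34]
    simp [Sz.bits_le]
    omega
  have c2 := (f₃.1 2 (by decide)).trans ((f₂.1 2 (by decide)).trans a2)
  have c6 := (f₃.1 6 (by decide)).trans ((f₂.1 6 (by decide)).trans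
    ((f₁.1 6 (by decide)).trans h6))
  have c28 := (f₃.1 28 (by decide)).trans ((f₂.1 28 (by decide)).trans
    ((f₁.1 28 (by decide)).trans h28))
  have c20 := (f₃.1 20 (by decide)).trans ((f₂.1 20 (by decide)).trans a20)
  have c21 := (f₃.1 21 (by decide)).trans ((f₂.1 21 (by decide)).trans a21)
  have c22 := (f₃.1 22 (by decide)).trans ((f₂.1 22 (by decide)).trans a22)
  have c23 := (f₃.1 23 (by decide)).trans ((f₂.1 23 (by decide)).trans a23)
  have sE : Sz v 1 ((e - i₀ : ℕ) : ℤ) := Sz.of_le (y := (n : ℤ)) (by positivity) (by omega)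
  refine Tri.mono (Tri.cons (N' := i₀ * 36 + 42) (powLoop_spec (T := T) (E := e - i₀) (s₀ := 1)
    (B₀ := C) (H := H) (z₀ := c) (z := m) hP c2 c28 c6 c24 hC hH (by omega)
    (by rw [c20, c21]; exact hc) (by rw [c22, c23]; exact hm) ?_ ?_)
    fun s₄ f₄ hacc => ?_) (by omega) fun _ _ h => h
  · refine le_trans (mul_le_mul_of_nonneg_left ?_ hP'.le) hv₁
    exact mul_le_mul (pow_le_pow_right₀ (by linarith) (by omega))
      (mul_le_mul_of_nonneg_left (pow_le_pow_right₀ hH (by omega)) (by linarith))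
      (by positivity) (by positivity)
  · refine le_trans (mul_le_mul_of_nonneg_left ?_ hP'.le) hv₂
    exact mul_le_mul (pow_le_pow_right₀ (by linarith) (by omega))
      (pow_le_pow_right₀ hH (by omega)) (by positivity) (by positivity)
  have d34 := (f₄.1 34 (by decide)).trans ((f₃.1 34 (by decide)).trans b34)
  have d2 := (f₄.1 2 (by decide)).trans c2
  refine Tri.mono (Tri.cons (N' := i₀ * 36 + 38) (R := fun w => w.reg 35 = 0 ∧ w.reg 36 = 1 ∧
      w.reg 38 = i₀) (Tri.of_wp (one_le_opBits v) ?_) fun s₅ f₅ ⟨e35, e36, e38⟩ => ?_)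
    (by simp [Cmd.block, Cmd.length]; omega) fun _ _ h => h
  · simp only [Cmd.block, wp, State.setReg_reg, d34, d2]
    simp [Sz.bits_le]
  have e3 := (f₅.1 3 (by decide)).trans ((f₄.1 3 (by decide)).trans ((f₃.1 3 (by decide)).trans
    ((f₂.1 3 (by decide)).trans ((f₁.1 3 (by decide)).trans h3))))
  have e32 := (f₅.1 32 (by decide)).trans ((f₄.1 32 (by decide)).trans
    ((f₃.1 32 (by decide)).trans b32))
  have e34 := (f₅.1 34 (by decide)).trans d34
  refine Tri.mono (Tri.cons (N' := i₀ * 29 + 34) (chooseLoop_spec e3 e32 e35 e36 e38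
    (by omega) fun i hi => hch i (by omega))
    fun s₆ f₆ g36 => ?_) (by omega) fun _ _ h => h
  have g34 := (f₆.1 34 (by decide)).trans e34
  have g3 := (f₆.1 3 (by decide)).trans e3
  refine Tri.mono (Tri.cons (N := 1) (N' := i₀ * 29 + 33)
    (R := fun w => w.reg 38 = (i₀ + 1 : ℕ)) (Tri.of_wp (one_le_opBits v) ?_)
    fun s₇ f₇ k38 => ?_) (by omega) fun _ _ h => h
  · simp only [wp, State.setReg_reg, g3, g34]
    simp [Sz.bits_le]
  have k2 := (f₇.1 2 (by decide)).trans ((f₆.1 2 (by decide)).trans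
    ((f₅.1 2 (by decide)).trans d2))
  have k3 := (f₇.1 3 (by decide)).trans g3
  have k5 := (f₇.1 5 (by decide)).trans ((f₆.1 5 (by decide)).trans ((f₅.1 5 (by decide)).trans
    ((f₄.1 5 (by decide)).trans ((f₃.1 5 (by decide)).trans
    ((f₂.1 5 (by decide)).trans ((f₁.1 5 (by decide)).trans h5))))))
  have k6 := (f₇.1 6 (by decide)).trans ((f₆.1 6 (by decide)).trans ((f₅.1 6 (by decide)).trans
    ((f₄.1 6 (by decide)).trans c6)))
  have k8 := (f₇.1 8 (by decide)).trans ((f₆.1 8 (by decide)).trans ((f₅.1 8 (by decide)).trans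
    ((f₄.1 8 (by decide)).trans ((f₃.1 8 (by decide)).trans
    ((f₂.1 8 (by decide)).trans ((f₁.1 8 (by decide)).trans h8))))))
  have k9 := (f₇.1 9 (by decide)).trans ((f₆.1 9 (by decide)).trans ((f₅.1 9 (by decide)).trans
    ((f₄.1 9 (by decide)).trans ((f₃.1 9 (by decide)).trans
    ((f₂.1 9 (by decide)).trans ((f₁.1 9 (by decide)).trans h9))))))
  have k15 := (f₇.1 15 (by decide)).trans ((f₆.1 15 (by decide)).trans
    ((f₅.1 15 (by decide)).trans ((f₄.1 15 (by decide)).trans ((f₃.1 15 (by decide)).trans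
    ((f₂.1 15 (by decide)).trans a15)))))
  have k20 := (f₇.1 20 (by decide)).trans ((f₆.1 20 (by decide)).trans (f₅.1 20 (by decide)))
  have k21 := (f₇.1 21 (by decide)).trans ((f₆.1 21 (by decide)).trans (f₅.1 21 (by decide)))
  have k32 := (f₇.1 32 (by decide)).trans ((f₆.1 32 (by decide)).trans e32)
  have k36 := (f₇.1 36 (by decide)).trans g36
  have kmem : s₇.mem = s.mem := (f₇.2 (by decide)).trans ((f₆.2 (by decide)).trans
    ((f₅.2 (by decide)).trans ((f₄.2 (by decide)).trans ((f₃.2 (by decide)).trans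
    ((f₂.2 (by decide)).trans (f₁.2 (by decide)))))))
  refine Tri.mono (Tri.cons (N' := 1) (accLoop_spec (c := c) (m := m) (C := C) (H := H) (n := n)
    (B := B) (S := S) (K := K) hP k2 k3 k5 k6 k8 k9 k32 k36 k38 hi₀ hen hC hH
    (fun i hi => hch i (by omega)) (by rw [k20, k21]; exact hacc) hm (by rw [kmem]; exact hS)
    hv₁ hv₃) fun s₈ f₈ ⟨l1, l2⟩ => Tri.nil (one_le_opBits v) ⟨?_, l1, ?_⟩) (by omega)
    fun _ _ h => h
  · exact (f₈.1 15 (by decide)).trans k15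
  · intro a ha
    rw [l2 a ha, kmem]

/-- Processes all terms of the polynomial. -/
def termLoop : Cmd := .loop 31 (.block [termCmd, .block [.add 30 30 3, .sub 31 31 3]])

/-- All terms share the rounding exponent 2n+1, so the majorants simply add. The squares of the
approximate coefficients are summed on the side; they later give a computable bound for ∑
max(1,|c_j|). -/
theorem termLoop_spec {s : State} {P mx my : ℤ} {c : ℕ → ℂ} {m : ℂ} {C : ℕ → ℝ} {H : ℝ}
    {e : ℕ → ℕ} {n k K base κ T : ℕ} (hP : 0 < P)
    (h2 : s.reg 2 = 0) (h3 : s.reg 3 = 1) (h4 : s.reg 4 = K) (h5 : s.reg 5 = base)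
    (h6 : s.reg 6 = P) (h7 : s.reg 7 = κ) (h8 : s.reg 8 = mx) (h9 : s.reg 9 = my)
    (h15 : s.reg 15 = 0) (h28 : s.reg 28 = 2) (h30 : s.reg 30 = 0) (h31 : s.reg 31 = k)
    (hmem : ∀ j < k, s.mem j = e j) (hkb : k ≤ base)
    (hz : ∀ x, base ≤ x → x < base + (2 * K + 2) → s.mem x = 0)
    (hen : ∀ j < k, e j ≤ n) (hC : ∀ j < k, 1 ≤ C j) (hH : 1 ≤ H) (hT : n < 2 ^ T)
    (hκ : κ ≤ opBits v)
    [Sz v 1 P] [Sz v 1 mx] [Sz v 1 my] [Sz v 1 (n : ℤ)] [Sz v 1 (base + 2 * K + 2 : ℤ)]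
    [Sz v 1 (κ : ℤ)] (hZ : Sz v 3 (∑ j ∈ Finset.range k, O j κ * O j κ))
    (hch : ∀ j < k, ∀ i ≤ K, Sz v 1 ((e j).choose i : ℤ))
    (hc : ∀ j < k, Near (4 / P) 1 (C j) (cpx P (O j κ) 0) (c j))
    (hm : Near (4 / P) 1 H (cpx P mx my) m)
    (hv₁ : ∀ j < k, P * ((1 + 4 / P : ℝ) ^ (2 * n + 3) * (C j * H ^ (n + 1))) ≤ 2 ^ (v + 1))
    (hv₂ : P * ((1 + 4 / P : ℝ) ^ (4 * n + 1) * H ^ (2 * n + 1)) ≤ 2 ^ (v + 1))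
    (hv₃ : ∀ i ≤ K, P * ((1 + 4 / P : ℝ) ^ (2 * n + 1) *
      (∑ j ∈ Finset.range k, (e j).choose i * (C j * H ^ n))) ≤ 2 ^ (v + 1)) :
    Tri O (opBits v) termLoop (k * (T * 30 + K * 36 + 65) + 1) s fun s' =>
      s'.reg 15 = ∑ j ∈ Finset.range k, O j κ * O j κ ∧
      (∀ i ≤ K, Near (4 / P) (2 * n + 1) (∑ j ∈ Finset.range k, (e j).choose i * (C j * H ^ n))
        (cpx P (s'.mem (base + 2 * i)) (s'.mem (base + 2 * i + 1)))
        (∑ j ∈ Finset.range k, (e j).choose i * (c j * m ^ (e j - i)))) ∧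
      ∀ a < base, s'.mem a = s.mem a := by
  have hP' : (0 : ℝ) < P := by exact_mod_cast hP
  have hη : (0 : ℝ) ≤ 4 / P := by positivity
  refine Tri.mono (Tri.loop (N := T * 30 + K * 36 + 64) (fun q u => ∃ j : ℕ, j + q = k ∧
    u.reg 30 = j ∧ u.reg 31 = q ∧ u.reg 15 = ∑ j' ∈ Finset.range j, O j' κ * O j' κ ∧
    (∀ i ≤ K, Near (4 / P) (2 * n + 1) (∑ j' ∈ Finset.range j, (e j').choose i * (C j' * H ^ n))
        (cpx P (u.mem (base + 2 * i)) (u.mem (base + 2 * i + 1)))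
        (∑ j' ∈ Finset.range j, (e j').choose i * (c j' * m ^ (e j' - i)))) ∧
    ∀ a < base, u.mem a = s.mem a) k ⟨0, by omega, h30, h31, by simpa using h15, ?_,
      fun _ _ => rfl⟩ ?_) le_rfl fun _ _ h => h
  · intro i hi
    rw [hz _ (by omega) (by omega), hz _ (by omega) (by omega)]
    have : cpx P 0 0 = 0 := by apply Complex.ext <;> simp [cpx]
    simp only [Finset.range_zero, Finset.sum_empty, this]
    exact ⟨by simp, by simp⟩
  rintro q u ⟨j, hjq, i30, i31, i15, iS, imem⟩ hfr
  have sk : ∀ x : ℕ, x ≤ base + 2 * K + 2 → Sz v 1 (x : ℤ) := fun x hx =>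
    Sz.of_le (y := (base + 2 * K + 2 : ℤ)) (by positivity) (by exact_mod_cast hx)
  have sq := sk q (by omega)
  have sj := sk j (by omega)
  refine ⟨by rw [i31]; exact Sz.bits_le (by norm_num), fun h => ?_, fun h => ?_⟩
  · obtain rfl : j = k := by omega
    exact ⟨i15, iS, imem⟩
  obtain ⟨q, rfl⟩ : ∃ q', q = q' + 1 := ⟨q - 1, by omega⟩
  have hjk : j < k := by omega
  have hsub : Finset.range j ⊆ Finset.range k := Finset.range_subset_range.2 hjk.le
  have sZ : Sz v 3 (∑ j' ∈ Finset.range j, O j' κ * O j' κ) :=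
    Sz.of_le (y := ∑ j' ∈ Finset.range k, O j' κ * O j' κ)
      (Finset.sum_nonneg fun i _ => mul_self_nonneg _)
      (Finset.sum_le_sum_of_subset_of_nonneg hsub fun i _ _ => mul_self_nonneg _)
  have i3 := (hfr.1 3 (by decide)).trans h3
  refine ⟨q, rfl, ?_⟩
  refine Tri.mono (Tri.cons (N' := 4) (termCmd_spec (c := c j) (C := C j) (m := m) (H := H)
    (T := T) (n := n) (K := K) (e := e j) hP
    ((hfr.1 2 (by decide)).trans h2) i3 ((hfr.1 4 (by decide)).trans h4)
    ((hfr.1 5 (by decide)).trans h5) ((hfr.1 6 (by decide)).trans h6)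
    ((hfr.1 7 (by decide)).trans h7) ((hfr.1 8 (by decide)).trans h8)
    ((hfr.1 9 (by decide)).trans h9) i15 ((hfr.1 28 (by decide)).trans h28) i30
    ((imem j (by omega)).trans (hmem j hjk)) (hen j hjk) (hC j hjk) hH hT hκ (hch j hjk)
    (hc j hjk) hm iS (hv₁ j hjk) hv₂ ?_) fun s₁ f₁ ⟨a15, aS, amem⟩ => ?_) (by omega)
    fun _ _ h => h
  · intro i hi
    refine le_trans (mul_le_mul_of_nonneg_left (mul_le_mul_of_nonneg_left ?_ (by positivity))
      hP'.le) (hv₃ i hi)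
    refine Finset.sum_le_sum_of_subset_of_nonneg hsub fun j' hj' _ => ?_
    have := hC j' (Finset.mem_range.1 hj')
    positivity
  have a3 := (f₁.1 3 (by decide)).trans i3
  have a30 := (f₁.1 30 (by decide)).trans i30
  have a31 := (f₁.1 31 (by decide)).trans i31
  push_cast at sq a31
  refine Tri.mono (Tri.cons (N' := 1) (R := fun w => w.reg 30 = (j + 1 : ℕ) ∧ w.reg 31 = q)
    (Tri.of_wp (one_le_opBits v) ?_) fun s₂ f₂ ⟨b30, b31⟩ => Tri.nil (one_le_opBits v) ?_)
    (by simp [Cmd.block, Cmd.length]) fun _ _ h => h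
  · simp only [Cmd.block, wp, State.setReg_reg, a3, a30, a31]
    simp [Sz.bits_le]
  · have bmem := f₂.2 (by decide)
    refine ⟨j + 1, by omega, b30, b31, ?_, ?_, ?_⟩
    · rw [Finset.sum_range_succ, ← a15]; exact f₂.1 15 (by decide)
    · intro i hi
      rw [Finset.sum_range_succ, Finset.sum_range_succ, bmem]
      exact aS i hi
    · intro a ha
      rw [bmem, amem a ha, imem a ha]

end SparseRoots

/-! ### Size bounds in powers of W, and error bounds computable by the program -/

namespace SparseRoots

/-- The data of the test at working precision `κ`, together with a bound `W` for everything that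
occurs in it. -/
structure Setup (O : ℕ → ℕ → ℤ) (v n k K base T : ℕ) (e : ℕ → ℕ) (c : ℕ → ℝ) (m : ℂ) (r W : ℝ)
    (κ : ℕ) : Prop where
  n_pos : 1 ≤ n
  κ_pos : 1 ≤ κ
  exponent_le : ∀ j < k, e j ≤ n
  r_pos : 0 < r
  le_W : 2 ^ 20 ≤ W
  normPow_le : (max 1 ‖m‖) ^ (2 * n) ≤ W
  coeff_le : ∀ j < k, max 1 |c j| ≤ W
  radiusPow_le : (max 1 r) ^ (K + 1) ≤ W
  degreePow_le : (n : ℝ) ^ (K + 1) ≤ W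
  fourPow_le : (4 : ℝ) ^ (K + 1) ≤ W
  count_le : ((2 * n + 2 * K + 2 : ℕ) : ℝ) ≤ W
  terms_le : ((3 * k + 1 : ℕ) : ℝ) ≤ W
  base_le : ((base + 2 * K + 2 : ℕ) : ℝ) ≤ W
  W_le : W ^ 200 ≤ 2 ^ v
  k_le_base : k ≤ base
  degree_lt : n < 2 ^ T
  size_le : v + 3 ≤ 2 ^ (T + 1)
  scale_ge : 2 * n + 2 * K + 2 ≤ 2 ^ (κ + 1)
  scale_le : (2 : ℝ) ^ (κ + 1) ≤ W ^ 60
  oracle_coeff : ∀ j < k, ApproximatesReal (O j) (c j)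
  oracle_re : ApproximatesReal (O k) m.re
  oracle_im : ApproximatesReal (O (k + 1)) m.im
  oracle_radius : ApproximatesReal (O (k + 2)) r

/-- The scale of fixed point numbers. -/
def scale (κ : ℕ) : ℤ := 2 ^ (κ + 1)

theorem scale_pos (κ : ℕ) : 0 < scale κ := by unfold scale; positivity

theorem scale_cast (κ : ℕ) : (scale κ : ℝ) = 2 ^ (κ + 1) := by unfold scale; push_cast; rfl

theorem ApproximatesReal.abs_sub_lt {g : ℕ → ℤ} {x : ℝ} {κ : ℕ} (h : ApproximatesReal g x)
    (hκ : 1 ≤ κ) : |(g κ : ℝ) / scale κ - x| < 2 / scale κ := by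
  have := h κ hκ
  unfold IsBitApprox at this
  rw [scale_cast]
  calc _ < 1 / (2 : ℝ) ^ κ := this
    _ = 2 / 2 ^ (κ + 1) := by field_simp; ring

theorem ApproximatesReal.near {g : ℕ → ℤ} {x B : ℝ} {κ : ℕ} (h : ApproximatesReal g x)
    (hκ : 1 ≤ κ) (hB : 1 ≤ B) (hxB : |x| ≤ B) :
    Near (4 / scale κ) 1 B (cpx (scale κ) (g κ) 0) x := by
  have hP' : (0 : ℝ) < scale κ := by exact_mod_cast scale_pos κ
  refine Near.of_le ?_ (by simpa using hxB) hB
  have e : cpx (scale κ) (g κ) 0 - x = (((g κ : ℝ) / scale κ - x : ℝ) : ℂ) := by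
    apply Complex.ext <;> simp [cpx]
  rw [e, Complex.norm_real, Real.norm_eq_abs]
  exact (h.abs_sub_lt hκ).le.trans (div_le_div_of_nonneg_right (by norm_num) hP'.le)

theorem near_complex {g g' : ℕ → ℤ} {z : ℂ} {B : ℝ} {κ : ℕ} (h : ApproximatesReal g z.re)
    (h' : ApproximatesReal g' z.im) (hκ : 1 ≤ κ) (hB : 1 ≤ B) (hz : ‖z‖ ≤ B) :
    Near (4 / scale κ) 1 B (cpx (scale κ) (g κ) (g' κ)) z := by
  refine Near.of_le ((Complex.norm_le_abs_re_add_abs_im _).trans ?_) hz hB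
  have e1 := (h.abs_sub_lt hκ).le
  have e2 := (h'.abs_sub_lt hκ).le
  calc _ ≤ 2 / (scale κ : ℝ) + 2 / scale κ := add_le_add (by simpa [cpx] using e1)
        (by simpa [cpx] using e2)
    _ = 4 / scale κ := by ring

namespace Setup

variable {O : ℕ → ℕ → ℤ} {v n k K base T : ℕ} {e : ℕ → ℕ} {c : ℕ → ℝ} {m : ℂ} {r W : ℝ} {κ : ℕ}

theorem one_le_W (h : Setup O v n k K base T e c m r W κ) : 1 ≤ W := by
  have := h.le_W
  norm_num at this
  linarith

theorem W_pos (h : Setup O v n k K base T e c m r W κ) : 0 < W := by linarith [h.one_le_W]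

theorem le_pow (h : Setup O v n k K base T e c m r W κ) {i : ℕ} (hi : i ≤ 200) :
    W ^ i ≤ 2 ^ (v + 1) :=
  (pow_le_pow_right₀ h.one_le_W hi).trans (h.W_le.trans (pow_le_pow_right₀ one_le_two (by omega)))

theorem scale_le' (h : Setup O v n k K base T e c m r W κ) : (scale κ : ℝ) ≤ W ^ 60 := by
  rw [scale_cast]; exact h.scale_le

/-- The scale is at least the number s of roundings, so (1+4/P)^(2s) ≤ e^8 < 3^8 < 2^20 ≤ W. -/
theorem eta_pow_le (h : Setup O v n k K base T e c m r W κ) {t : ℕ}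
    (ht : t ≤ 2 * (2 * n + 2 * K + 2)) : (1 + 4 / scale κ : ℝ) ^ t ≤ W := by
  have hP : (0 : ℝ) < scale κ := by exact_mod_cast scale_pos κ
  have h1 : (t : ℝ) * (4 / scale κ) ≤ 8 := by
    rw [mul_div_assoc', div_le_iff₀ hP, scale_cast]
    have : ((2 * n + 2 * K + 2 : ℕ) : ℝ) ≤ 2 ^ (κ + 1) := by exact_mod_cast h.scale_ge
    have h2 : (t : ℝ) ≤ ((2 * (2 * n + 2 * K + 2) : ℕ) : ℝ) := by exact_mod_cast ht
    push_cast at this h2 ⊢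
    linarith
  calc (1 + 4 / scale κ : ℝ) ^ t ≤ Real.exp (4 / scale κ) ^ t := by
        refine pow_le_pow_left₀ (by positivity) ?_ t
        linarith [Real.add_one_le_exp (4 / scale κ : ℝ)]
    _ = Real.exp (t * (4 / scale κ)) := by rw [Real.exp_nat_mul]
    _ ≤ Real.exp 8 := Real.exp_le_exp.2 h1
    _ = Real.exp 1 ^ 8 := by rw [← Real.exp_nat_mul]; norm_num
    _ ≤ 3 ^ 8 := pow_le_pow_left₀ (Real.exp_pos 1).le (by linarith [Real.exp_one_lt_d9]) 8
    _ ≤ W := le_trans (by norm_num) h.le_W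

theorem H_pow_le (h : Setup O v n k K base T e c m r W κ) {t : ℕ} (ht : t ≤ 2 * n) :
    (max 1 ‖m‖) ^ t ≤ W :=
  (pow_le_pow_right₀ (le_max_left _ _) ht).trans h.normPow_le

theorem H_pow_le' (h : Setup O v n k K base T e c m r W κ) {t : ℕ} (ht : t ≤ 4 * n) :
    (max 1 ‖m‖) ^ t ≤ W ^ 2 := by
  refine (pow_le_pow_right₀ (le_max_left _ _) ht).trans ?_
  have : (max 1 ‖m‖) ^ (4 * n) = ((max 1 ‖m‖) ^ (2 * n)) ^ 2 := by rw [← pow_mul]; congr 1; ring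
  rw [this]
  exact pow_le_pow_left₀ (by positivity) h.normPow_le 2

theorem R_pow_le (h : Setup O v n k K base T e c m r W κ) {t : ℕ} (ht : t ≤ K + 1) :
    (max 1 r) ^ t ≤ W :=
  (pow_le_pow_right₀ (le_max_left _ _) ht).trans h.radiusPow_le

theorem one_le_n (h : Setup O v n k K base T e c m r W κ) : (1 : ℝ) ≤ n := by
  exact_mod_cast h.n_pos

theorem choose_le (h : Setup O v n k K base T e c m r W κ) {j i : ℕ} (hj : j < k) (hi : i ≤ K) :
    ((e j).choose i : ℝ) ≤ (n : ℝ) ^ (K + 1) := by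
  have h1 : ((e j).choose i : ℝ) ≤ (e j : ℝ) ^ i := by
    exact_mod_cast Nat.choose_le_pow (e j) i
  have h2 : (e j : ℝ) ≤ n := by exact_mod_cast h.exponent_le j hj
  exact h1.trans ((pow_le_pow_left₀ (by positivity) h2 i).trans
    (pow_le_pow_right₀ h.one_le_n (by omega)))

theorem sz_nat (h : Setup O v n k K base T e c m r W κ) {x : ℕ} (hx : (x : ℝ) ≤ W) :
    Sz v 1 (x : ℤ) := by
  refine Sz.of_real ?_
  rw [Int.cast_natCast, abs_of_nonneg (by positivity)]
  exact (hx.trans_eq (pow_one W).symm).trans (h.le_pow (by norm_num))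

theorem mul_le_pow (h : Setup O v n k K base T e c m r W κ) {x y : ℝ} {i j : ℕ} (hy : 0 ≤ y)
    (hx : x ≤ W ^ i) (hy' : y ≤ W ^ j) : x * y ≤ W ^ (i + j) := by
  rw [pow_add]
  exact mul_le_mul hx hy' hy (pow_nonneg h.W_pos.le _)

theorem near_coeff (h : Setup O v n k K base T e c m r W κ) {j : ℕ} (hj : j < k) :
    Near (4 / scale κ) 1 (max 1 |c j|) (cpx (scale κ) (O j κ) 0) (c j) :=
  (h.oracle_coeff j hj).near h.κ_pos (le_max_left _ _) (le_max_right _ _)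

theorem near_center (h : Setup O v n k K base T e c m r W κ) :
    Near (4 / scale κ) 1 (max 1 ‖m‖) (cpx (scale κ) (O k κ) (O (k + 1) κ)) m :=
  near_complex h.oracle_re h.oracle_im h.κ_pos (le_max_left _ _) (le_max_right _ _)

theorem near_radius (h : Setup O v n k K base T e c m r W κ) :
    Near (4 / scale κ) 1 (max 1 r) (cpx (scale κ) (O (k + 2) κ) 0) r :=
  h.oracle_radius.near h.κ_pos (le_max_left _ _) (by rw [abs_of_pos h.r_pos]; exact le_max_right _ _)

theorem bound_acc (h : Setup O v n k K base T e c m r W κ) {j : ℕ} (hj : j < k) :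
    scale κ * ((1 + 4 / scale κ : ℝ) ^ (2 * n + 3) * (max 1 |c j| * max 1 ‖m‖ ^ (n + 1)))
      ≤ 2 ^ (v + 1) := by
  have := h.n_pos
  have h1 : max 1 |c j| * max 1 ‖m‖ ^ (n + 1) ≤ W ^ (1 + 1) :=
    h.mul_le_pow (by positivity) (by simpa using h.coeff_le j hj)
      (by simpa using h.H_pow_le (by omega))
  have h2 := h.mul_le_pow (i := 1) (by positivity)
    (by simpa using h.eta_pow_le (t := 2 * n + 3) (by omega)) h1
  exact (h.mul_le_pow (by have := scale_pos κ; positivity) h.scale_le' h2).trans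
    (h.le_pow (by norm_num))

theorem bound_pow (h : Setup O v n k K base T e c m r W κ) :
    scale κ * ((1 + 4 / scale κ : ℝ) ^ (4 * n + 1) * max 1 ‖m‖ ^ (2 * n + 1)) ≤ 2 ^ (v + 1) := by
  have := h.n_pos
  have h2 := h.mul_le_pow (i := 1) (by positivity)
    (by simpa using h.eta_pow_le (t := 4 * n + 1) (by omega)) (h.H_pow_le' (t := 2 * n + 1) (by omega))
  exact (h.mul_le_pow (by have := scale_pos κ; positivity) h.scale_le' h2).trans
    (h.le_pow (by norm_num))

theorem sum_le (h : Setup O v n k K base T e c m r W κ) {i : ℕ} (hi : i ≤ K) :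
    ∑ j ∈ Finset.range k, (e j).choose i * (max 1 |c j| * max 1 ‖m‖ ^ n) ≤ W ^ 4 := by
  have h1 : ∀ j ∈ Finset.range k,
      ((e j).choose i : ℝ) * (max 1 |c j| * max 1 ‖m‖ ^ n) ≤ W ^ 3 := fun j hj => by
    have hj := Finset.mem_range.1 hj
    refine h.mul_le_pow (i := 1) (j := 2) (by positivity)
      (by simpa using (h.choose_le hj hi).trans h.degreePow_le) ?_
    exact h.mul_le_pow (i := 1) (j := 1) (by positivity) (by simpa using h.coeff_le j hj)
      (by simpa using h.H_pow_le (by omega))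
  have h2 := Finset.sum_le_card_nsmul _ _ _ h1
  rw [Finset.card_range, nsmul_eq_mul] at h2
  refine h2.trans (h.mul_le_pow (i := 1) (j := 3) (pow_nonneg h.W_pos.le _) ?_ le_rfl)
  have := h.terms_le
  push_cast at this
  rw [pow_one]
  linarith [(Nat.cast_nonneg k : (0 : ℝ) ≤ k)]

theorem bound_sum (h : Setup O v n k K base T e c m r W κ) {i : ℕ} (hi : i ≤ K) :
    scale κ * ((1 + 4 / scale κ : ℝ) ^ (2 * n + 1) *
      (∑ j ∈ Finset.range k, (e j).choose i * (max 1 |c j| * max 1 ‖m‖ ^ n))) ≤ 2 ^ (v + 1) := by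
  have hP : (0 : ℝ) < scale κ := by exact_mod_cast scale_pos κ
  have h2 := h.mul_le_pow (i := 1) (by positivity)
    (by simpa using h.eta_pow_le (t := 2 * n + 1) (by omega)) (h.sum_le hi)
  exact (h.mul_le_pow (by positivity) h.scale_le' h2).trans (h.le_pow (by norm_num))

theorem bound_coeff (h : Setup O v n k K base T e c m r W κ) {i : ℕ} (hi : i ≤ K) :
    scale κ * ((1 + 4 / scale κ : ℝ) ^ (2 * n + 2 * K + 2) *
      (max 1 (∑ j ∈ Finset.range k, (e j).choose i * (max 1 |c j| * max 1 ‖m‖ ^ n)) * max 1 r ^ i))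
      ≤ 2 ^ (v + 1) := by
  have hP : (0 : ℝ) < scale κ := by exact_mod_cast scale_pos κ
  have h1 := h.mul_le_pow (y := max 1 r ^ i) (j := 1) (by positivity)
    (max_le (one_le_pow₀ h.one_le_W) (h.sum_le hi)) (by simpa using h.R_pow_le (t := i) (by omega))
  have h2 := h.mul_le_pow (i := 1) (by positivity)
    (by simpa using h.eta_pow_le (t := 2 * n + 2 * K + 2) (by omega)) h1
  exact (h.mul_le_pow (by positivity) h.scale_le' h2).trans (h.le_pow (by norm_num))

theorem bound_radius (h : Setup O v n k K base T e c m r W κ) :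
    scale κ * ((1 + 4 / scale κ : ℝ) ^ (2 * K + 2) * max 1 r ^ (K + 1)) ≤ 2 ^ (v + 1) := by
  have hP : (0 : ℝ) < scale κ := by exact_mod_cast scale_pos κ
  have h2 := h.mul_le_pow (y := max 1 r ^ (K + 1)) (i := 1) (j := 1) (by positivity)
    (by simpa using h.eta_pow_le (t := 2 * K + 2) (by omega))
    (by simpa using h.R_pow_le (t := K + 1) (by omega))
  exact (h.mul_le_pow (by positivity) h.scale_le' h2).trans (h.le_pow (by norm_num))

theorem sz_scale (h : Setup O v n k K base T e c m r W κ) : Sz v 1 (scale κ) := by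
  have hP : (0 : ℝ) < scale κ := by exact_mod_cast scale_pos κ
  exact Sz.of_real (by rw [abs_of_pos hP]; exact h.scale_le'.trans (h.le_pow (by norm_num)))

theorem κ_le (h : Setup O v n k K base T e c m r W κ) : κ ≤ v := by
  have h1 : (2 : ℝ) ^ (κ + 1) ≤ 2 ^ v :=
    h.scale_le.trans ((pow_le_pow_right₀ h.one_le_W (by norm_num)).trans h.W_le)
  have := (pow_le_pow_iff_right₀ one_lt_two).1 h1
  omega

theorem sz_κ (h : Setup O v n k K base T e c m r W κ) : Sz v 1 (κ : ℤ) := by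
  refine Sz.of_le (y := (2 ^ (v + 1) : ℤ)) (hy := ⟨by simp⟩) (by positivity) ?_
  have h1 : κ < 2 ^ (v + 1) := lt_of_le_of_lt (h.κ_le.trans (by omega)) Nat.lt_two_pow_self
  exact_mod_cast h1.le

theorem sz_center (h : Setup O v n k K base T e c m r W κ) :
    Sz v 1 (O k κ) ∧ Sz v 1 (O (k + 1) κ) := by
  refine h.near_center.sz (scale_pos κ) (le_trans ?_ h.bound_pow)
  have hP : (0 : ℝ) < scale κ := by exact_mod_cast scale_pos κ
  refine mul_le_mul_of_nonneg_left ?_ hP.le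
  exact mul_le_mul (pow_le_pow_right₀ (le_add_of_nonneg_right (by positivity)) (by omega))
    (le_self_pow₀ (le_max_left _ _) (by omega)) (by positivity) (by positivity)

theorem sz_radius (h : Setup O v n k K base T e c m r W κ) : Sz v 1 (O (k + 2) κ) := by
  refine (h.near_radius.sz (scale_pos κ) (le_trans ?_ h.bound_radius)).1
  have hP : (0 : ℝ) < scale κ := by exact_mod_cast scale_pos κ
  refine mul_le_mul_of_nonneg_left ?_ hP.le
  exact mul_le_mul (pow_le_pow_right₀ (le_add_of_nonneg_right (by positivity)) (by omega))
    (le_self_pow₀ (le_max_left _ _) (by omega)) (by positivity) (by positivity)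

/-- The sum of the squares of the approximations of the coefficients. -/
def sqSum (O : ℕ → ℕ → ℤ) (k κ : ℕ) : ℤ := ∑ j ∈ Finset.range k, O j κ * O j κ

theorem sqSum_le (h : Setup O v n k K base T e c m r W κ) :
    (sqSum O k κ : ℝ) ≤ scale κ * scale κ * W ^ 4 := by
  have hP : (0 : ℝ) < scale κ := by exact_mod_cast scale_pos κ
  unfold sqSum
  push_cast
  have h1 : ∀ j ∈ Finset.range k, (O j κ : ℝ) * O j κ ≤ scale κ * scale κ * W ^ 3 := by
    intro j hj
    have hj := Finset.mem_range.1 hj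
    have h2 := abs_fst_le_mul_norm_cpx (O j κ) 0 (scale_pos κ)
    have h3 := (h.near_coeff hj).err
    have h4 : ‖cpx (scale κ) (O j κ) 0‖ ≤ W + 1 := by
      have h5 := norm_sub_norm_le (cpx (scale κ) (O j κ) 0) (c j : ℂ)
      have h6 : ‖cpx (scale κ) (O j κ) 0 - c j‖ ≤ 1 := by
        have e : cpx (scale κ) (O j κ) 0 - c j = (((O j κ : ℝ) / scale κ - c j : ℝ) : ℂ) := by
          apply Complex.ext <;> simp [cpx]
        rw [e, Complex.norm_real, Real.norm_eq_abs]
        refine ((h.oracle_coeff j hj).abs_sub_lt h.κ_pos).le.trans ?_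
        rw [div_le_one hP, scale_cast]
        exact le_self_pow₀ one_le_two (by omega)
      have h7 : ‖(c j : ℂ)‖ ≤ W := by
        rw [Complex.norm_real, Real.norm_eq_abs]
        exact (le_max_right _ _).trans (h.coeff_le j hj)
      linarith
    have h8 : |(O j κ : ℝ)| ≤ scale κ * (W + 1) := h2.trans (mul_le_mul_of_nonneg_left h4 hP.le)
    rw [← abs_mul_abs_self]
    refine (mul_le_mul h8 h8 (abs_nonneg _) (by have := h.W_pos; positivity)).trans ?_
    have hW := h.le_W
    have h9 : (W + 1) * (W + 1) ≤ W ^ 3 := by nlinarith [sq_nonneg W]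
    calc (scale κ : ℝ) * (W + 1) * (scale κ * (W + 1))
        = scale κ * scale κ * ((W + 1) * (W + 1)) := by ring
      _ ≤ _ := mul_le_mul_of_nonneg_left h9 (by positivity)
  have h2 := Finset.sum_le_card_nsmul _ _ _ h1
  rw [Finset.card_range, nsmul_eq_mul] at h2
  have h3 : (k : ℝ) ≤ W := by
    have := h.terms_le
    push_cast at this
    linarith [(Nat.cast_nonneg k : (0 : ℝ) ≤ k)]
  refine h2.trans ?_
  have hW := h.W_pos
  calc (k : ℝ) * (scale κ * scale κ * W ^ 3) ≤ W * (scale κ * scale κ * W ^ 3) :=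
        mul_le_mul_of_nonneg_right h3 (by positivity)
    _ = _ := by ring

theorem sqSum_nonneg (O : ℕ → ℕ → ℤ) (k κ : ℕ) : 0 ≤ sqSum O k κ :=
  Finset.sum_nonneg fun _ _ => mul_self_nonneg _

theorem sz_sqSum (h : Setup O v n k K base T e c m r W κ) : Sz v 1 (sqSum O k κ) := by
  refine Sz.of_real ?_
  rw [abs_of_nonneg (by exact_mod_cast sqSum_nonneg O k κ)]
  refine h.sqSum_le.trans ((h.mul_le_pow (pow_nonneg h.W_pos.le _) (h.mul_le_pow ?_ h.scale_le'
    h.scale_le') le_rfl).trans (h.le_pow (by norm_num)))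
  exact_mod_cast (scale_pos κ).le

/-- The number of fixed point operations in the error analysis. -/
def roundings (n K : ℕ) : ℤ := (2 * n + 2 * K + 2 : ℕ)

/-- An upper bound for the sum of the absolute values of the coefficients. -/
def coeffBound (O : ℕ → ℕ → ℤ) (k κ : ℕ) : ℤ :=
  sqSum O k κ / (scale κ * scale κ) + (k + k + k) + 1

/-- `n` times an upper bound for the radius. -/
def radiusBound (O : ℕ → ℕ → ℤ) (n k κ : ℕ) : ℤ := (O (k + 2) κ / scale κ + 2) * n

/-- The bound for the errors, where `hh` is a bound for the powers of the center. -/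
def errorBound (O : ℕ → ℕ → ℤ) (n k K κ : ℕ) (hh : ℤ) : ℤ :=
  32 * roundings n K * (K + 1) * coeffBound O k κ * hh * radiusBound O n k κ ^ (K + 1)

theorem coeffBound_pos (O : ℕ → ℕ → ℤ) (k κ : ℕ) : 1 ≤ coeffBound O k κ := by
  have := Int.ediv_nonneg (sqSum_nonneg O k κ)
    (mul_nonneg (scale_pos κ).le (scale_pos κ).le)
  unfold coeffBound
  omega

theorem coeffBound_le (h : Setup O v n k K base T e c m r W κ) :
    (coeffBound O k κ : ℝ) ≤ W ^ 5 := by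
  have hP := scale_pos κ
  have hP' : (0 : ℝ) < scale κ := by exact_mod_cast scale_pos κ
  have h1 := (ediv_cast_bounds (sqSum O k κ) (mul_pos hP hP)).2
  have h2 : (sqSum O k κ : ℝ) / ((scale κ * scale κ : ℤ) : ℝ) ≤ W ^ 4 := by
    push_cast
    rw [div_le_iff₀ (by positivity), mul_comm]
    exact h.sqSum_le
  have h3 := h.terms_le
  have hW := h.le_W
  unfold coeffBound
  push_cast at h3 ⊢
  have h4 : W ≤ W ^ 4 := le_self_pow₀ h.one_le_W (by norm_num)
  have h5 : 2 * W ^ 4 ≤ W ^ 5 := by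
    rw [pow_succ W 4, mul_comm]
    exact mul_le_mul_of_nonneg_left (by linarith) (pow_nonneg h.W_pos.le _)
  linarith

/-- The approximation is within 1/2 and the floor loses less than 1, so adding 2 gives an upper
bound for r. Positivity of r makes the floor at least -1, so the bound is also at least 1. -/
theorem radius_bounds (h : Setup O v n k K base T e c m r W κ) :
    max 1 r ≤ ((O (k + 2) κ / scale κ + 2 : ℤ) : ℝ) ∧
      ((O (k + 2) κ / scale κ + 2 : ℤ) : ℝ) ≤ 4 * max 1 r := by
  have hP' : (0 : ℝ) < scale κ := by exact_mod_cast scale_pos κ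
  obtain ⟨h1, h2⟩ := ediv_cast_bounds (O (k + 2) κ) (scale_pos κ)
  have h3 := abs_lt.1 (h.oracle_radius.abs_sub_lt h.κ_pos)
  have h4 : 2 / (scale κ : ℝ) ≤ 1 / 2 := by
    rw [scale_cast, div_le_div_iff₀ (by positivity) (by norm_num)]
    have : (2 : ℝ) ^ 2 ≤ 2 ^ (κ + 1) := pow_le_pow_right₀ one_le_two (by have := h.κ_pos; omega)
    linarith
  have hr := h.r_pos
  have h5 : (-1 : ℝ) ≤ ((O (k + 2) κ / scale κ : ℤ) : ℝ) := by
    have : (-2 : ℝ) < ((O (k + 2) κ / scale κ : ℤ) : ℝ) := by linarith [h3.1]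
    have : (-2 : ℤ) < O (k + 2) κ / scale κ := by exact_mod_cast this
    have : (-1 : ℤ) ≤ O (k + 2) κ / scale κ := by omega
    exact_mod_cast this
  push_cast
  refine ⟨max_le (by linarith) (by linarith [h3.1]), ?_⟩
  linarith [h3.2, le_max_left 1 r, le_max_right 1 r]

theorem one_le_radiusBound (h : Setup O v n k K base T e c m r W κ) :
    1 ≤ radiusBound O n k κ := by
  have h1 : (1 : ℝ) ≤ ((O (k + 2) κ / scale κ + 2 : ℤ) : ℝ) :=
    (le_max_left _ _).trans h.radius_bounds.1
  have h2 : 1 ≤ O (k + 2) κ / scale κ + 2 := by exact_mod_cast h1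
  have h3 : (1 : ℤ) ≤ n := by exact_mod_cast h.n_pos
  unfold radiusBound
  nlinarith

theorem radiusBound_pow_le (h : Setup O v n k K base T e c m r W κ) :
    (radiusBound O n k κ : ℝ) ^ (K + 1) ≤ W ^ 3 := by
  obtain ⟨h1, h2⟩ := h.radius_bounds
  have h3 : (radiusBound O n k κ : ℝ) ≤ 4 * max 1 r * n := by
    unfold radiusBound
    push_cast at h2 ⊢
    exact mul_le_mul_of_nonneg_right h2 (by positivity)
  refine (pow_le_pow_left₀ ?_ h3 (K + 1)).trans ?_
  · have := h.one_le_radiusBound; positivity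
  · rw [mul_pow, mul_pow]
    exact h.mul_le_pow (i := 2) (j := 1) (by positivity) (h.mul_le_pow (i := 1) (j := 1)
      (by positivity) (by simpa using h.fourPow_le) (by simpa using h.radiusPow_le))
      (by simpa using h.degreePow_le)

theorem errorBound_le (h : Setup O v n k K base T e c m r W κ) {hh : ℤ} (h0 : 0 ≤ hh)
    (hhh : (hh : ℝ) ≤ W ^ 5) : (errorBound O n k K κ hh : ℝ) ≤ W ^ 20 := by
  have h1 := h.one_le_radiusBound
  have h2 := coeffBound_pos O k κ
  have hK : ((K + 1 : ℝ)) ≤ W := by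
    have := h.count_le
    push_cast at this
    linarith [(Nat.cast_nonneg n : (0 : ℝ) ≤ n), (Nat.cast_nonneg K : (0 : ℝ) ≤ K)]
  have h32 : (32 : ℝ) ≤ W := le_trans (by norm_num) h.le_W
  have hs : (roundings n K : ℝ) ≤ W := by
    unfold roundings
    exact_mod_cast h.count_le
  have hs0 : (0 : ℝ) ≤ roundings n K := by unfold roundings; positivity
  have h0' : (0 : ℝ) ≤ hh := by exact_mod_cast h0
  have h2' : (0 : ℝ) ≤ coeffBound O k κ := by exact_mod_cast (by omega : (0 : ℤ) ≤ coeffBound O k κ)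
  have h1' : (0 : ℝ) ≤ radiusBound O n k κ := by
    exact_mod_cast (by omega : (0 : ℤ) ≤ radiusBound O n k κ)
  unfold errorBound
  push_cast
  have h3 : 32 * (roundings n K : ℝ) * (K + 1) ≤ W ^ (1 + 1 + 1) :=
    h.mul_le_pow (by positivity) (h.mul_le_pow hs0 (by simpa using h32) (by simpa using hs))
      (by simpa using hK)
  have := h.mul_le_pow (pow_nonneg h1' (K + 1)) (h.mul_le_pow h0' (h.mul_le_pow h2' h3
    h.coeffBound_le) hhh) h.radiusBound_pow_le
  exact this.trans (pow_le_pow_right₀ h.one_le_W (by norm_num))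

theorem errorBound_pos (h : Setup O v n k K base T e c m r W κ) {hh : ℤ} (h0 : 1 ≤ hh) :
    1 ≤ errorBound O n k K κ hh := by
  have h1 := h.one_le_radiusBound
  have h2 := coeffBound_pos O k κ
  have hs : 1 ≤ roundings n K := by unfold roundings; omega
  unfold errorBound
  have := pow_pos (by omega : 0 < radiusBound O n k κ) (K + 1)
  have : 0 < 32 * roundings n K * (K + 1) * coeffBound O k κ * hh
      * radiusBound O n k κ ^ (K + 1) := by positivity
  omega

theorem one_le_roundings (n K : ℕ) : 1 ≤ roundings n K := by unfold roundings; omega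

theorem two_div_scale_le (h : Setup O v n k K base T e c m r W κ) :
    2 / (scale κ : ℝ) ≤ 1 / 2 := by
  rw [scale_cast, div_le_div_iff₀ (by positivity) (by norm_num)]
  have : (2 : ℝ) ^ 2 ≤ 2 ^ (κ + 1) := pow_le_pow_right₀ one_le_two (by have := h.κ_pos; omega)
  linarith

/-- If y is the modulus of the approximate coefficient, then max(1,|c_j|) ≤ max(1, y + 1/2) ≤ y² +
3. Using squares avoids sign tests; the summand 3k + 1 covers the constants and the floor. -/
theorem sum_max_coeff_le (h : Setup O v n k K base T e c m r W κ) :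
    ∑ j ∈ Finset.range k, max 1 |c j| ≤ coeffBound O k κ := by
  have hP := scale_pos κ
  have hP' : (0 : ℝ) < scale κ := by exact_mod_cast hP
  have h1 : ∀ j ∈ Finset.range k,
      max 1 |c j| ≤ (O j κ : ℝ) * O j κ / (scale κ * scale κ) + 3 := fun j hj => by
    have h2 := ((h.oracle_coeff j (Finset.mem_range.1 hj)).abs_sub_lt h.κ_pos).le.trans
      h.two_div_scale_le
    have h3 : |c j| ≤ |(O j κ : ℝ) / scale κ| + 1 / 2 := by
      have := abs_sub_abs_le_abs_sub (c j) ((O j κ : ℝ) / scale κ)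
      rw [abs_sub_comm] at this
      linarith
    have h4 : (O j κ : ℝ) * O j κ / (scale κ * scale κ)
        = |(O j κ : ℝ) / scale κ| * |(O j κ : ℝ) / scale κ| := by
      rw [abs_mul_abs_self]; field_simp
    rw [h4]
    generalize |(O j κ : ℝ) / scale κ| = y at *
    exact max_le (by nlinarith) (by nlinarith [sq_nonneg (y - 1)])
  refine (Finset.sum_le_sum h1).trans ?_
  rw [Finset.sum_add_distrib, ← Finset.sum_div]
  have h5 := (ediv_cast_bounds (sqSum O k κ) (mul_pos hP hP)).1
  have h6 : ((sqSum O k κ : ℤ) : ℝ) = ∑ j ∈ Finset.range k, (O j κ : ℝ) * O j κ := by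
    unfold sqSum; push_cast; rfl
  rw [← h6]
  unfold coeffBound
  push_cast at h5 ⊢
  simp only [Finset.sum_const, Finset.card_range, nsmul_eq_mul]
  linarith

/-- The binomial coefficients are at most n^(K+1); this factor is absorbed by the radius bound,
which includes n. -/
theorem majorant_le (h : Setup O v n k K base T e c m r W κ) {hh : ℤ}
    (hH : max 1 ‖m‖ ^ n ≤ hh) {i : ℕ} (hi : i ≤ K) :
    max 1 (∑ j ∈ Finset.range k, ((e j).choose i : ℝ) * (max 1 |c j| * max 1 ‖m‖ ^ n))
      * max 1 r ^ i ≤ coeffBound O k κ * hh * radiusBound O n k κ ^ (K + 1) := by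
  have h1 := h.sum_max_coeff_le
  have hH1 : (1 : ℝ) ≤ max 1 ‖m‖ ^ n := one_le_pow₀ (le_max_left _ _)
  have hC1 : (1 : ℝ) ≤ coeffBound O k κ := by exact_mod_cast coeffBound_pos O k κ
  have hN1 : (1 : ℝ) ≤ (n : ℝ) ^ (K + 1) := one_le_pow₀ h.one_le_n
  have hR : (max 1 r * n) ^ (K + 1) ≤ (radiusBound O n k κ : ℝ) ^ (K + 1) := by
    have hn := h.one_le_n
    refine pow_le_pow_left₀ (by positivity) ?_ _
    have := h.radius_bounds.1
    unfold radiusBound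
    push_cast at this ⊢
    exact mul_le_mul_of_nonneg_right this (by positivity)
  have h2 : ∑ j ∈ Finset.range k, ((e j).choose i : ℝ) * (max 1 |c j| * max 1 ‖m‖ ^ n)
      ≤ (n : ℝ) ^ (K + 1) * (coeffBound O k κ * hh) := by
    calc _ ≤ ∑ j ∈ Finset.range k, (n : ℝ) ^ (K + 1) * (max 1 |c j| * max 1 ‖m‖ ^ n) :=
          Finset.sum_le_sum fun j hj => mul_le_mul_of_nonneg_right
            (h.choose_le (Finset.mem_range.1 hj) hi) (by positivity)
      _ = (n : ℝ) ^ (K + 1) * ((∑ j ∈ Finset.range k, max 1 |c j|) * max 1 ‖m‖ ^ n) := by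
          rw [← Finset.mul_sum, ← Finset.sum_mul]
      _ ≤ _ := mul_le_mul_of_nonneg_left (mul_le_mul h1 hH (by positivity) (by linarith))
            (by positivity)
  have h3 : (1 : ℝ) ≤ (n : ℝ) ^ (K + 1) * (coeffBound O k κ * hh) :=
    one_le_mul_of_one_le_of_one_le hN1 (one_le_mul_of_one_le_of_one_le hC1 (hH1.trans hH))
  calc _ ≤ (n : ℝ) ^ (K + 1) * (coeffBound O k κ * hh) * max 1 r ^ (K + 1) :=
        mul_le_mul (max_le h3 h2) (pow_le_pow_right₀ (le_max_left _ _) (by omega)) (by positivity)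
          (by linarith)
    _ = coeffBound O k κ * hh * (max 1 r * n) ^ (K + 1) := by rw [mul_pow]; ring
    _ ≤ _ := mul_le_mul_of_nonneg_left hR
          (by have := hH1.trans hH; positivity)

/-- With s roundings and majorant G the error is at most 2·(4s/P)·G + 1/P ≤ 16sG/P, and D =
32s(K+1)G. The linearization of (1+4/P)^s needs 4s ≤ P, which follows from 2048D < P. The divisor
2(K+1) keeps the sum of all the errors near D/(2P). -/
theorem error_le (h : Setup O v n k K base T e c m r W κ) {hh : ℤ}
    (hH : max 1 ‖m‖ ^ n ≤ hh) (hP : 2048 * errorBound O n k K κ hh < scale κ) {i : ℕ}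
    (hi : i ≤ K) :
    ((1 + 4 / scale κ : ℝ) ^ (2 * n + 2 * K + 2) - 1) *
      (max 1 (∑ j ∈ Finset.range k, ((e j).choose i : ℝ) * (max 1 |c j| * max 1 ‖m‖ ^ n))
        * max 1 r ^ i) + 1 / scale κ
      ≤ errorBound O n k K κ hh / (2 * (K + 1) * scale κ) := by
  have hP' : (0 : ℝ) < scale κ := by exact_mod_cast scale_pos κ
  have hm := h.majorant_le hH hi
  set G : ℝ := coeffBound O k κ * hh * radiusBound O n k κ ^ (K + 1) with hG
  have hs : (1 : ℝ) ≤ roundings n K := by exact_mod_cast one_le_roundings n K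
  have hs' : ((2 * n + 2 * K + 2 : ℕ) : ℝ) = roundings n K := by unfold roundings; push_cast; rfl
  have hD : (errorBound O n k K κ hh : ℝ) = 32 * roundings n K * (K + 1) * G := by
    rw [hG]; unfold errorBound; push_cast; ring
  have hG1 : 1 ≤ G := by
    refine le_trans ?_ hm
    exact one_le_mul_of_one_le_of_one_le (le_max_left _ _) (one_le_pow₀ (le_max_left _ _))
  have hP2 : 2048 * (errorBound O n k K κ hh : ℝ) < scale κ := by exact_mod_cast hP
  have hK : (1 : ℝ) ≤ K + 1 := by linarith [(Nat.cast_nonneg K : (0 : ℝ) ≤ K)]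
  have hsG : (roundings n K : ℝ) ≤ roundings n K * (K + 1) * G := by
    rw [mul_assoc]
    exact le_mul_of_one_le_right (by linarith) (one_le_mul_of_one_le_of_one_le hK hG1)
  have h1 : ((2 * n + 2 * K + 2 : ℕ) : ℝ) * (4 / scale κ) ≤ 1 := by
    rw [hs', mul_div_assoc', div_le_one hP']
    rw [hD] at hP2
    linarith
  have h2 := one_add_pow_sub_one_le (by positivity) h1
  have h3 : errorBound O n k K κ hh / (2 * (K + 1) * scale κ)
      = 16 * roundings n K * G / (scale κ : ℝ) := by
    rw [hD]; field_simp; norm_num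
  rw [h3]
  calc _ ≤ 2 * (((2 * n + 2 * K + 2 : ℕ) : ℝ) * (4 / scale κ)) * G + 1 / scale κ := by
        gcongr
    _ = (8 * (roundings n K * G) + 1) / (scale κ : ℝ) := by rw [hs']; ring
    _ ≤ 16 * roundings n K * G / (scale κ : ℝ) := by
        gcongr
        nlinarith

/-- An upper bound for the powers of the center, computed from an approximation of its `n`-th
power. -/
def centerBound (κ : ℕ) (X Y : ℤ) : ℤ := (X * X + Y * Y) / (scale κ * scale κ) + 3

theorem centerBound_ge (κ : ℕ) (X Y : ℤ) : 3 ≤ centerBound κ X Y := by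
  have := Int.ediv_nonneg (add_nonneg (mul_self_nonneg X) (mul_self_nonneg Y))
    (mul_nonneg (scale_pos κ).le (scale_pos κ).le)
  unfold centerBound
  omega

theorem cast_sq_div (κ : ℕ) (X Y : ℤ) :
    ((X * X + Y * Y : ℤ) : ℝ) / ((scale κ * scale κ : ℤ) : ℝ)
      = ‖cpx (scale κ) X Y‖ * ‖cpx (scale κ) X Y‖ := by
  have hP' : (0 : ℝ) < scale κ := by exact_mod_cast scale_pos κ
  rw [norm_cpx _ _ _ (scale_pos κ), div_mul_div_comm, Real.mul_self_sqrt]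
  · push_cast; rfl
  · exact_mod_cast add_nonneg (mul_self_nonneg X) (mul_self_nonneg Y)

theorem centerBound_le (h : Setup O v n k K base T e c m r W κ) {X Y : ℤ} {z : ℂ}
    (hz : Near (4 / scale κ) (2 * n) (max 1 ‖m‖ ^ n) (cpx (scale κ) X Y) z) :
    (centerBound κ X Y : ℝ) ≤ W ^ 5 := by
  have hP := scale_pos κ
  have h1 := (ediv_cast_bounds (X * X + Y * Y) (mul_pos hP hP)).2
  rw [cast_sq_div] at h1
  have hP' : (0 : ℝ) < scale κ := by exact_mod_cast hP
  have h2 : ‖cpx (scale κ) X Y‖ ≤ W ^ 2 := hz.norm_le.trans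
    (h.mul_le_pow (i := 1) (j := 1) (by positivity)
      (by simpa using h.eta_pow_le (t := 2 * n) (by omega))
      (by simpa using h.H_pow_le (t := n) (by omega)))
  have h3 := h.mul_le_pow (norm_nonneg _) h2 h2
  have hW := h.le_W
  have h4 : 1 ≤ W ^ 4 := one_le_pow₀ h.one_le_W
  have h5 : 4 * W ^ 4 ≤ W ^ 5 := by
    rw [pow_succ W 4, mul_comm]
    exact mul_le_mul_of_nonneg_left (by linarith) (by linarith)
  unfold centerBound
  push_cast at h1 h3 ⊢
  linarith

/-- At this scale the computed n-th power w of m has error at most half of max(1,|m|)^n. For |m| ≥ 1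
this gives |m|^n ≤ 2|w| ≤ |w|² + 1; for |m| ≤ 1 the bound 1 is trivial. The constant 3 also pays for
the floor. -/
theorem le_centerBound {X Y : ℤ}
    (hz : Near (4 / scale κ) (2 * n) (max 1 ‖m‖ ^ n) (cpx (scale κ) X Y) (m ^ n))
    (hs : 32 * roundings n K ≤ scale κ) : max 1 ‖m‖ ^ n ≤ centerBound κ X Y := by
  have hP := scale_pos κ
  have hP' : (0 : ℝ) < scale κ := by exact_mod_cast hP
  have hs' : (32 : ℝ) * (2 * n + 2 * K + 2) ≤ scale κ := by
    unfold roundings at hs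
    exact_mod_cast hs
  have h1 := (ediv_cast_bounds (X * X + Y * Y) (mul_pos hP hP)).1
  rw [cast_sq_div] at h1
  have h2 : ((2 * n : ℕ) : ℝ) * (4 / scale κ) ≤ 1 / 4 := by
    rw [mul_div_assoc', div_le_iff₀ hP']
    push_cast
    linarith [(Nat.cast_nonneg n : (0 : ℝ) ≤ n), (Nat.cast_nonneg K : (0 : ℝ) ≤ K)]
  have h3 := one_add_pow_sub_one_le (by positivity) (h2.trans (by norm_num))
  have h4 : ‖cpx (scale κ) X Y - m ^ n‖ ≤ 1 / 2 * max 1 ‖m‖ ^ n :=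
    hz.err.trans (mul_le_mul_of_nonneg_right (by linarith) (by positivity))
  have h5 : ‖m‖ ^ n ≤ ‖cpx (scale κ) X Y‖ + 1 / 2 * max 1 ‖m‖ ^ n := by
    have := norm_sub_norm_le (m ^ n) (cpx (scale κ) X Y)
    rw [norm_sub_rev, norm_pow] at this
    linarith
  unfold centerBound
  push_cast
  rcases le_total ‖m‖ 1 with hm | hm
  · rw [max_eq_left hm, one_pow]
    nlinarith [norm_nonneg (cpx (scale κ) X Y)]
  · rw [max_eq_right hm] at h5 ⊢
    nlinarith [sq_nonneg (‖cpx (scale κ) X Y‖ - 1)]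

end Setup

end SparseRoots

/-! ### One round at a fixed working precision -/

namespace SparseRoots

/-- The test at one working precision; register 11 becomes zero if the precision suffices. -/
def roundCmd : Cmd :=
  .block [.block [.query 8 1 7, .add 39 1 3, .query 9 39 7, .add 39 39 3, .query 10 39 7,
      .add 37 5 2, .add 38 4 3, .add 38 38 38],
    zeroLoop,
    .block [.add 20 6 2, .add 21 2 2, .add 22 8 2, .add 23 9 2, .add 24 0 2],
    powLoop,
    .block [.mul 39 6 6, .mul 16 20 20, .mul 17 21 21, .add 16 16 17, .div 16 16 39, .const 39 3,
      .add 16 16 39, .const 15 0, .const 30 0, .add 31 1 2],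
    termLoop,
    .block [.mul 39 6 6, .div 12 15 39, .add 39 1 1, .add 39 39 1, .add 12 12 39, .add 12 12 3,
      .const 39 32, .mul 39 39 52, .add 38 4 3, .mul 39 39 38, .mul 12 39 12, .mul 12 12 16,
      .div 46 10 6, .add 46 46 28, .mul 46 46 0, .const 13 0, .const 14 0, .const 35 0,
      .add 41 6 2],
    normLoop,
    .block [.sub 53 13 12, .const 54 2048, .mul 54 54 12, .sub 55 6 54, .mul 56 53 53,
      .mul 57 54 6, .sub 56 56 57, .const 11 1],
    .ite 53 (.ite 55 (.ite 56 (.const 11 0) .skip) .skip) .skip]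

/-- The number of steps of a round. -/
def roundCost (k K T : ℕ) : ℕ :=
  (2 * K + 2) * 6 + T * 30 + k * (T * 30 + K * 36 + 65) + (K + 1) * (T * 8 + 50) + 100

/-- The registers that stay fixed during the main part of the program. -/
structure Ready (n k K base : ℕ) (e : ℕ → ℕ) (s : State) : Prop where
  r0 : s.reg 0 = n
  r1 : s.reg 1 = k
  r2 : s.reg 2 = 0
  r3 : s.reg 3 = 1
  r4 : s.reg 4 = K
  r5 : s.reg 5 = base
  r28 : s.reg 28 = 2
  r52 : s.reg 52 = (2 * n + 2 * K + 2 : ℕ)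
  mem : ∀ j < k, s.mem j = e j

/-- The coefficients of the shifted polynomial. -/
noncomputable def shiftCoeff (k : ℕ) (e : ℕ → ℕ) (c : ℕ → ℝ) (m : ℂ) (r : ℝ) (i : ℕ) : ℂ :=
  (∑ j ∈ Finset.range k, (e j).choose i * ((c j : ℂ) * m ^ (e j - i))) * (r : ℂ) ^ i

/-- The result of a round at precision `κ`: the approximations of the absolute values of the
coefficients are in the memory, their sum in register 14, their maximum in register 13, and `D` bounds
their errors if `2048 D` is less than the scale. -/
structure RoundResult (k K base : ℕ) (e : ℕ → ℕ) (v κ : ℕ) (A : ℕ → ℂ) (W : ℝ) (D : ℤ) (s : State) :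
    Prop where
  one_le : 1 ≤ D
  le : (D : ℝ) ≤ W ^ 20
  nonneg : ∀ i ≤ K, 0 ≤ s.mem (base + 2 * i)
  size : ∀ i ≤ K, s.mem (base + 2 * i) ≤ 2 ^ (3 * (v + 1))
  err : 2048 * D < scale κ → ∀ i ≤ K,
    |(s.mem (base + 2 * i) : ℝ) / scale κ - ‖A i‖| ≤ D / (2 * (K + 1) * scale κ)
  sum : s.reg 14 = ∑ i ∈ Finset.range (K + 1), s.mem (base + 2 * i)
  le_max : ∀ i ≤ K, s.mem (base + 2 * i) ≤ s.reg 13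
  max_mem : ∃ i ≤ K, s.reg 13 = s.mem (base + 2 * i)
  diff : s.reg 53 = s.reg 13 - D
  flag : s.reg 11 = if 0 < s.reg 53 ∧ 2048 * D < scale κ ∧
    2048 * D * scale κ < s.reg 53 * s.reg 53 then 0 else 1
  mem : ∀ j < k, s.mem j = e j

variable {O : ℕ → ℕ → ℤ} {v n k K base T : ℕ} {e : ℕ → ℕ} {c : ℕ → ℝ} {m : ℂ} {r W : ℝ} {κ : ℕ}

/-- Lets the loop over the moduli be analysed with some common error δ at every scale, although the
explicit bound δ₀ is available only once the scale is large. -/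
theorem exists_error (f : ℕ → ℝ) (K : ℕ) (δ₀ : ℝ) :
    ∃ δ, (∀ i ≤ K, f i ≤ δ) ∧ ((∀ i ≤ K, f i ≤ δ₀) → δ ≤ δ₀) := by
  obtain ⟨i, hi, h⟩ := Finset.exists_max_image (Finset.range (K + 1)) f ⟨0, by simp⟩
  exact ⟨f i, fun j hj => h j (Finset.mem_range.2 (by omega)),
    fun h' => h' i (by have := Finset.mem_range.1 hi; omega)⟩

-- Operand sizes come from `Setup` at every admissible scale, so a round with insufficient precision
-- still runs within the cost bound and is merely rejected by the flag. Only the error estimate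
-- depends on 2048D < P.
set_option maxHeartbeats 2000000 in
theorem roundCmd_spec {s : State} (h : Setup O v n k K base T e c m r W κ)
    (hs : Ready n k K base e s) (h6 : s.reg 6 = scale κ) (h7 : s.reg 7 = κ) :
    Tri O (opBits v) roundCmd (roundCost k K T) s fun s' =>
      ∃ D, RoundResult k K base e v κ (shiftCoeff k e c m r) W D s' := by
  have hP := scale_pos κ
  have hP' : (0 : ℝ) < scale κ := by exact_mod_cast hP
  have hη : (0 : ℝ) ≤ 4 / scale κ := by positivity
  obtain ⟨h0, h1, h2, h3, h4, h5, h28, h52, hmem⟩ := hs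
  have sP := h.sz_scale
  have sκ := h.sz_κ
  obtain ⟨smx, smy⟩ := h.sz_center
  have smr := h.sz_radius
  have sn : Sz v 1 (n : ℤ) := h.sz_nat (by
    have := h.count_le
    push_cast at this
    linarith [(Nat.cast_nonneg n : (0 : ℝ) ≤ n), (Nat.cast_nonneg K : (0 : ℝ) ≤ K)])
  have sbK : Sz v 1 (base + 2 * K + 2 : ℤ) := by
    have := h.sz_nat h.base_le
    push_cast at this
    exact this
  have sbK' : Sz v 1 ((base + (2 * K + 2) : ℕ) : ℤ) := h.sz_nat (by simpa [add_assoc] using h.base_le)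
  have sle : ∀ x : ℕ, x ≤ base + (2 * K + 2) → Sz v 1 (x : ℤ) := fun x hx =>
    Sz.of_le (y := ((base + (2 * K + 2) : ℕ) : ℤ)) (by positivity) (by exact_mod_cast hx)
  have skb := h.k_le_base
  have sk := sle k (by omega)
  have sK := sle K (by omega)
  have sb := sle base (by omega)
  have hκ : κ ≤ opBits v := h.κ_le.trans (by unfold opBits; omega)
  unfold roundCmd roundCost
  refine Tri.mono (Tri.cons (N := 9) (N' := (2 * K + 2) * 6 + T * 30 + k * (T * 30 + K * 36 + 65)
      + (K + 1) * (T * 8 + 50) + 91)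
    (R := fun w => w.reg 8 = O k κ ∧ w.reg 9 = O (k + 1) κ ∧ w.reg 10 = O (k + 2) κ ∧
      w.reg 37 = base ∧ w.reg 38 = (2 * K + 2 : ℕ))
    (Tri.of_wp (one_le_opBits v) ?_) fun s₁ f₁ ⟨a8, a9, a10, a37, a38⟩ => ?_) (by omega)
    fun _ _ h => h
  · have e1 : ((k : ℤ) + 1).toNat = k + 1 := by omega
    have e2 : ((k : ℤ) + 1 + 1).toNat = k + 2 := by omega
    simp only [Cmd.block, wp, State.setReg_reg, h1, h2, h3, h4, h5, h7]
    simp [Sz.bits_le, e1, e2, hκ]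
    omega
  refine Tri.mono (Tri.cons (N' := T * 30 + k * (T * 30 + K * 36 + 65)
      + (K + 1) * (T * 8 + 50) + 90) (zeroLoop_spec (base := base) (N := 2 * K + 2)
    ((f₁.1 2 (by decide)).trans h2) ((f₁.1 3 (by decide)).trans h3) a37 a38)
    fun s₂ f₂ ⟨hz, hlow⟩ => ?_) (by omega) fun _ _ h => h
  have b0 := (f₂.1 0 (by decide)).trans ((f₁.1 0 (by decide)).trans h0)
  have b2 := (f₂.1 2 (by decide)).trans ((f₁.1 2 (by decide)).trans h2)
  have b6 := (f₂.1 6 (by decide)).trans ((f₁.1 6 (by decide)).trans h6)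
  have b28 := (f₂.1 28 (by decide)).trans ((f₁.1 28 (by decide)).trans h28)
  have b8 := (f₂.1 8 (by decide)).trans a8
  have b9 := (f₂.1 9 (by decide)).trans a9
  refine Tri.mono (Tri.cons (N := 6) (N' := T * 30 + k * (T * 30 + K * 36 + 65)
      + (K + 1) * (T * 8 + 50) + 84)
    (R := fun w => w.reg 20 = scale κ ∧ w.reg 21 = 0 ∧ w.reg 22 = O k κ ∧ w.reg 23 = O (k + 1) κ ∧
      w.reg 24 = n)
    (Tri.of_wp (one_le_opBits v) ?_) fun s₃ f₃ ⟨d20, d21, d22, d23, d24⟩ => ?_) (by omega)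
    fun _ _ h => h
  · simp only [Cmd.block, wp, State.setReg_reg, b0, b2, b6, b8, b9]
    simp [Sz.bits_le]
  have d2 := (f₃.1 2 (by decide)).trans b2
  have d6 := (f₃.1 6 (by decide)).trans b6
  have d28 := (f₃.1 28 (by decide)).trans b28
  refine Tri.mono (Tri.cons (N' := k * (T * 30 + K * 36 + 65) + (K + 1) * (T * 8 + 50) + 83)
    (powLoop_spec (T := T) (E := n) (s₀ := 0) (B₀ := 1) (H := max 1 ‖m‖) (z₀ := 1) (z := m) hP d2
      d28 d6 d24 le_rfl (le_max_left _ _) h.degree_lt ?_ (by rw [d22, d23]; exact h.near_center) ?_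
      h.bound_pow)
    fun s₄ f₄ hacc => ?_) (by omega) fun _ _ h => h
  · rw [d20, d21]
    have : cpx (scale κ) (scale κ) 0 = 1 := by
      apply Complex.ext <;> simp [cpx, hP'.ne']
    rw [this]
    exact Near.of_eq (by simp)
  · refine le_trans (mul_le_mul_of_nonneg_left ?_ hP'.le) h.bound_pow
    rw [zero_add, one_mul]
    exact mul_le_mul (pow_le_pow_right₀ (by linarith) (by omega))
      (pow_le_pow_right₀ (le_max_left _ _) (by omega)) (by positivity) (by positivity)
  rw [zero_add, one_mul, one_mul] at hacc
  have hcb := h.centerBound_le hacc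
  set hh := Setup.centerBound κ (s₄.reg 20) (s₄.reg 21) with hhh
  have hh3 : 3 ≤ hh := Setup.centerBound_ge _ _ _
  have shh : Sz v 1 hh := Sz.of_real (by
    rw [abs_of_nonneg (by exact_mod_cast (by omega : 0 ≤ hh))]
    exact hcb.trans (h.le_pow (by norm_num)))
  obtain ⟨s20, s21⟩ := hacc.sz hP (le_trans (mul_le_mul_of_nonneg_left (mul_le_mul
    (pow_le_pow_right₀ (by linarith) (by omega : 2 * n ≤ 4 * n + 1))
    (pow_le_pow_right₀ (le_max_left _ _) (by omega : n ≤ 2 * n + 1)) (by positivity)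
    (by positivity)) hP'.le) h.bound_pow)
  have g1 := (f₄.1 1 (by decide)).trans ((f₃.1 1 (by decide)).trans ((f₂.1 1 (by decide)).trans
    ((f₁.1 1 (by decide)).trans h1)))
  have g2 := (f₄.1 2 (by decide)).trans d2
  have g6 := (f₄.1 6 (by decide)).trans d6
  refine Tri.mono (Tri.cons (N := 11) (N' := k * (T * 30 + K * 36 + 65)
      + (K + 1) * (T * 8 + 50) + 72)
    (R := fun w => w.reg 16 = hh ∧ w.reg 15 = 0 ∧ w.reg 30 = 0 ∧ w.reg 31 = k)
    (Tri.of_wp (one_le_opBits v) ?_) fun s₅ f₅ ⟨i16, i15, i30, i31⟩ => ?_) (by omega)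
    fun _ _ h => h
  · simp only [Cmd.block, wp, State.setReg_reg, g1, g2, g6]
    simp [Sz.bits_le, hhh, Setup.centerBound]
  have i2 := (f₅.1 2 (by decide)).trans g2
  have i3 := (f₅.1 3 (by decide)).trans ((f₄.1 3 (by decide)).trans ((f₃.1 3 (by decide)).trans
    ((f₂.1 3 (by decide)).trans ((f₁.1 3 (by decide)).trans h3))))
  have i4 := (f₅.1 4 (by decide)).trans ((f₄.1 4 (by decide)).trans ((f₃.1 4 (by decide)).trans
    ((f₂.1 4 (by decide)).trans ((f₁.1 4 (by decide)).trans h4))))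
  have i5 := (f₅.1 5 (by decide)).trans ((f₄.1 5 (by decide)).trans ((f₃.1 5 (by decide)).trans
    ((f₂.1 5 (by decide)).trans ((f₁.1 5 (by decide)).trans h5))))
  have i6 := (f₅.1 6 (by decide)).trans g6
  have i7 := (f₅.1 7 (by decide)).trans ((f₄.1 7 (by decide)).trans ((f₃.1 7 (by decide)).trans
    ((f₂.1 7 (by decide)).trans ((f₁.1 7 (by decide)).trans h7))))
  have i8 := (f₅.1 8 (by decide)).trans ((f₄.1 8 (by decide)).trans ((f₃.1 8 (by decide)).trans b8))
  have i9 := (f₅.1 9 (by decide)).trans ((f₄.1 9 (by decide)).trans ((f₃.1 9 (by decide)).trans b9))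
  have i28 := (f₅.1 28 (by decide)).trans ((f₄.1 28 (by decide)).trans d28)
  have i0 := (f₅.1 0 (by decide)).trans ((f₄.1 0 (by decide)).trans ((f₃.1 0 (by decide)).trans b0))
  have i1 := (f₅.1 1 (by decide)).trans g1
  have i10 := (f₅.1 10 (by decide)).trans ((f₄.1 10 (by decide)).trans ((f₃.1 10 (by decide)).trans
    ((f₂.1 10 (by decide)).trans a10)))
  have i52 := (f₅.1 52 (by decide)).trans ((f₄.1 52 (by decide)).trans ((f₃.1 52 (by decide)).trans
    ((f₂.1 52 (by decide)).trans ((f₁.1 52 (by decide)).trans h52))))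
  have imem : s₅.mem = s₂.mem := (f₅.2 (by decide)).trans ((f₄.2 (by decide)).trans
    (f₃.2 (by decide)))
  have hmem₁ : s₁.mem = s.mem := f₁.2 (by decide)
  have sZ := h.sz_sqSum
  refine Tri.mono (Tri.cons (N' := (K + 1) * (T * 8 + 50) + 71)
    (termLoop_spec (T := T) (n := n) (K := K) (k := k) (e := e) (c := fun j => (c j : ℂ)) (m := m)
      (C := fun j => max 1 |c j|) (H := max 1 ‖m‖) hP i2 i3 i4 i5 i6 i7 i8 i9 i15 i28 i30 i31
      ?_ skb ?_ h.exponent_le (fun _ _ => le_max_left _ _) (le_max_left _ _) h.degree_lt hκ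
      (sZ.mono (by norm_num)) ?_ (fun j hj => h.near_coeff hj) h.near_center
      (fun j hj => h.bound_acc hj) h.bound_pow fun i hi => h.bound_sum hi)
    fun s₆ f₆ ⟨j15, jS, jmem⟩ => ?_) (by omega) fun _ _ h => h
  · intro j hj
    rw [imem, hlow j (by omega), hmem₁, hmem j hj]
  · intro x hx1 hx2
    rw [imem, hz x hx1 hx2]
  · intro j hj i hi
    exact h.sz_nat ((h.choose_le hj hi).trans h.degreePow_le)
  have j0 := (f₆.1 0 (by decide)).trans i0
  have j1 := (f₆.1 1 (by decide)).trans i1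
  have j2 := (f₆.1 2 (by decide)).trans i2
  have j3 := (f₆.1 3 (by decide)).trans i3
  have j4 := (f₆.1 4 (by decide)).trans i4
  have j6 := (f₆.1 6 (by decide)).trans i6
  have j10 := (f₆.1 10 (by decide)).trans i10
  have j16 := (f₆.1 16 (by decide)).trans i16
  have j28 := (f₆.1 28 (by decide)).trans i28
  have j52 : s₆.reg 52 = Setup.roundings n K := (f₆.1 52 (by decide)).trans i52
  have sround : Sz v 1 (Setup.roundings n K) := h.sz_nat h.count_le
  have j15' : s₆.reg 15 = Setup.sqSum O k κ := j15
  have sCC : Sz v 1 (Setup.coeffBound O k κ) := Sz.of_real (by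
    rw [abs_of_nonneg (by exact_mod_cast (zero_le_one.trans (Setup.coeffBound_pos O k κ)))]
    exact h.coeffBound_le.trans (h.le_pow (by norm_num)))
  set D₀ : ℤ := 32 * Setup.roundings n K * (K + 1) * Setup.coeffBound O k κ * hh with hD₀
  refine Tri.mono (Tri.cons (N := 20) (N' := (K + 1) * (T * 8 + 50) + 51)
    (R := fun w => w.reg 12 = D₀ ∧ w.reg 46 = Setup.radiusBound O n k κ ∧ w.reg 13 = 0 ∧
      w.reg 14 = 0 ∧ w.reg 35 = 0 ∧ w.reg 38 = (K + 1 : ℕ) ∧ w.reg 41 = scale κ)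
    (Tri.of_wp (one_le_opBits v) ?_)
    fun s₇ f₇ ⟨k12, k46, k13, k14, k35, k38, k41⟩ => ?_) (by omega) fun _ _ h => h
  · simp only [Cmd.block, wp, State.setReg_reg, j0, j1, j2, j3, j4, j6, j10, j15', j16, j28, j52]
    simp [Sz.bits_le, hD₀, Setup.radiusBound, Setup.coeffBound]
  have kmem : s₇.mem = s₆.mem := f₇.2 (by decide)
  have hq := h.one_le_radiusBound
  have hDeq : D₀ * Setup.radiusBound O n k κ ^ (K + 1) = Setup.errorBound O n k K κ hh := rfl
  have hD1 := h.errorBound_pos (hh := hh) (by omega)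
  have hDle := h.errorBound_le (hh := hh) (by omega) hcb
  have hs1 := Setup.one_le_roundings n K
  have hc1 := Setup.coeffBound_pos O k κ
  have hD₀' : 0 ≤ D₀ := by rw [hD₀]; positivity
  have sD : Sz v 1 (Setup.errorBound O n k K κ hh) := Sz.of_real (by
    rw [abs_of_nonneg (by exact_mod_cast (zero_le_one.trans hD1))]
    exact hDle.trans (h.le_pow (by norm_num)))
  have sD' : Sz v 1 (D₀ * Setup.radiusBound O n k κ ^ (K + 1)) := sD
  have sq : Sz v 1 (Setup.radiusBound O n k κ) := by
    refine Sz.of_real ?_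
    have : (1 : ℝ) ≤ Setup.radiusBound O n k κ := by exact_mod_cast hq
    rw [abs_of_nonneg (by linarith)]
    exact (le_self_pow₀ this (by omega)).trans (h.radiusBound_pow_le.trans (h.le_pow (by norm_num)))
  obtain ⟨δ, hδ, hδ'⟩ := exists_error (fun i => ((1 + 4 / scale κ : ℝ) ^ (2 * n + 2 * K + 2) - 1) *
      (max 1 (∑ j ∈ Finset.range k, ((e j).choose i : ℝ) * (max 1 |c j| * max 1 ‖m‖ ^ n))
        * max 1 r ^ i) + 1 / scale κ) K
      (Setup.errorBound O n k K κ hh / (2 * (K + 1) * scale κ))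
  refine Tri.mono (Tri.cons (N' := 50)
    (normLoop_spec (T := T) (n := n) (K := K) (base := base) (D₀ := D₀) (R := max 1 r) (δ := δ)
      (S := fun i => ∑ j ∈ Finset.range k, (e j).choose i * ((c j : ℂ) * m ^ (e j - i)))
      (B := fun i => max 1 (∑ j ∈ Finset.range k, ((e j).choose i : ℝ)
        * (max 1 |c j| * max 1 ‖m‖ ^ n))) hP
      ((f₇.1 2 (by decide)).trans j2) ((f₇.1 3 (by decide)).trans j3)
      ((f₇.1 5 (by decide)).trans ((f₆.1 5 (by decide)).trans i5)) ((f₇.1 6 (by decide)).trans j6)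
      ((f₇.1 10 (by decide)).trans j10) k12 k13 k14 k35 k38 k41 k46 (le_max_left _ _) hD₀' hq
      h.size_le h.near_radius (fun _ _ => le_max_left _ _) ?_ h.bound_radius
      (fun i hi => h.bound_coeff hi) hδ)
    fun s₈ f₈ ⟨lV, l14, l13, l13', l12, lmem⟩ => ?_) (by omega) fun _ _ h => h
  · intro i hi
    rw [kmem]
    exact (jS i hi).mono hη le_rfl (le_max_right _ _)
  rw [hDeq] at l12
  set D := Setup.errorBound O n k K κ hh with hDdef
  have l6 := (f₈.1 6 (by decide)).trans ((f₇.1 6 (by decide)).trans j6)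
  have l13s : Sz v 3 (s₈.reg 13) := by
    obtain ⟨i, hi, h'⟩ := l13'
    constructor
    rw [h', abs_of_nonneg (lV i hi).1]
    exact (lV i hi).2.1
  refine Tri.mono (Tri.cons (N := 9) (N' := 8) (R := fun w => w.reg 53 = s₈.reg 13 - D ∧
      w.reg 55 = scale κ - 2048 * D ∧ w.reg 11 = 1 ∧
      w.reg 56 = (s₈.reg 13 - D) * (s₈.reg 13 - D) - 2048 * D * scale κ)
    (Tri.of_wp (one_le_opBits v) ?_) fun s₉ f₉ ⟨m53, m55, m11, m56⟩ => ?_) (by omega)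
    fun _ _ h => h
  · simp only [Cmd.block, wp, State.setReg_reg, l6, l12]
    simp [Sz.bits_le]
  refine Tri.mono (Tri.cons (N := 7) (N' := 1) (R := fun w => w.reg 11 =
      if 0 < s₈.reg 13 - D ∧ 2048 * D < scale κ ∧
        2048 * D * scale κ < (s₈.reg 13 - D) * (s₈.reg 13 - D) then 0 else 1)
    (Tri.of_wp (one_le_opBits v) ?_) fun s₁₀ f₁₀ n11 => Tri.nil (one_le_opBits v) ?_) (by omega)
    fun _ _ h => h
  · simp only [wp, State.setReg_reg, m53, m55, m56, m11]
    simp [Sz.bits_le]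
    generalize s₈.reg 13 - D = y
    generalize 2048 * D * scale κ = z
    refine ⟨fun h1 => ⟨fun h2 => ⟨fun h3 => ?_, fun h3 h4 h5 => h3⟩, fun h2 h3 h4 => ?_⟩,
      fun h1 h2 h3 => ?_⟩
    · exact ⟨h1, h2, h3⟩
    · omega
    · omega
  have nmem : s₁₀.mem = s₈.mem := (f₁₀.2 (by decide)).trans (f₉.2 (by decide))
  have n53 := (f₁₀.1 53 (by decide)).trans m53
  have n13 := (f₁₀.1 13 (by decide)).trans (f₉.1 13 (by decide))
  have n14 := (f₁₀.1 14 (by decide)).trans ((f₉.1 14 (by decide)).trans l14)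
  refine ⟨D, hD1, hDle, fun i hi => ?_, fun i hi => ?_, fun hbig i hi => ?_, ?_, fun i hi => ?_,
    ?_, ?_, ?_, fun j hj => ?_⟩
  · rw [nmem]; exact (lV i hi).1
  · rw [nmem]; exact (lV i hi).2.1
  · rw [nmem]
    refine (lV i hi).2.2.trans (hδ' fun i hi => h.error_le (Setup.le_centerBound (K := K) hacc ?_) hbig hi)
    -- All other factors of D are at least 1, so 2048D < P makes the scale large enough for the
    -- bound on the powers of the center.
    have h32 : 32 * Setup.roundings n K ≤ D := by
      rw [hDdef]
      unfold Setup.errorBound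
      have hqp : 1 ≤ Setup.radiusBound O n k κ ^ (K + 1) := one_le_pow₀ hq
      have e1 : 1 ≤ Setup.coeffBound O k κ * hh * Setup.radiusBound O n k κ ^ (K + 1) :=
        one_le_mul_of_one_le_of_one_le (one_le_mul_of_one_le_of_one_le hc1 (by omega)) hqp
      have e2 : (1 : ℤ) ≤ (K + 1) * (Setup.coeffBound O k κ * hh
          * Setup.radiusBound O n k κ ^ (K + 1)) :=
        one_le_mul_of_one_le_of_one_le (by omega) e1
      calc _ = 32 * Setup.roundings n K * 1 := by ring
        _ ≤ 32 * Setup.roundings n K * ((K + 1) * (Setup.coeffBound O k κ * hh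
          * Setup.radiusBound O n k κ ^ (K + 1))) :=
            mul_le_mul_of_nonneg_left e2 (by omega)
        _ = _ := by ring
    omega
  · rw [nmem, n14]
  · rw [nmem, n13]; exact l13 i hi
  · rw [nmem, n13]; exact l13'
  · rw [n53, n13]
  · rw [n53, n11]
  · rw [nmem, lmem j (by omega), kmem, jmem j (by omega), imem, hlow j (by omega), hmem₁, hmem j hj]

end SparseRoots

/-! ### From good approximations to certified output -/

namespace SparseRoots

variable {K : ℕ} {a : ℕ → ℝ} {M : ℝ} {P D mx : ℤ} {V : ℕ → ℤ}

/-- The integers `V i` approximate the numbers `P * a i`, with an error bound `D` that is small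
compared to the scale `P` and to the maximum `mx` of the `V i`. -/
structure GoodApprox (K : ℕ) (a : ℕ → ℝ) (P D mx : ℤ) (V : ℕ → ℤ) : Prop where
  one_le : 1 ≤ D
  err : ∀ i ≤ K, |(V i : ℝ) / P - a i| ≤ D / (2 * (K + 1) * P)
  le_max : ∀ i ≤ K, V i ≤ mx
  max_mem : ∃ i ≤ K, mx = V i
  pos : 0 < mx - D
  lt_scale : 2048 * D < P
  lt_sq : 2048 * D * P < (mx - D) * (mx - D)

theorem abs_sub_mul_le {x y P ε : ℝ} (hP : 0 < P) (h : |x / P - y| ≤ ε / P) : |x - P * y| ≤ ε := by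
  have e : x - P * y = P * (x / P - y) := by field_simp
  rw [e, abs_mul, abs_of_pos hP]
  calc _ ≤ P * (ε / P) := mul_le_mul_of_nonneg_left h hP.le
    _ = ε := by field_simp

theorem abs_sub_le_of_err {i : ℕ} (hP : (0 : ℝ) < P)
    (h : |(V i : ℝ) / P - a i| ≤ D / (2 * (K + 1) * P)) :
    |(V i : ℝ) - P * a i| ≤ D / (2 * (K + 1)) :=
  abs_sub_mul_le hP (h.trans_eq (by field_simp))

theorem div_two_mul_le {x : ℝ} (hx : 0 ≤ x) (K : ℕ) : x / (2 * (K + 1)) ≤ x / 2 := by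
  refine div_le_div_of_nonneg_left hx (by norm_num) ?_
  linarith [(Nat.cast_nonneg K : (0 : ℝ) ≤ K)]

/-- At a large scale the approximations are good. -/
theorem lt_sq_of_scale_ge {W : ℝ} (hW : 2 ^ 20 ≤ W) (hD : (D : ℝ) ≤ W ^ 20)
    (hP : W ^ 30 ≤ (P : ℝ))
    (err : 2048 * D < P → ∀ i ≤ K, |(V i : ℝ) / P - a i| ≤ D / (2 * (K + 1) * P))
    (h1 : 1 ≤ D) (le_max : ∀ i ≤ K, V i ≤ mx) (hM : ∃ i ≤ K, 1 / W ≤ a i) :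
    0 < mx - D ∧ 2048 * D < P ∧ 2048 * D * P < (mx - D) * (mx - D) := by
  have hW0 : 0 < W := by linarith
  have hW20 : 0 < W ^ 20 := by positivity
  have hD1 : (1 : ℝ) ≤ D := by exact_mod_cast h1
  have h2048 : (2 : ℝ) ^ 20 * D ≤ W ^ 21 := by
    rw [pow_succ' W 20]
    exact mul_le_mul hW hD (by linarith) hW0.le
  have hlt : 2 ^ 20 * W ^ 21 ≤ W ^ 22 := by
    rw [pow_succ' W 21]
    exact mul_le_mul_of_nonneg_right hW (by positivity)
  have hW22 : W ^ 22 ≤ W ^ 28 := pow_le_pow_right₀ (by linarith) (by norm_num)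
  have hW28 : W ^ 28 ≤ W ^ 30 := pow_le_pow_right₀ (by linarith) (by norm_num)
  have hP0 : (0 : ℝ) < P := lt_of_lt_of_le (by positivity) hP
  have c1 : 2048 * (D : ℝ) < P := by
    have : 0 < W ^ 21 := by positivity
    norm_num at h2048 hlt ⊢
    linarith
  have c1' : 2048 * D < P := by exact_mod_cast c1
  obtain ⟨i, hi, hai⟩ := hM
  have h2 := abs_le.1 (abs_sub_le_of_err hP0 (err c1' i hi))
  have h3 := div_two_mul_le (by linarith : (0 : ℝ) ≤ D) K
  have h4 : (V i : ℝ) ≤ mx := by exact_mod_cast le_max i hi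
  have h5 : (P : ℝ) / W ≤ P * a i := by
    rw [div_eq_mul_one_div]
    exact mul_le_mul_of_nonneg_left hai hP0.le
  have h6 : W ^ 28 * 2 ^ 20 ≤ (P : ℝ) / W := by
    rw [le_div_iff₀ hW0]
    calc W ^ 28 * 2 ^ 20 * W ≤ W ^ 28 * W * W := by
          rw [mul_assoc, mul_assoc]
          refine mul_le_mul_of_nonneg_left ?_ (by positivity)
          exact mul_le_mul_of_nonneg_right hW hW0.le
      _ = W ^ 30 := by ring
      _ ≤ P := hP
  -- Some a_i is at least 1/W, so the maximum is at least P/W up to the error, and D ≤ W^20 is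
  -- negligible against P/W ≥ W^29.
  have h7 : (P : ℝ) / W / 2 ≤ mx - D := by
    have : 0 < W ^ 21 := by positivity
    norm_num at h2048 hlt h6
    linarith [h2.1]
  have h8 : 0 < (P : ℝ) / W / 2 := by positivity
  refine ⟨by exact_mod_cast h8.trans_le h7, c1', ?_⟩
  have h9 : 2048 * (D : ℝ) * P < (P : ℝ) / W / 2 * ((P : ℝ) / W / 2) := by
    have e : (P : ℝ) / W / 2 * ((P : ℝ) / W / 2) = (P / W / (4 * W)) * P := by field_simp; norm_num
    rw [e]
    refine mul_lt_mul_of_pos_right ?_ hP0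
    rw [lt_div_iff₀ (by positivity)]
    refine lt_of_lt_of_le ?_ h6
    have : 0 < W ^ 21 := by positivity
    calc 2048 * (D : ℝ) * (4 * W) = 2 ^ 13 * D * W := by ring
      _ ≤ 2 ^ 20 * D * W := by gcongr <;> norm_num
      _ ≤ W ^ 21 * W := by gcongr
      _ = W ^ 22 := by ring
      _ ≤ W ^ 28 := hW22
      _ < W ^ 28 * 2 ^ 20 := by
        have : 0 < W ^ 28 := by positivity
        linarith
  have h10 := mul_le_mul h7 h7 h8.le (h8.le.trans h7)
  exact_mod_cast h9.trans_le h10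

namespace GoodApprox

theorem scale_pos (h : GoodApprox K a P D mx V) : 0 < P := by
  have := h.one_le
  have := h.lt_scale
  omega

theorem scale_pos' (h : GoodApprox K a P D mx V) : (0 : ℝ) < P := by exact_mod_cast h.scale_pos

theorem abs_sub_le (h : GoodApprox K a P D mx V) {i : ℕ} (hi : i ≤ K) :
    |(V i : ℝ) - P * a i| ≤ D / (2 * (K + 1)) :=
  abs_sub_le_of_err h.scale_pos' (h.err i hi)

/-- Write b = mx - D. Either b ≥ P > 2048D, or b² < Pb, and then 2048DP < b² can be divided by P. -/
theorem error_lt (h : GoodApprox K a P D mx V) : 2048 * D < mx - D := by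
  have h1 := h.pos
  have h2 := h.one_le
  have h3 := h.lt_scale
  have h4 := h.lt_sq
  rcases le_or_gt P (mx - D) with h5 | h5
  · omega
  · have h6 : (mx - D) * (mx - D) < P * (mx - D) := mul_lt_mul_of_pos_right h5 h1
    have h7 : P * (2048 * D) < P * (mx - D) := by linarith
    exact lt_of_mul_lt_mul_left h7 h.scale_pos.le

/-- Subtracting D from the maximum errs on the safe side, since V_i exceeds P·a_i by at most D/2.
The loss, in the next lemma, is at most 3D/2, a small fraction of mx - D. -/
theorem sub_le (h : GoodApprox K a P D mx V) (hM : ∀ i ≤ K, a i ≤ M) :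
    ((mx - D : ℤ) : ℝ) ≤ P * M := by
  obtain ⟨i, hi, h1⟩ := h.max_mem
  have h2 := abs_le.1 (h.abs_sub_le hi)
  have hD : (1 : ℝ) ≤ D := by exact_mod_cast h.one_le
  have h3 := div_two_mul_le (by linarith : (0 : ℝ) ≤ D) K
  have h4 := mul_le_mul_of_nonneg_left (hM i hi) h.scale_pos'.le
  rw [h1]
  push_cast
  linarith [h2.2]

theorem le_sub (h : GoodApprox K a P D mx V) (hM : ∃ i ≤ K, a i = M) :
    P * M ≤ (1 + 2 / 2048) * ((mx - D : ℤ) : ℝ) := by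
  obtain ⟨i, hi, h1⟩ := hM
  have h2 := abs_le.1 (h.abs_sub_le hi)
  have hD : (1 : ℝ) ≤ D := by exact_mod_cast h.one_le
  have h3 := div_two_mul_le (by linarith : (0 : ℝ) ≤ D) K
  have h4 : (V i : ℝ) ≤ mx := by exact_mod_cast h.le_max i hi
  have h5 : 2048 * (D : ℝ) < ((mx - D : ℤ) : ℝ) := by exact_mod_cast h.error_lt
  rw [← h1]
  push_cast at h5 ⊢
  linarith [h2.1]

end GoodApprox

/-- The state of the search for the precision: `p = 2 ^ x` where either `x = 1`, or `x` is twice the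
previous value, which was too small. -/
def SearchState (P b p : ℤ) (x : ℕ) : Prop :=
  p = 2 ^ x ∧ (x = 1 ∨ ∃ (y : ℕ) (q : ℤ), x = 2 * y ∧ p = q * q ∧ 0 < q ∧ 512 * q * b < 600 * P)

namespace GoodApprox

variable {p : ℤ} {x : ℕ}

/-- Explains the quadratic acceptance condition: with b = mx - D and p = q², the failure 512qb <
600P gives 1024pD < 1024·(600/512)²·DP²/b², which is below P because 1024·(600/512)² < 2048 and
2048DP < b². -/
theorem mul_error_le (h : GoodApprox K a P D mx V) (hs : SearchState P (mx - D) p x) :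
    1024 * p * D ≤ P := by
  rcases hs with ⟨hp, rfl | ⟨y, q, -, hq, hq0, h1⟩⟩
  · have := h.lt_scale
    rw [hp]; omega
  · have hb := h.pos
    have h2 := h.lt_sq
    have hP := h.scale_pos
    have hD := h.one_le
    rw [hq]
    generalize mx - D = b at *
    have h3 : (512 * q * b) * (512 * q * b) ≤ (600 * P) * (600 * P) :=
      mul_le_mul h1.le h1.le (by positivity) (by positivity)
    have h4 : (512 * q) * (512 * q) * (2048 * D * P) ≤ (512 * q) * (512 * q) * (b * b) :=
      mul_le_mul_of_nonneg_left h2.le (by positivity)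
    have h5 : P * ((512 * 512 * 2) * (1024 * (q * q) * D)) ≤ P * (600 * 600 * P) := by linarith
    have h6 := le_of_mul_le_mul_left h5 hP
    omega

/-- The failure of q gives 512qM ≤ 601; after squaring, 2^(9+x)M² = 512q²M² ≤ 601²/512 < 2^10. -/
theorem precision_le (h : GoodApprox K a P D mx V) (hs : SearchState P (mx - D) p x)
    (hM : ∃ i ≤ K, a i = M) (hM0 : 0 ≤ M) :
    9 + x ≤ 10 ∨ (2 : ℝ) ^ (9 + x) * M ^ 2 ≤ 2 ^ 10 := by
  rcases hs with ⟨hp, rfl | ⟨y, q, -, hq, hq0, h1⟩⟩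
  · exact Or.inl le_rfl
  · right
    have hP := h.scale_pos'
    have h2 := h.le_sub hM
    have h3 : 512 * (q : ℝ) * ((mx - D : ℤ) : ℝ) < 600 * P := by exact_mod_cast h1
    have hq' : (0 : ℝ) < q := by exact_mod_cast hq0
    have h4 : P * (512 * q * M) ≤ P * 601 := by
      have := mul_le_mul_of_nonneg_left h2 (by positivity : 0 ≤ 512 * (q : ℝ))
      linarith
    have h5 := le_of_mul_le_mul_left h4 hP
    have h6 : (2 : ℝ) ^ x = q * q := by
      rw [← Int.cast_mul, ← hq, hp]; push_cast; rfl
    have h7 : 512 * q * M * (512 * q * M) ≤ 601 * 601 :=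
      mul_le_mul h5 h5 (by positivity) (by norm_num)
    rw [pow_add, h6]
    norm_num
    linarith

/-- Since mx - D ≤ PM, the stopping condition gives 600 ≤ 2^(9+x)M, more than the 518 that a verdict
needs. -/
theorem le_precision (h : GoodApprox K a P D mx V) (hs : SearchState P (mx - D) p x)
    (hx : 600 * P ≤ 512 * p * (mx - D)) (hM : ∀ i ≤ K, a i ≤ M) :
    518 / (2 : ℝ) ^ (9 + x) ≤ M := by
  have h1 := h.sub_le hM
  have hP := h.scale_pos'
  have h2 : (2 : ℝ) ^ x = p := by rw [hs.1]; push_cast; rfl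
  have hp : (0 : ℝ) < p := by rw [← h2]; positivity
  have h3 : 600 * (P : ℝ) ≤ 512 * p * ((mx - D : ℤ) : ℝ) := by exact_mod_cast hx
  rw [div_le_iff₀ (by positivity), pow_add, h2]
  norm_num
  have h4 := mul_le_mul_of_nonneg_left h1 (by positivity : 0 ≤ 512 * (p : ℝ))
  have h5 : P * 600 ≤ P * (M * (512 * p)) := by linarith
  linarith [le_of_mul_le_mul_left h5 hP]

/-- Error below 1 before the floor and below 1 from the floor add up to less than 2 units of
2^(-(L+1)), where 2^(L+1) = 1024p. -/
theorem isBitApprox_of_abs_sub_le {z : ℤ} {u E : ℝ} (hs : p = 2 ^ x)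
    (hz : u - 1 < z ∧ (z : ℝ) ≤ u) (h : |u - 1024 * p * E| < 1) :
    IsBitApprox (9 + x) ((z : ℝ) / 2 ^ (9 + x + 1)) E := by
  have h2 : (2 : ℝ) ^ x = p := by rw [hs]; push_cast; rfl
  have hp : (0 : ℝ) < p := by rw [← h2]; positivity
  have e1 : (2 : ℝ) ^ (9 + x) = 512 * p := by rw [pow_add, h2]; norm_num
  have e2 : (2 : ℝ) ^ (9 + x + 1) = 1024 * p := by rw [pow_succ, e1]; ring
  unfold IsBitApprox
  rw [e1, e2]
  obtain ⟨h4, h3⟩ := hz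
  have h5 := abs_lt.1 h
  have e3 : (z : ℝ) / (1024 * p) - E = (z - 1024 * p * E) / (1024 * p) := by field_simp
  rw [e3, abs_div, abs_of_pos (by positivity : (0 : ℝ) < 1024 * p),
    div_lt_div_iff₀ (by positivity) (by positivity)]
  have h6 : |(z : ℝ) - 1024 * p * E| < 2 := abs_lt.2 ⟨by linarith [h5.1], by linarith [h5.2]⟩
  calc |(z : ℝ) - 1024 * p * E| * (512 * p) < 2 * (512 * p) :=
        mul_lt_mul_of_pos_right h6 (by positivity)
    _ = 1 * (1024 * p) := by ring

theorem isBitApprox_left (h : GoodApprox K a P D mx V) (hs : SearchState P (mx - D) p x) {l : ℕ}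
    (hl : l ≤ K) :
    IsBitApprox (9 + x) (((V l * (1024 * p) / P : ℤ) : ℝ) / 2 ^ (9 + x + 1)) (a l) := by
  refine isBitApprox_of_abs_sub_le hs.1 (ediv_cast_bounds _ h.scale_pos) ?_
  have hP := h.scale_pos'
  have h1 := h.abs_sub_le hl
  have hD : (1 : ℝ) ≤ D := by exact_mod_cast h.one_le
  have h3 := div_two_mul_le (by linarith : (0 : ℝ) ≤ D) K
  have h2 : (2 : ℝ) ^ x = p := by rw [hs.1]; push_cast; rfl
  have hp : (0 : ℝ) < p := by rw [← h2]; positivity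
  have h4 : 1024 * (p : ℝ) * D ≤ P := by exact_mod_cast h.mul_error_le hs
  push_cast
  have e : (V l : ℝ) * (1024 * p) / P - 1024 * p * a l = (1024 * p / P) * (V l - P * a l) := by
    field_simp
  rw [e, abs_mul, abs_of_pos (by positivity)]
  calc _ ≤ 1024 * (p : ℝ) / P * (D / 2) := mul_le_mul_of_nonneg_left (h1.trans h3) (by positivity)
    _ = 1024 * (p : ℝ) * D / P / 2 := by ring
    _ ≤ 1 / 2 := by
      refine div_le_div_of_nonneg_right ?_ (by norm_num)
      rwa [div_le_one hP]
    _ < 1 := by norm_num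

/-- The K summands each have error at most D/(2(K+1)), together at most D/2. After rescaling this is
at most 65/64·1/2 < 1. -/
theorem isBitApprox_right (h : GoodApprox K a P D mx V) (hs : SearchState P (mx - D) p x) {l : ℕ}
    (hl : l ≤ K) :
    IsBitApprox (9 + x)
      (((((∑ i ∈ Finset.range (K + 1), V i) - V l) * (65 * (1024 * p)) / (64 * P) : ℤ) : ℝ)
        / 2 ^ (9 + x + 1)) (65 / 64 * ∑ i ∈ (Finset.range (K + 1)).erase l, a i) := by
  refine isBitApprox_of_abs_sub_le hs.1
    (ediv_cast_bounds _ (mul_pos (by norm_num : (0 : ℤ) < 64) h.scale_pos)) ?_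
  have hP := h.scale_pos'
  have hD : (1 : ℝ) ≤ D := by exact_mod_cast h.one_le
  have h2 : (2 : ℝ) ^ x = p := by rw [hs.1]; push_cast; rfl
  have hp : (0 : ℝ) < p := by rw [← h2]; positivity
  have h4 : 1024 * (p : ℝ) * D ≤ P := by exact_mod_cast h.mul_error_le hs
  have hmem : l ∈ Finset.range (K + 1) := Finset.mem_range.2 (by omega)
  have e0 : (((∑ i ∈ Finset.range (K + 1), V i) - V l : ℤ) : ℝ)
      = ∑ i ∈ (Finset.range (K + 1)).erase l, (V i : ℝ) := by
    rw [← Finset.add_sum_erase _ _ hmem]; push_cast; ring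
  have h5 : |(∑ i ∈ (Finset.range (K + 1)).erase l, (V i : ℝ))
      - P * ∑ i ∈ (Finset.range (K + 1)).erase l, a i| ≤ D / 2 := by
    rw [Finset.mul_sum, ← Finset.sum_sub_distrib]
    refine (Finset.abs_sum_le_sum_abs _ _).trans ?_
    refine (Finset.sum_le_card_nsmul _ _ _ fun i hi => h.abs_sub_le
      (Nat.lt_succ_iff.1 (Finset.mem_range.1 (Finset.mem_of_mem_erase hi)))).trans ?_
    rw [Finset.card_erase_of_mem hmem, Finset.card_range, nsmul_eq_mul, Nat.add_sub_cancel,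
      mul_div_assoc', div_le_div_iff₀ (by positivity) (by norm_num)]
    nlinarith [(Nat.cast_nonneg K : (0 : ℝ) ≤ K)]
  rw [Int.cast_mul, e0]
  push_cast
  generalize ∑ i ∈ (Finset.range (K + 1)).erase l, (V i : ℝ) = x₁ at *
  generalize ∑ i ∈ (Finset.range (K + 1)).erase l, a i = x₂ at *
  have e : x₁ * (65 * (1024 * p)) / (64 * P) - 1024 * p * (65 / 64 * x₂)
      = 65 / 64 * ((1024 * p / P) * (x₁ - P * x₂)) := by
    field_simp
  rw [e, abs_mul, abs_mul, abs_of_pos (by positivity : (0 : ℝ) < 1024 * p / P)]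
  calc _ ≤ |(65 / 64 : ℝ)| * (1024 * p / P * (D / 2)) :=
        mul_le_mul_of_nonneg_left (mul_le_mul_of_nonneg_left h5 (by positivity)) (by positivity)
    _ = 65 / 64 * (1024 * p * D / P / 2) := by rw [abs_of_pos (by norm_num)]; ring
    _ ≤ 65 / 64 * (1 / 2) := by
      refine mul_le_mul_of_nonneg_left (div_le_div_of_nonneg_right ?_ (by norm_num)) (by norm_num)
      rwa [div_le_one hP]
    _ < 1 := by norm_num

end GoodApprox

/-- The verdict that the program returns for the approximations `A` and `B`. -/
def verdictOf (A B : ℤ) : Verdict :=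
  if 3 < B - A then .no else if 3 < A - B then .yes else .undecided

/-- The gap 2·2^(-L) is four units of 2^(-(L+1)), and for integers 3 < B - A means a difference of
at least 4. -/
theorem certifies_verdictOf {A B : ℤ} {L : ℕ} {E E' : ℝ}
    (hA : IsBitApprox L ((A : ℝ) / 2 ^ (L + 1)) E) (hB : IsBitApprox L ((B : ℝ) / 2 ^ (L + 1)) E')
    (hE : 518 / (2 : ℝ) ^ L ≤ max E E') :
    Certifies (1 / 128) L ((A : ℝ) / 2 ^ (L + 1)) ((B : ℝ) / 2 ^ (L + 1)) (verdictOf A B) := by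
  have h2 : (0 : ℝ) < 2 ^ (L + 1) := by positivity
  have e : 2 / (2 : ℝ) ^ L = 4 / 2 ^ (L + 1) := by rw [pow_succ]; field_simp; norm_num
  unfold verdictOf
  split_ifs with h h'
  · refine certifies_no ?_
    rw [e, ← sub_div]
    refine div_le_div_of_nonneg_right ?_ h2.le
    exact_mod_cast (by omega : 4 ≤ B - A)
  · refine certifies_yes ?_
    rw [e, ← sub_div]
    refine div_le_div_of_nonneg_right ?_ h2.le
    exact_mod_cast (by omega : 4 ≤ A - B)
  · refine certifies_undecided ?_ hA hB hE
    rw [e, ← sub_div, abs_div, abs_of_pos h2]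
    refine div_lt_div_of_pos_right ?_ h2
    have : |A - B| < 4 := abs_lt.2 ⟨by omega, by omega⟩
    exact_mod_cast this

end SparseRoots

/-! ### Searches for the working and the output precision, and writing the output -/

namespace SparseRoots

variable {O : ℕ → ℕ → ℤ} {v n k K base T T₁ : ℕ} {e : ℕ → ℕ} {c : ℕ → ℝ} {m : ℂ} {r W M : ℝ} {κ : ℕ}

/-- The relation between the bound `W`, the word size `v` and the iteration bound `T`. -/
structure SizeBound (v T : ℕ) (W : ℝ) : Prop where
  le_W : 2 ^ 20 ≤ W
  W_le : W ^ 200 ≤ 2 ^ v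
  size_le : v + 3 ≤ 2 ^ (T + 1)

namespace SizeBound

theorem one_le (h : SizeBound v T W) : 1 ≤ W := le_trans (by norm_num) h.le_W

theorem pow_le (h : SizeBound v T W) {i : ℕ} (hi : i ≤ 200) : W ^ i ≤ 2 ^ v :=
  (pow_le_pow_right₀ h.one_le hi).trans h.W_le

theorem sz (h : SizeBound v T W) {i : ℕ} (hi : i ≤ 200) {x : ℤ} (hx : |(x : ℝ)| ≤ W ^ i) :
    Sz v 1 x :=
  Sz.of_real (hx.trans ((h.pow_le hi).trans (pow_le_pow_right₀ one_le_two (by omega))))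

theorem exponent_le (h : SizeBound v T W) {i x : ℕ} (hi : i ≤ 200) (hx : (2 : ℝ) ^ x ≤ W ^ i) :
    x ≤ v :=
  (pow_le_pow_iff_right₀ one_lt_two).1 (hx.trans (h.pow_le hi))

end SizeBound

theorem sz_of_le_size {x : ℕ} (hx : x ≤ v) : Sz v 1 (x : ℤ) := by
  refine Sz.of_le (y := (2 ^ (v + 1) : ℤ)) (hy := ⟨by simp⟩) (by positivity) ?_
  have h1 : x < 2 ^ (v + 1) := lt_of_le_of_lt (hx.trans (by omega)) Nat.lt_two_pow_self
  exact_mod_cast h1.le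

theorem scale_two_mul_add_one (κ : ℕ) : scale (2 * κ + 1) = scale κ * scale κ := by
  unfold scale; rw [← pow_add]; congr 1; ring

theorem sz_scale_of_le (h : SizeBound v T W) {i : ℕ} (hi : i ≤ 200) (hκ : (scale κ : ℝ) ≤ W ^ i) :
    Sz v 1 (scale κ) ∧ κ + 1 ≤ v ∧ Sz v 1 (κ : ℤ) := by
  have h0 : (0 : ℝ) < scale κ := by exact_mod_cast scale_pos κ
  have h1 : κ + 1 ≤ v := h.exponent_le hi (by rwa [scale_cast] at hκ)
  exact ⟨h.sz hi (by rwa [abs_of_pos h0]), h1, sz_of_le_size (by omega)⟩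

/-- Termination of the doubling loops: x doubles while j drops by one, so x·2^j ≥ 2^(T+1) persists.
As the size bounds force x < 2^(T+1), j cannot be exhausted. -/
theorem pos_of_lt_two_pow {x T j : ℕ} (h : 2 ^ (T + 1) ≤ x * 2 ^ j) (hx : x < 2 ^ (T + 1)) :
    ∃ j', j = j' + 1 := by
  rcases j with _ | j
  · omega
  · exact ⟨j, rfl⟩

theorem Ready.of_frame {p : Cmd} {s s' : State} (h : Ready n k K base e s) (hf : Frame p s s')
    (hp : ∀ x ∈ ([0, 1, 2, 3, 4, 5, 28, 52] : List ℕ), x ∉ p.writes)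
    (hm : ∀ j < k, s'.mem j = e j) : Ready n k K base e s' where
  r0 := (hf.1 0 (hp 0 (by decide))).trans h.r0
  r1 := (hf.1 1 (hp 1 (by decide))).trans h.r1
  r2 := (hf.1 2 (hp 2 (by decide))).trans h.r2
  r3 := (hf.1 3 (hp 3 (by decide))).trans h.r3
  r4 := (hf.1 4 (hp 4 (by decide))).trans h.r4
  r5 := (hf.1 5 (hp 5 (by decide))).trans h.r5
  r28 := (hf.1 28 (hp 28 (by decide))).trans h.r28
  r52 := (hf.1 52 (hp 52 (by decide))).trans h.r52
  mem := hm

/-- Increases the precision until the scale is at least the number in register 52. -/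
def startLoop : Cmd :=
  .loop 50 (.block [.mul 6 6 6, .add 7 7 7, .add 7 7 3, .sub 50 52 6])

/-- Rounds start only when the scale reaches the number of roundings, since from there on the
accumulated factor (1+4/P)^s is bounded by a constant. Squaring overshoots to at most W². -/
theorem startLoop_spec {s : State} {S : ℕ} (hW : SizeBound v T W) (h3 : s.reg 3 = 1)
    (h6 : s.reg 6 = scale 1) (h7 : s.reg 7 = (1 : ℕ)) (h52 : s.reg 52 = S)
    (h50 : s.reg 50 = S - scale 1) (hS : (S : ℝ) ≤ W) :
    Tri O (opBits v) startLoop (T * 6 + 1) s fun s' => ∃ κ : ℕ, 1 ≤ κ ∧ s'.reg 6 = scale κ ∧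
      s'.reg 7 = κ ∧ S ≤ 2 ^ (κ + 1) ∧ (scale κ : ℝ) ≤ W ^ 2 := by
  have sS : Sz v 1 (S : ℤ) := hW.sz (i := 1) (by norm_num) (by simpa using hS)
  have hW1 := hW.one_le
  refine Tri.loop (N := 5) (fun j u => ∃ κ : ℕ, 1 ≤ κ ∧ u.reg 6 = scale κ ∧ u.reg 7 = κ ∧
    u.reg 50 = S - scale κ ∧ (scale κ : ℝ) ≤ W ^ 2 ∧ 2 ^ (T + 1) ≤ (κ + 1) * 2 ^ j) T
    ⟨1, le_rfl, h6, h7, h50, ?_, by rw [pow_succ, mul_comm]⟩ ?_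
  · rw [scale_cast]
    exact (by norm_num [hW.le_W] : (2 : ℝ) ^ (1 + 1) ≤ 2 ^ 20).trans
      (hW.le_W.trans (le_self_pow₀ hW1 (by norm_num)))
  rintro j u ⟨κ, hκ, i6, i7, i50, iW, ij⟩ hfr
  have i3 := (hfr.1 3 (by decide)).trans h3
  have i52 := (hfr.1 52 (by decide)).trans h52
  obtain ⟨sP, hκv, sκ⟩ := sz_scale_of_le hW (by norm_num) iW
  refine ⟨by rw [i50]; exact Sz.bits_le (by norm_num), fun h => ?_, fun h => ?_⟩
  · refine ⟨κ, hκ, i6, i7, ?_, iW⟩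
    rw [i50] at h
    unfold scale at h
    exact_mod_cast (by linarith : (S : ℤ) ≤ 2 ^ (κ + 1))
  · obtain ⟨j, rfl⟩ := pos_of_lt_two_pow ij (by have := hW.size_le; omega)
    have h1 : (scale κ : ℝ) ≤ W := by
      rw [i50] at h
      have : (scale κ : ℤ) ≤ (S : ℤ) := by linarith
      have : (scale κ : ℝ) ≤ S := by exact_mod_cast this
      linarith
    have hP : (0 : ℝ) < scale κ := by exact_mod_cast scale_pos κ
    refine ⟨j, rfl, (Tri.of_wp (one_le_opBits v) (Q := fun w => w.reg 6 = scale (2 * κ + 1) ∧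
      w.reg 7 = (2 * κ + 1 : ℕ) ∧ w.reg 50 = S - scale (2 * κ + 1)) ?_).mono (by decide)
      fun w _ ⟨k6, k7, k50⟩ => ⟨2 * κ + 1, by omega, k6, k7, k50, ?_, ?_⟩⟩
    · simp only [Cmd.block, wp, State.setReg_reg, i3, i52, i6, i7, scale_two_mul_add_one]
      simp [Sz.bits_le]
      ring
    · rw [scale_two_mul_add_one, pow_two]
      push_cast
      exact mul_le_mul h1 h1 hP.le (by linarith)
    · calc 2 ^ (T + 1) ≤ (κ + 1) * 2 ^ (j + 1) := ij
        _ = (2 * κ + 1 + 1) * 2 ^ j := by ring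

/-- Increases the precision until it suffices. -/
def roundLoop : Cmd :=
  .loop 11 (.block [.block [.mul 6 6 6, .add 7 7 7, .add 7 7 3], roundCmd])

/-- The absolute values of the coefficients are known with sufficient precision. -/
structure RoundsDone (n k K base : ℕ) (e : ℕ → ℕ) (v : ℕ) (a : ℕ → ℝ) (W : ℝ) (P D : ℤ) (s : State) :
    Prop where
  ready : Ready n k K base e s
  r6 : s.reg 6 = P
  r53 : s.reg 53 = s.reg 13 - D
  r14 : s.reg 14 = ∑ i ∈ Finset.range (K + 1), s.mem (base + 2 * i)
  scale_le : (P : ℝ) ≤ W ^ 60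
  good : GoodApprox K a P D (s.reg 13) fun i => s.mem (base + 2 * i)
  nonneg : ∀ i ≤ K, 0 ≤ s.mem (base + 2 * i)
  size : ∀ i ≤ K, s.mem (base + 2 * i) ≤ 2 ^ (3 * (v + 1))

/-- A round with scale at least W^30 always succeeds, so after an unsuccessful one the scale is
below W^30 and its square is at most W^60. -/
theorem roundLoop_spec {s : State} (hW : SizeBound v T W)
    (hset : ∀ κ : ℕ, 1 ≤ κ → 2 * n + 2 * K + 2 ≤ 2 ^ (κ + 1) → (2 : ℝ) ^ (κ + 1) ≤ W ^ 60 →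
      Setup O v n k K base T₁ e c m r W κ)
    (hs : Ready n k K base e s) (h11 : s.reg 11 = 1) (h6 : s.reg 6 = scale κ) (h7 : s.reg 7 = κ)
    (hκ : 1 ≤ κ) (hS : 2 * n + 2 * K + 2 ≤ 2 ^ (κ + 1)) (hκW : (scale κ : ℝ) ≤ W ^ 2)
    (hM : ∃ i ≤ K, 1 / W ≤ ‖shiftCoeff k e c m r i‖) :
    Tri O (opBits v) roundLoop (T * (roundCost k K T₁ + 6) + 1) s fun s' =>
      ∃ P D, RoundsDone n k K base e v (fun i => ‖shiftCoeff k e c m r i‖) W P D s' := by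
  have hW1 := hW.one_le
  have hW2 : W ^ 2 < W ^ 30 := pow_lt_pow_right₀ (lt_of_lt_of_le (by norm_num) hW.le_W) (by norm_num)
  refine Tri.loop (N := roundCost k K T₁ + 5) (fun j u => ∃ κ : ℕ, 1 ≤ κ ∧ u.reg 6 = scale κ ∧
    u.reg 7 = κ ∧ Ready n k K base e u ∧ 2 * n + 2 * K + 2 ≤ 2 ^ (κ + 1) ∧
    2 ^ (T + 1) ≤ (κ + 1) * 2 ^ j ∧
    (u.reg 11 = 1 ∧ (scale κ : ℝ) < W ^ 30 ∨ u.reg 11 = 0 ∧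
      ∃ P D, RoundsDone n k K base e v (fun i => ‖shiftCoeff k e c m r i‖) W P D u)) T
    ⟨κ, hκ, h6, h7, hs, hS, ?_, Or.inl ⟨h11, hκW.trans_lt hW2⟩⟩ ?_
  · rw [pow_succ, mul_comm]
    exact Nat.mul_le_mul_right _ (by omega)
  rintro j u ⟨κ, hκ, i6, i7, iready, iS, ij, ⟨i11, iW⟩ | ⟨i11, idone⟩⟩ hfr
  · have h60 : (scale κ : ℝ) ≤ W ^ 30 := iW.le
    obtain ⟨sP, hκv, sκ⟩ := sz_scale_of_le hW (by norm_num) h60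
    refine ⟨by rw [i11]; exact Sz.bits_le (by norm_num), fun h => by omega, fun _ => ?_⟩
    obtain ⟨j, rfl⟩ := pos_of_lt_two_pow ij (by have := hW.size_le; omega)
    have hP : (0 : ℝ) < scale κ := by exact_mod_cast scale_pos κ
    have hsc : (scale (2 * κ + 1) : ℝ) ≤ W ^ 60 := by
      rw [scale_two_mul_add_one]
      push_cast
      calc _ ≤ W ^ 30 * W ^ 30 := mul_le_mul h60 h60 hP.le (by positivity)
        _ = W ^ 60 := by ring
    have hS' : 2 * n + 2 * K + 2 ≤ 2 ^ (2 * κ + 1 + 1) :=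
      iS.trans (Nat.pow_le_pow_right (by norm_num) (by omega))
    have i3 := iready.r3
    refine ⟨j, rfl, ?_⟩
    refine Tri.mono (Tri.cons (N := 4) (N' := roundCost k K T₁ + 1)
      (R := fun w => w.reg 6 = scale (2 * κ + 1) ∧ w.reg 7 = (2 * κ + 1 : ℕ))
      (Tri.of_wp (one_le_opBits v) ?_) fun s₁ f₁ ⟨a6, a7⟩ => ?_) (by omega) fun _ _ h => h
    · simp only [Cmd.block, wp, State.setReg_reg, i3, i6, i7, scale_two_mul_add_one]
      simp [Sz.bits_le]
      ring
    have r₁ : Ready n k K base e s₁ := iready.of_frame f₁ (by decide) fun j hj => by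
      rw [f₁.2 (by decide)]; exact iready.mem j hj
    refine Tri.mono (Tri.cons (N' := 1) (roundCmd_spec (hset (2 * κ + 1) (by omega) hS'
      (by rwa [scale_cast] at hsc)) r₁ a6 a7) fun s₂ f₂ ⟨D, hD⟩ => Tri.nil (one_le_opBits v) ?_)
      le_rfl fun _ _ h => h
    have r₂ : Ready n k K base e s₂ := r₁.of_frame f₂ (by decide) hD.mem
    refine ⟨2 * κ + 1, by omega, (f₂.1 6 (by decide)).trans a6, (f₂.1 7 (by decide)).trans a7, r₂, hS',
      ?_, ?_⟩
    · calc 2 ^ (T + 1) ≤ (κ + 1) * 2 ^ (j + 1) := ij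
        _ = (2 * κ + 1 + 1) * 2 ^ j := by ring
    by_cases hc : 0 < s₂.reg 53 ∧ 2048 * D < scale (2 * κ + 1) ∧
        2048 * D * scale (2 * κ + 1) < s₂.reg 53 * s₂.reg 53
    · right
      refine ⟨by rw [hD.flag, if_pos hc], scale (2 * κ + 1), D, r₂, (f₂.1 6 (by decide)).trans a6,
        hD.diff, hD.sum, hsc, ⟨hD.one_le, hD.err hc.2.1, hD.le_max, hD.max_mem, ?_, hc.2.1, ?_⟩,
        hD.nonneg, hD.size⟩
      · rw [← hD.diff]; exact hc.1
      · rw [← hD.diff]; exact hc.2.2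
    · left
      refine ⟨by rw [hD.flag, if_neg hc], not_le.1 fun hle => hc ?_⟩
      rw [hD.diff]
      exact lt_sq_of_scale_ge hW.le_W hD.le hle hD.err hD.one_le hD.le_max hM
  · exact ⟨by rw [i11]; exact Sz.bits_le (by norm_num), fun _ => idone, fun h => by omega⟩

/-- Looks for the precision of the output. -/
def searchLoop : Cmd :=
  .loop 62 (.block [.mul 60 60 60, .add 61 61 61, .mul 62 64 60, .sub 62 63 62])

/-- The previous value satisfied 512qb < 600P with b ≥ 1, hence q ≤ 2P and p = q² ≤ 4P². -/
theorem SearchState.le {P b p : ℤ} {x : ℕ} (h : SearchState P b p x) (hb : 0 < b) (hP : 1 ≤ P) :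
    0 < p ∧ p ≤ 4 * (P * P) := by
  rcases h with ⟨hp, rfl | ⟨y, q, -, hq, hq0, h1⟩⟩
  · rw [hp]
    norm_num
    nlinarith
  · have h2 : q ≤ 2 * P := by nlinarith
    rw [hq]
    exact ⟨mul_pos hq0 hq0, by nlinarith⟩

theorem SearchState.size (hW : SizeBound v T W) {P b p : ℤ} {x : ℕ} (h : SearchState P b p x)
    (hb : 0 < b) (hP : 1 ≤ P) (hPW : (P : ℝ) ≤ W ^ 60) : Sz v 1 p ∧ x ≤ v := by
  obtain ⟨h0, h1⟩ := h.le hb hP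
  have h0' : (0 : ℝ) < p := by exact_mod_cast h0
  have h1' : (p : ℝ) ≤ 4 * (P * P) := by exact_mod_cast h1
  have hP' : (1 : ℝ) ≤ P := by exact_mod_cast hP
  have hW1 := hW.one_le
  have h4 : (4 : ℝ) ≤ W := le_trans (by norm_num) hW.le_W
  have h2 : (p : ℝ) ≤ W ^ 121 := by
    calc (p : ℝ) ≤ 4 * (P * P) := h1'
      _ ≤ W * (W ^ 60 * W ^ 60) := by gcongr
      _ = W ^ 121 := by ring
  refine ⟨hW.sz (i := 121) (by norm_num) (by rwa [abs_of_pos h0']), hW.exponent_le (i := 121) (by norm_num) ?_⟩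
  have : (2 : ℝ) ^ x = p := by rw [h.1]; push_cast; rfl
  rwa [this]

theorem searchLoop_spec {s : State} {P b : ℤ} (hW : SizeBound v T W) (hP : 1 ≤ P)
    (hPW : (P : ℝ) ≤ W ^ 60) (hb : 0 < b) [Sz v 4 b] (h60 : s.reg 60 = 2) (h61 : s.reg 61 = 1)
    (h63 : s.reg 63 = 600 * P) (h64 : s.reg 64 = 512 * b) (h62 : s.reg 62 = 600 * P - 512 * b * 2) :
    Tri O (opBits v) searchLoop ((T + 1) * 6 + 1) s fun s' => ∃ (x : ℕ) (p : ℤ),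
      s'.reg 60 = p ∧ s'.reg 61 = x ∧ SearchState P b p x ∧ 600 * P ≤ 512 * p * b := by
  refine Tri.loop (N := 5) (fun j u => ∃ (x : ℕ) (p : ℤ), u.reg 60 = p ∧ u.reg 61 = x ∧
    u.reg 62 = 600 * P - 512 * b * p ∧ SearchState P b p x ∧ 2 ^ (T + 1) ≤ x * 2 ^ j) (T + 1)
    ⟨1, 2, h60, h61, h62, ⟨rfl, Or.inl rfl⟩, by omega⟩ ?_
  rintro j u ⟨x, p, i60, i61, i62, ist, ij⟩ hfr
  have i63 := (hfr.1 63 (by decide)).trans h63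
  have i64 := (hfr.1 64 (by decide)).trans h64
  obtain ⟨sp, hxv⟩ := ist.size hW hb hP hPW
  have sx := sz_of_le_size hxv
  have hP' : (1 : ℝ) ≤ P := by exact_mod_cast hP
  have sP : Sz v 1 P := hW.sz (i := 60) (by norm_num) (by rwa [abs_of_nonneg (by linarith)])
  refine ⟨by rw [i62]; exact Sz.bits_le (by norm_num), fun h => ?_, fun h => ?_⟩
  · exact ⟨x, p, i60, i61, ist, by linarith⟩
  · obtain ⟨j, rfl⟩ := pos_of_lt_two_pow ij (by have := hW.size_le; omega)
    refine ⟨j, rfl, (Tri.of_wp (one_le_opBits v) (Q := fun w => w.reg 60 = p * p ∧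
      w.reg 61 = (2 * x : ℕ) ∧ w.reg 62 = 600 * P - 512 * b * (p * p)) ?_).mono (by decide)
      fun w _ ⟨k60, k61, k62⟩ => ⟨2 * x, p * p, k60, k61, k62, ⟨?_, Or.inr ⟨x, p, rfl, rfl, ?_, ?_⟩⟩,
        ?_⟩⟩
    · simp only [Cmd.block, wp, State.setReg_reg, i60, i61, i63, i64]
      simp [Sz.bits_le]
      ring
    · rw [ist.1, ← pow_add]; congr 1; ring
    · exact (ist.le hb hP).1
    · linarith
    · calc 2 ^ (T + 1) ≤ x * 2 ^ (j + 1) := ij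
        _ = 2 * x * 2 ^ j := by ring

/-- Writes the output. -/
def outputLoop : Cmd :=
  .loop 38 (.block [.block [.add 37 35 35, .add 37 37 5, .load 36 37, .mul 67 36 65, .div 67 67 6,
      .sub 68 14 36, .mul 68 68 72, .div 68 68 73],
    .block [.const 71 2, .const 39 3, .sub 69 67 68, .sub 69 69 39, .ite 69 (.const 71 1) .skip,
      .sub 69 68 67, .sub 69 69 39, .ite 69 (.const 71 0) .skip],
    .block [.add 37 35 35, .add 37 37 37, .store 37 71, .add 37 37 3, .store 37 66, .add 37 37 3,
      .store 37 67, .add 37 37 3, .store 37 68, .add 35 35 3, .sub 38 38 3]])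

/-- The output cells 4l, …, 4l+3 with l ≤ k lie below `base`, so the stored moduli survive. The
exponents are overwritten, but they are no longer needed. -/
theorem outputLoop_spec {s : State} {P q sum : ℤ} {V : ℕ → ℤ} {L : ℕ} (hkK : k ≤ K)
    (h3 : s.reg 3 = 1) (h5 : s.reg 5 = base) (h6 : s.reg 6 = P) (h14 : s.reg 14 = sum)
    (h35 : s.reg 35 = 0) (h38 : s.reg 38 = (k + 1 : ℕ)) (h65 : s.reg 65 = q) (h66 : s.reg 66 = L)
    (h72 : s.reg 72 = 65 * q) (h73 : s.reg 73 = 64 * P) (hbase : 4 * k + 4 ≤ base)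
    (hV : ∀ i ≤ K, s.mem (base + 2 * i) = V i) (sV : ∀ i ≤ K, Sz v 3 (V i))
    [Sz v 4 sum] [Sz v 1 P] [Sz v 11 q] [Sz v 1 (base + 2 * K + 2 : ℤ)] [Sz v 5 (L : ℤ)] :
    Tri O (opBits v) outputLoop ((k + 1) * 40 + 1) s fun s' => ∀ l ≤ k,
      s'.mem (4 * l) = (verdictOf (V l * q / P) ((sum - V l) * (65 * q) / (64 * P))).code ∧
      s'.mem (4 * l + 1) = L ∧ s'.mem (4 * l + 2) = V l * q / P ∧
      s'.mem (4 * l + 3) = (sum - V l) * (65 * q) / (64 * P) := by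
  refine Tri.loop (N := 39) (fun j u => ∃ l : ℕ, l + j = k + 1 ∧ u.reg 35 = l ∧ u.reg 38 = j ∧
    (∀ i ≤ K, u.mem (base + 2 * i) = V i) ∧ ∀ l' < l,
      u.mem (4 * l') = (verdictOf (V l' * q / P) ((sum - V l') * (65 * q) / (64 * P))).code ∧
      u.mem (4 * l' + 1) = L ∧ u.mem (4 * l' + 2) = V l' * q / P ∧
      u.mem (4 * l' + 3) = (sum - V l') * (65 * q) / (64 * P)) (k + 1)
    ⟨0, by omega, h35, h38, hV, by omega⟩ ?_
  rintro j u ⟨l, hlj, i35, i38, iV, iout⟩ hfr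
  have i3 := (hfr.1 3 (by decide)).trans h3
  have i5 := (hfr.1 5 (by decide)).trans h5
  have i6 := (hfr.1 6 (by decide)).trans h6
  have i14 := (hfr.1 14 (by decide)).trans h14
  have i65 := (hfr.1 65 (by decide)).trans h65
  have i66 := (hfr.1 66 (by decide)).trans h66
  have i72 := (hfr.1 72 (by decide)).trans h72
  have i73 := (hfr.1 73 (by decide)).trans h73
  have sle : ∀ x : ℕ, x ≤ base + 2 * K + 2 → Sz v 1 (x : ℤ) := fun x hx =>
    Sz.of_le (y := (base + 2 * K + 2 : ℤ)) (by positivity) (by exact_mod_cast hx)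
  have sj := sle j (by omega)
  refine ⟨by rw [i38]; exact Sz.bits_le (by norm_num), fun h => ?_, fun h => ?_⟩
  · obtain rfl : l = k + 1 := by omega
    exact fun l' hl' => iout l' (by omega)
  obtain ⟨j, rfl⟩ : ∃ j', j = j' + 1 := ⟨j - 1, by omega⟩
  have sl := sle l (by omega)
  have sb := sle base (by omega)
  have sVl := sV l (by omega)
  refine ⟨j, rfl, ?_⟩
  set A := V l * q / P with hA
  set B := (sum - V l) * (65 * q) / (64 * P) with hB
  have sA : Sz v 14 A := inferInstance
  have sB : Sz v 23 B := inferInstance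
  refine Tri.mono (Tri.cons (N := 9) (N' := 26) (R := fun w => w.reg 67 = A ∧ w.reg 68 = B)
    (Tri.of_wp (one_le_opBits v) ?_) fun s₁ f₁ ⟨a67, a68⟩ => ?_) (by omega) fun _ _ h => h
  · have e1 : ((l : ℤ) + l + base).toNat = base + 2 * l := by omega
    have e2 := iV l (by omega)
    simp only [Cmd.block, wp, State.setReg_reg, i35, i5, i6, i14, i65, i72, i73]
    simp [Sz.bits_le, e1, e2, hA, hB]
  refine Tri.mono (Tri.cons (N := 13) (N' := 13) (R := fun w => w.reg 71 = (verdictOf A B).code)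
    (Tri.of_wp (one_le_opBits v) ?_) fun s₂ f₂ b71 => ?_) (by omega) fun _ _ h => h
  · simp only [Cmd.block, wp, State.setReg_reg, a67, a68]
    simp [Sz.bits_le]
    unfold verdictOf
    constructor
    · intro h1
      constructor
      · intro h2; omega
      · intro h2
        rw [if_neg (by omega), if_pos (by omega)]; rfl
    · intro h1
      constructor
      · intro h2
        rw [if_pos (by omega)]; rfl
      · intro h2
        rw [if_neg (by omega), if_neg (by omega)]; rfl
  have bmem : s₂.mem = u.mem := (f₂.2 (by decide)).trans (f₁.2 (by decide))
  have b3 := (f₂.1 3 (by decide)).trans ((f₁.1 3 (by decide)).trans i3)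
  have b35 := (f₂.1 35 (by decide)).trans ((f₁.1 35 (by decide)).trans i35)
  have b38 := (f₂.1 38 (by decide)).trans ((f₁.1 38 (by decide)).trans i38)
  have b66 := (f₂.1 66 (by decide)).trans ((f₁.1 66 (by decide)).trans i66)
  have b67 := (f₂.1 67 (by decide)).trans a67
  have b68 := (f₂.1 68 (by decide)).trans a68
  have scode : Sz v 1 (verdictOf A B).code := by
    cases verdictOf A B <;> exact Sz.lit (by decide)
  push_cast at sj b38
  refine Tri.mono (Tri.cons (N := 12) (N' := 1) (R := fun w => w.reg 35 = (l + 1 : ℕ) ∧ w.reg 38 = j ∧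
      ∀ x, w.mem x = if x = 4 * l + 3 then B else if x = 4 * l + 2 then A else
        if x = 4 * l + 1 then (L : ℤ) else if x = 4 * l then (verdictOf A B).code else u.mem x)
    (Tri.of_wp (one_le_opBits v) ?_) fun s₃ f₃ ⟨d35, d38, dmem⟩ => Tri.nil (one_le_opBits v) ?_)
    (by omega) fun _ _ h => h
  · have e0 : ((l : ℤ) + l + (l + l)).toNat = 4 * l := by omega
    have e1 : ((l : ℤ) + l + (l + l) + 1).toNat = 4 * l + 1 := by omega
    have e2 : ((l : ℤ) + l + (l + l) + 1 + 1).toNat = 4 * l + 2 := by omega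
    have e3 : ((l : ℤ) + l + (l + l) + 1 + 1 + 1).toNat = 4 * l + 3 := by omega
    simp only [Cmd.block, wp, State.setReg_reg, State.setReg_mem, State.setMem_reg, State.setMem_mem,
      b3, b35, b38, b66, b67, b68, b71, bmem]
    simp [Sz.bits_le, e0, e1, e2, e3]
  · refine ⟨l + 1, by omega, d35, d38, fun i hi => ?_, fun l' hl' => ?_⟩
    · rw [dmem, if_neg (by omega), if_neg (by omega), if_neg (by omega), if_neg (by omega)]
      exact iV i hi
    · rcases Nat.lt_succ_iff_lt_or_eq.1 hl' with h' | rfl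
      · obtain ⟨o1, o2, o3, o4⟩ := iout l' h'
        refine ⟨?_, ?_, ?_, ?_⟩ <;>
          rw [dmem, if_neg (by omega), if_neg (by omega), if_neg (by omega), if_neg (by omega)] <;>
          assumption
      · refine ⟨?_, ?_, ?_, ?_⟩ <;> rw [dmem] <;> simp [← hA, ← hB]

end SparseRoots

/-! ### The complete program -/

namespace SparseRoots

variable {O : ℕ → ℕ → ℤ} {v n k K base T T₁ : ℕ} {e : ℕ → ℕ} {c : ℕ → ℝ} {m : ℂ} {r W M : ℝ} {κ : ℕ}

/-- The output of the program for the `l`-th test. -/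
def OutputSpec (K : ℕ) (a : ℕ → ℝ) (M : ℝ) (l : ℕ) (s : State) : Prop :=
  ∃ (L : ℕ) (A B : ℤ), s.mem (4 * l) = (verdictOf A B).code ∧ s.mem (4 * l + 1) = L ∧
    s.mem (4 * l + 2) = A ∧ s.mem (4 * l + 3) = B ∧ 1 ≤ L ∧
    (L ≤ 10 ∨ (2 : ℝ) ^ L * M ^ 2 ≤ 2 ^ 10) ∧ 518 / (2 : ℝ) ^ L ≤ M ∧
    IsBitApprox L ((A : ℝ) / 2 ^ (L + 1)) (a l) ∧
    IsBitApprox L ((B : ℝ) / 2 ^ (L + 1)) (65 / 64 * ∑ i ∈ (Finset.range (K + 1)).erase l, a i)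

/-- The program. -/
def testCmd : Cmd :=
  .block [.block [.const 3 1, .mul 4 1 1, .add 5 1 3, .add 5 5 5, .add 5 5 5, .const 28 2,
      .add 52 0 4, .add 52 52 3, .add 52 52 52, .const 6 4, .const 7 1, .sub 50 52 6],
    startLoop, .const 11 1, roundLoop,
    .block [.const 60 2, .const 61 1, .const 63 600, .mul 63 63 6, .const 64 512, .mul 64 64 53,
      .mul 62 64 60, .sub 62 63 62],
    searchLoop,
    .block [.const 65 1024, .mul 65 65 60, .const 66 9, .add 66 66 61, .const 35 0, .add 38 1 3,
      .const 72 65, .mul 72 72 65, .const 73 64, .mul 73 73 6],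
    outputLoop]

/-- The number of steps of the program. -/
def testCost (k K T T₁ : ℕ) : ℕ := T * (roundCost k K T₁ + 18) + (k + 1) * 40 + 60

theorem RoundsDone.outputSpec {P D p : ℤ} {x l : ℕ} {a : ℕ → ℝ} {s s' : State}
    (h : RoundsDone n k K base e v a W P D s) (hs : SearchState P (s.reg 53) p x)
    (hx : 600 * P ≤ 512 * p * s.reg 53) (hM₁ : ∃ i ≤ K, a i = M) (hM₂ : ∀ i ≤ K, a i ≤ M)
    (hM : 0 ≤ M) (hl : l ≤ K)
    (h' : s'.mem (4 * l) = (verdictOf (s.mem (base + 2 * l) * (1024 * p) / P)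
        ((s.reg 14 - s.mem (base + 2 * l)) * (65 * (1024 * p)) / (64 * P))).code ∧
      s'.mem (4 * l + 1) = (9 + x : ℕ) ∧ s'.mem (4 * l + 2) = s.mem (base + 2 * l) * (1024 * p) / P ∧
      s'.mem (4 * l + 3) = (s.reg 14 - s.mem (base + 2 * l)) * (65 * (1024 * p)) / (64 * P)) :
    OutputSpec K a M l s' := by
  rw [h.r53] at hs hx
  obtain ⟨h1, h2, h3, h4⟩ := h'
  refine ⟨9 + x, _, _, h1, h2, h3, h4, by omega, h.good.precision_le hs hM₁ hM,
    h.good.le_precision hs hx hM₂, h.good.isBitApprox_left hs hl, ?_⟩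
  rw [h.r14]
  exact h.good.isBitApprox_right hs hl

set_option maxHeartbeats 1000000 in
theorem testCmd_spec {s : State} (hW : SizeBound v T W)
    (hset : ∀ κ : ℕ, 1 ≤ κ → 2 * n + 2 * (k * k) + 2 ≤ 2 ^ (κ + 1) → (2 : ℝ) ^ (κ + 1) ≤ W ^ 60 →
      Setup O v n k (k * k) (4 * k + 4) T₁ e c m r W κ)
    (h0 : s.reg 0 = n) (h1 : s.reg 1 = k) (h2 : s.reg 2 = 0) (hmem : ∀ j < k, s.mem j = e j)
    (hk : 1 ≤ k) (hS : ((2 * n + 2 * (k * k) + 2 : ℕ) : ℝ) ≤ W)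
    (hbW : ((4 * k + 4 + 2 * (k * k) + 2 : ℕ) : ℝ) ≤ W)
    (hM : 1 / W ≤ M) (hM₁ : ∃ i ≤ k * k, ‖shiftCoeff k e c m r i‖ = M)
    (hM₂ : ∀ i ≤ k * k, ‖shiftCoeff k e c m r i‖ ≤ M) :
    Tri O (opBits v) testCmd (testCost k (k * k) T T₁) s fun s' =>
      ∀ l ≤ k, OutputSpec (k * k) (fun i => ‖shiftCoeff k e c m r i‖) M l s' := by
  have hW1 := hW.one_le
  have sle : ∀ x : ℕ, x ≤ 4 * k + 4 + 2 * (k * k) + 2 → Sz v 1 (x : ℤ) := fun x hx =>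
    hW.sz (i := 1) (by norm_num) (by
      rw [Int.cast_natCast, abs_of_nonneg (by positivity), pow_one]
      exact le_trans (by exact_mod_cast hx) hbW)
  have sn : Sz v 1 (n : ℤ) := hW.sz (i := 1) (by norm_num) (by
      rw [Int.cast_natCast, abs_of_nonneg (by positivity), pow_one]
      exact le_trans (by exact_mod_cast (by omega : n ≤ 2 * n + 2 * (k * k) + 2)) hS)
  have sk := sle k (by omega)
  have sb : Sz v 1 (((4 * k + 4 : ℕ) : ℤ) + 2 * ((k * k : ℕ) : ℤ) + 2) := by
    have := sle _ le_rfl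
    push_cast at this ⊢
    exact this
  unfold testCmd testCost
  generalize hc : roundCost k (k * k) T₁ = C
  refine Tri.mono (Tri.cons (N := 13) (N' := T * (C + 18) + (k + 1) * 40 + 47)
    (R := fun w => Ready n k (k * k) (4 * k + 4) e w ∧ w.reg 6 = scale 1 ∧ w.reg 7 = (1 : ℕ) ∧
      w.reg 50 = (2 * n + 2 * (k * k) + 2 : ℕ) - scale 1)
    (Tri.of_wp (one_le_opBits v) ?_) fun s₁ f₁ ⟨a, a6, a7, a50⟩ => ?_) (by omega) fun _ _ h => h
  · have e1 : scale 1 = 4 := rfl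
    simp only [Cmd.block, wp, State.setReg_reg, h0, h1, e1]
    simp [Sz.bits_le]
    refine ⟨⟨?_, ?_, ?_, ?_, ?_, ?_, ?_, ?_, ?_⟩, by ring⟩ <;> simp [h0, h1, h2] <;>
      first | ring | exact hmem
  refine Tri.mono (Tri.cons (N' := T * (C + 12) + (k + 1) * 40 + 46)
    (startLoop_spec hW a.r3 a6 a7 a.r52 a50 hS) fun s₂ f₂ ⟨κ, hκ, b6, b7, hSκ, hκW⟩ => ?_)
    (by ring_nf; omega) fun _ _ h => h
  have b : Ready n k (k * k) (4 * k + 4) e s₂ := a.of_frame f₂ (by decide) fun j hj => by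
    rw [f₂.2 (by decide)]; exact a.mem j hj
  refine Tri.mono (Tri.cons (N := 1) (N' := T * (C + 12) + (k + 1) * 40 + 45)
    (R := fun w => w.reg 11 = 1) (Tri.of_wp (one_le_opBits v) ?_) fun s₃ f₃ d11 => ?_)
    (by omega) fun _ _ h => h
  · simp [wp, Sz.bits_le]
  have d : Ready n k (k * k) (4 * k + 4) e s₃ := b.of_frame f₃ (by decide) fun j hj => by
    rw [f₃.2 (by decide)]; exact b.mem j hj
  refine Tri.mono (Tri.cons (N' := T * 6 + (k + 1) * 40 + 44)
    (roundLoop_spec hW hset d d11 ((f₃.1 6 (by decide)).trans b6) ((f₃.1 7 (by decide)).trans b7) hκ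
      hSκ hκW (by obtain ⟨i, hi, h⟩ := hM₁; exact ⟨i, hi, by rwa [h]⟩))
    fun s₄ f₄ ⟨P, D, g⟩ => ?_) (by rw [hc]; ring_nf; omega) fun _ _ h => h
  have hP := g.good.scale_pos
  have hb : 0 < s₄.reg 53 := by rw [g.r53]; exact g.good.pos
  have hP' : (0 : ℝ) < P := by exact_mod_cast hP
  have sP : Sz v 1 P := hW.sz (i := 60) (by norm_num) (by rw [abs_of_pos hP']; exact g.scale_le)
  have sV : ∀ i ≤ k * k, Sz v 3 (s₄.mem (4 * k + 4 + 2 * i)) := fun i hi =>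
    ⟨by rw [abs_of_nonneg (g.nonneg i hi)]; exact g.size i hi⟩
  have ssum : Sz v 4 (s₄.reg 14) := by
    have hs : ∀ i ∈ Finset.range (k * k + 1), 0 ≤ s₄.mem (4 * k + 4 + 2 * i) ∧
        s₄.mem (4 * k + 4 + 2 * i) ≤ 2 ^ (3 * (v + 1)) := fun i hi =>
      have hi := Nat.lt_succ_iff.1 (Finset.mem_range.1 hi)
      ⟨g.nonneg i hi, g.size i hi⟩
    have sk2 := sle (k * k + 1) (by omega)
    refine Sz.of_le (y := ((k * k + 1 : ℕ) : ℤ) * 2 ^ (3 * (v + 1))) (hy := ?_) ?_ ?_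
    · have : Sz v 3 (2 ^ (3 * (v + 1)) : ℤ) := ⟨by simp⟩
      exact Sz.mono (i := 1 + 3) inferInstance (by norm_num)
    · rw [g.r14]; exact Finset.sum_nonneg fun i hi => (hs i hi).1
    · rw [g.r14]
      have := Finset.sum_le_card_nsmul _ _ _ fun i hi => (hs i hi).2
      simpa using this
  have sb53 : Sz v 4 (s₄.reg 53) := by
    obtain ⟨i, hi, h13⟩ := g.good.max_mem
    refine Sz.of_le (y := s₄.mem (4 * k + 4 + 2 * i)) (hy := (sV i hi).mono (by norm_num)) hb.le ?_
    have := g.good.one_le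
    rw [g.r53]
    linarith
  have g6 := g.r6
  refine Tri.mono (Tri.cons (N := 9) (N' := T * 6 + (k + 1) * 40 + 34)
    (R := fun w => w.reg 60 = 2 ∧ w.reg 61 = 1 ∧ w.reg 63 = 600 * P ∧ w.reg 64 = 512 * s₄.reg 53 ∧
      w.reg 62 = 600 * P - 512 * s₄.reg 53 * 2)
    (Tri.of_wp (one_le_opBits v) ?_) fun s₅ f₅ ⟨i60, i61, i63, i64, i62⟩ => ?_) (by omega)
    fun _ _ h => h
  · simp only [Cmd.block, wp, State.setReg_reg, g6]
    simp [Sz.bits_le]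
  refine Tri.mono (Tri.cons (N' := (k + 1) * 40 + 27)
    (searchLoop_spec hW (by omega) g.scale_le hb i60 i61 i63 i64 i62)
    fun s₆ f₆ ⟨x, p, j60, j61, jst, jle⟩ => ?_) (by omega) fun _ _ h => h
  obtain ⟨sp, hxv⟩ := jst.size hW hb (by omega) g.scale_le
  have sx := sz_of_le_size hxv
  have hget : ∀ y ∈ ([1, 3, 5, 6, 14] : List ℕ), s₆.reg y = s₄.reg y := by
    intro y hy
    rw [f₆.1 y, f₅.1 y]
    all_goals
      simp only [List.mem_cons, List.not_mem_nil, or_false] at hy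
      rcases hy with rfl | rfl | rfl | rfl | rfl <;> decide
  have j1 := (hget 1 (by decide)).trans g.ready.r1
  have j3 := (hget 3 (by decide)).trans g.ready.r3
  have j5 := (hget 5 (by decide)).trans g.ready.r5
  have j6 := (hget 6 (by decide)).trans g6
  have j14 := hget 14 (by decide)
  refine Tri.mono (Tri.cons (N := 11) (N' := (k + 1) * 40 + 2)
    (R := fun w => w.reg 65 = 1024 * p ∧ w.reg 66 = (9 + x : ℕ) ∧ w.reg 35 = 0 ∧
      w.reg 38 = (k + 1 : ℕ) ∧ w.reg 72 = 65 * (1024 * p) ∧ w.reg 73 = 64 * P)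
    (Tri.of_wp (one_le_opBits v) ?_) fun s₇ f₇ ⟨k65, k66, k35, k38, k72, k73⟩ => ?_) (by omega)
    fun _ _ h => h
  · simp only [Cmd.block, wp, State.setReg_reg, j1, j3, j6, j60, j61]
    simp [Sz.bits_le]
  have kmem : s₇.mem = s₄.mem := (f₇.2 (by decide)).trans ((f₆.2 (by decide)).trans
    (f₅.2 (by decide)))
  have sL : Sz v 5 ((9 + x : ℕ) : ℤ) := by
    push_cast
    exact Sz.mono (i := max 4 1 + 1) inferInstance (by norm_num)
  refine Tri.mono (Tri.cons (N' := 1) (outputLoop_spec (k := k) (K := k * k)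
    (V := fun i => s₄.mem (4 * k + 4 + 2 * i)) (by nlinarith)
    ((f₇.1 3 (by decide)).trans j3) ((f₇.1 5 (by decide)).trans j5) ((f₇.1 6 (by decide)).trans j6)
    ((f₇.1 14 (by decide)).trans j14) k35 k38 k65 k66 k72 k73 le_rfl
    (fun i _ => by rw [kmem]) sV)
    fun s₈ f₈ hout => Tri.nil (one_le_opBits v) fun l hl => ?_) (by omega) fun _ _ h => h
  have hMpos : 0 ≤ M := le_trans (by positivity) hM
  exact g.outputSpec jst jle hM₁ hM₂ hMpos (by nlinarith) (hout l hl)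

end SparseRoots

/-! ### Bit size of the input and the final cost estimate -/

namespace SparseRoots

/-- `L(m,r,f) + τ + n log max(1,|m|) + k² (log n + log max(1,r))` -/
noncomputable def bitSize (n k : ℕ) (τ : ℝ) (f : ℝ[X]) (m : ℂ) (r : ℝ) : ℝ :=
  precisionBound n f m r + τ + n * Real.logb 2 (max 1 ‖m‖)
    + (k : ℝ) ^ 2 * (Real.logb 2 n + Real.logb 2 (max 1 r))

theorem ten_le_precisionBound (n : ℕ) (f : ℝ[X]) (m : ℂ) (r : ℝ) : 10 ≤ precisionBound n f m r := by
  unfold precisionBound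
  linarith [le_max_left 1 (1 + Real.logb 2 n - Real.logb 2 (maxCoeff f m r n))]

theorem logb_two_max_nonneg (x : ℝ) : 0 ≤ Real.logb 2 (max 1 x) :=
  Real.logb_nonneg one_lt_two (le_max_left _ _)

theorem le_two_pow_of_mul_logb_le {x : ℝ} (hx : 0 < x) {i b : ℕ} (h : i * Real.logb 2 x ≤ b) :
    x ^ i ≤ 2 ^ b := by
  have h1 := Real.logb_le_iff_le_rpow (b := 2) (x := x ^ i) (y := b) one_lt_two (by positivity)
  rw [Real.logb_pow, Real.rpow_natCast] at h1
  exact h1.1 h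

theorem size_le_logb (n : ℕ) : (Nat.size n : ℝ) ≤ Real.logb 2 n + 1 := by
  have h1 : Nat.size n ≤ Nat.log 2 n + 1 :=
    Nat.size_le.2 (Nat.lt_pow_succ_log_self (by norm_num) n)
  have h2 := Real.natLog_le_logb n 2
  have h3 : (Nat.size n : ℝ) ≤ Nat.log 2 n + 1 := by exact_mod_cast h1
  push_cast at h2
  linarith

namespace IsNomial

variable {n k : ℕ} {τ : ℝ} {e : Fin k → ℕ} {c : Fin k → ℝ}

theorem one_le (h : IsNomial n k τ e c) : 1 ≤ n := by
  have := h.two_le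
  have := h.le_add_one
  omega

theorem one_le_two_rpow (h : IsNomial n k τ e c) : (1 : ℝ) ≤ 2 ^ τ := by
  have j : Fin k := ⟨0, by have := h.two_le; omega⟩
  have h1 := (h.le_abs j).trans (h.abs_le j)
  rw [Real.rpow_neg (by norm_num)] at h1
  have h2 : (0 : ℝ) < 2 ^ τ := by positivity
  rw [inv_le_iff_one_le_mul₀ h2] at h1
  nlinarith

theorem nonneg (h : IsNomial n k τ e c) : 0 ≤ τ := by
  by_contra hτ
  exact absurd h.one_le_two_rpow (not_le.2 (Real.rpow_lt_one_of_one_lt_of_neg one_lt_two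
    (not_le.1 hτ)))

theorem logb_nonneg (h : IsNomial n k τ e c) : 0 ≤ Real.logb 2 n :=
  Real.logb_nonneg one_lt_two (by exact_mod_cast h.one_le)

section

variable (f : ℝ[X]) (m : ℂ) (r : ℝ)

theorem le_bitSize (h : IsNomial n k τ e c) :
    10 ≤ bitSize n k τ f m r ∧ precisionBound n f m r ≤ bitSize n k τ f m r ∧
      τ ≤ bitSize n k τ f m r ∧ n * Real.logb 2 (max 1 ‖m‖) ≤ bitSize n k τ f m r ∧
      (k : ℝ) ^ 2 * Real.logb 2 n + 10 ≤ bitSize n k τ f m r ∧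
      (k : ℝ) ^ 2 * Real.logb 2 (max 1 r) ≤ bitSize n k τ f m r := by
  have h1 := ten_le_precisionBound n f m r
  have h2 := h.nonneg
  have h3 : 0 ≤ n * Real.logb 2 (max 1 ‖m‖) := mul_nonneg (by positivity) (logb_two_max_nonneg _)
  have h4 : 0 ≤ (k : ℝ) ^ 2 * Real.logb 2 n := mul_nonneg (by positivity) h.logb_nonneg
  have h5 : 0 ≤ (k : ℝ) ^ 2 * Real.logb 2 (max 1 r) :=
    mul_nonneg (by positivity) (logb_two_max_nonneg _)
  unfold bitSize
  rw [mul_add]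
  refine ⟨?_, ?_, ?_, ?_, ?_, ?_⟩ <;> linarith

/-- For n ≥ 2 the term k² log n dominates k²; for n = 1 there are at most two terms and the constant
10 suffices. -/
theorem sq_add_one_le_bitSize (h : IsNomial n k τ e c) :
    (k : ℝ) ^ 2 + 1 ≤ bitSize n k τ f m r := by
  obtain ⟨h1, -, -, -, h5, -⟩ := h.le_bitSize f m r
  have hn := h.one_le
  have hk := h.le_add_one
  rcases Nat.lt_or_ge n 2 with h2 | h2
  · have h3 : (k : ℝ) ≤ 2 := by exact_mod_cast (by omega : k ≤ 2)
    nlinarith [(Nat.cast_nonneg k : (0 : ℝ) ≤ k)]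
  · have h3 : 1 ≤ Real.logb 2 n := by
      rw [Real.le_logb_iff_rpow_le one_lt_two (by positivity), Real.rpow_one]
      exact_mod_cast h2
    nlinarith [sq_nonneg (k : ℝ)]

theorem bitBound_eq (n k : ℕ) (τ : ℝ) (f : ℝ[X]) (m : ℂ) (r : ℝ) :
    bitBound n k τ f m r = (k : ℝ) ^ 2 * (k + Real.logb 2 n) * bitSize n k τ f m r := rfl

end

/-- All quantities of the computation are bounded in terms of `bitSize`. -/
theorem setup (h : IsNomial n k τ e c) {m : ℂ} {r : ℝ} (hr : 0 < r) {O : ℕ → ℕ → ℤ}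
    (hO : IsInputOracle c m r O) {f : ℝ[X]} {b v T₁ κ : ℕ} {e' : ℕ → ℕ} {c' : ℕ → ℝ}
    (he : ∀ j : Fin k, e' j = e j) (hc : ∀ j : Fin k, c' j = c j)
    (hb : bitSize n k τ f m r ≤ b) (hv : v = 400 * b) (hn : n < 2 ^ T₁) (hT : v + 3 ≤ 2 ^ (T₁ + 1))
    (hκ : 1 ≤ κ) (hκ₁ : 2 * n + 2 * (k * k) + 2 ≤ 2 ^ (κ + 1))
    (hκ₂ : (2 : ℝ) ^ (κ + 1) ≤ ((2 : ℝ) ^ (2 * b)) ^ 60)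
    (hcount : ((2 * n + 2 * (k * k) + 2 : ℕ) : ℝ) ≤ 2 ^ (2 * b))
    (hbase : ((4 * k + 4 + 2 * (k * k) + 2 : ℕ) : ℝ) ≤ 2 ^ (2 * b)) :
    Setup O v n k (k * k) (4 * k + 4) T₁ e' c' m r (2 ^ (2 * b)) κ := by
  obtain ⟨h1, h2, h3, h4, h5, h6⟩ := h.le_bitSize f m r
  have h7 := h.sq_add_one_le_bitSize f m r
  have hk : (1 : ℝ) ≤ k := by exact_mod_cast (by have := h.two_le; omega : 1 ≤ k)
  have hn1 := h.one_le
  have hlog := h.logb_nonneg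
  have hb10 : 10 ≤ b := by exact_mod_cast h1.trans hb
  have hkk : k * k + 1 ≤ b := by
    have : (k : ℝ) ^ 2 + 1 ≤ b := h7.trans hb
    rw [pow_two] at this
    exact_mod_cast this
  -- The powers have exponent k² + 1, at most twice the k² in the bit size; this and the exponent 2n
  -- for the center are covered by W = 2^(2b) instead of 2^b.
  have hK : ((k * k + 1 : ℕ) : ℝ) ≤ 2 * (k : ℝ) ^ 2 := by push_cast; nlinarith
  have hcτ : ∀ j : Fin k, max 1 |c j| ≤ 2 ^ (2 * b) := fun j => by
    refine max_le (one_le_pow₀ one_le_two) ((h.abs_le j).trans ?_)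
    rw [← Real.rpow_natCast]
    refine Real.rpow_le_rpow_of_exponent_le one_le_two ?_
    push_cast
    linarith
  exact {
    n_pos := hn1
    κ_pos := hκ
    exponent_le := fun j hj => by rw [he ⟨j, hj⟩]; exact h.exponent_le _
    r_pos := hr
    le_W := pow_le_pow_right₀ one_le_two (by omega)
    normPow_le := le_two_pow_of_mul_logb_le (by positivity) (by push_cast; linarith)
    coeff_le := fun j hj => by rw [hc ⟨j, hj⟩]; exact hcτ _
    radiusPow_le := le_two_pow_of_mul_logb_le (by positivity) (by
      have := mul_le_mul_of_nonneg_right hK (logb_two_max_nonneg r)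
      push_cast at this ⊢
      linarith)
    degreePow_le := le_two_pow_of_mul_logb_le (by positivity) (by
      have := mul_le_mul_of_nonneg_right hK hlog
      push_cast at this ⊢
      linarith)
    fourPow_le := by
      rw [show (4 : ℝ) = 2 ^ 2 by norm_num, ← pow_mul]
      exact pow_le_pow_right₀ one_le_two (by omega)
    count_le := hcount
    terms_le := by
      refine le_trans ?_ hbase
      exact_mod_cast (by omega : 3 * k + 1 ≤ 4 * k + 4 + 2 * (k * k) + 2)
    base_le := hbase
    W_le := by rw [← pow_mul, hv]; exact le_of_eq (by congr 1; ring)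
    k_le_base := by omega
    degree_lt := hn
    size_le := hT
    scale_ge := hκ₁
    scale_le := hκ₂
    oracle_coeff := fun j hj => by rw [hc ⟨j, hj⟩]; exact hO.coeff ⟨j, hj⟩
    oracle_re := hO.center_re
    oracle_im := hO.center_im
    oracle_radius := hO.radius }

end IsNomial

theorem shiftCoeff_eq_diskCoeff {k : ℕ} {e : Fin k → ℕ} {c : Fin k → ℝ} {e' : ℕ → ℕ} {c' : ℕ → ℝ}
    (he : ∀ j : Fin k, e' j = e j) (hc : ∀ j : Fin k, c' j = c j) (m : ℂ) (r : ℝ) (i : ℕ) :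
    shiftCoeff k e' c' m r i = diskCoeff (sparsePoly e c) m r i := by
  rw [diskCoeff_sparsePoly, shiftCoeff, Finset.sum_range]
  congr 1
  refine Finset.sum_congr rfl fun j _ => ?_
  rw [he, hc]
  ring

theorem OutputSpec.isTestResult {n k l : ℕ} {f : ℝ[X]} {m : ℂ} {r : ℝ} {s : State} (hn : 1 ≤ n)
    (hf : f.natDegree ≤ n) (htail : TailAssumption n k f m r) (hM : 0 < maxCoeff f m r n)
    (h : OutputSpec (k * k) (fun i => ‖diskCoeff f m r i‖) (maxCoeff f m r n) l s) :
    IsTestResult n k f m r l s := by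
  obtain ⟨L, A, B, h1, h2, h3, h4, h5, h6, h7, h8, h9⟩ := h
  have h9' : IsBitApprox L ((B : ℝ) / 2 ^ (L + 1)) (rhsExpr k f m r l) := by
    unfold rhsExpr
    rw [pow_two k]
    exact h9
  exact ⟨verdictOf A B, L, A, B, h1, h2, h3, h4, h5, le_precisionBound hn hM h6, h8, h9',
    certifies_verdictOf h8 h9' (h7.trans (maxCoeff_le_max hf htail))⟩

theorem unitCost_le {b : ℕ} {β Λ : ℝ} (hb : 10 ≤ b) (hbβ : (b : ℝ) ≤ 2 * β)
    (hβ : Real.logb 2 β ≤ Λ) (hΛ : 6 ≤ Λ) :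
    (unitCost (opBits (400 * b)) : ℝ) ≤ 2 ^ 21 * β * Λ ^ 2 := by
  have hb' : (10 : ℝ) ≤ b := by exact_mod_cast hb
  have hβ0 : 0 < β := by linarith
  have h1 : (opBits (400 * b) : ℝ) ≤ 2 ^ 15 * β := by
    unfold opBits; push_cast; linarith
  have h2 : (Nat.log 2 (2 * opBits (400 * b)) : ℝ) ≤ 16 + Λ := by
    have h3 := Real.natLog_le_logb (2 * opBits (400 * b)) 2
    have h4 : Real.logb 2 ((2 * opBits (400 * b) : ℕ) : ℝ) ≤ Real.logb 2 (2 ^ 16 * β) := by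
      refine Real.logb_le_logb_of_le one_lt_two ?_ ?_
      · have := one_le_opBits (400 * b)
        exact_mod_cast (by omega : 0 < 2 * opBits (400 * b))
      · push_cast; linarith
    rw [Real.logb_mul (by positivity) hβ0.ne', Real.logb_pow, Real.logb_self_eq_one one_lt_two] at h4
    push_cast at h3 h4
    linarith
  unfold unitCost
  generalize opBits (400 * b) = B at *
  push_cast
  have h5 : (1 + (Nat.log 2 (2 * B) : ℝ)) ^ 2 ≤ (4 * Λ) ^ 2 :=
    pow_le_pow_left₀ (by positivity) (by linarith) 2
  have h6 : 4 * (B : ℝ) ≤ 4 * (2 ^ 15 * β) := by linarith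
  have h7 := mul_le_mul h6 h5 (by positivity) (by positivity)
  linarith

/-- Up to constants a round takes k(k² + T₁) + k²T₁ instructions, and there are T rounds. One factor
Λ comes from T and one from T₁. -/
theorem testCost_le {k T T₁ : ℕ} {g Λ : ℝ} (hk : 2 ≤ k) (hg : (k : ℝ) ≤ g) (hΛ : 6 ≤ Λ)
    (hT : (T : ℝ) ≤ 3 * Λ) (hT₁ : (T₁ : ℝ) ≤ g + 3 * Λ) :
    (testCost k (k * k) T T₁ : ℝ) ≤ 700 * ((k : ℝ) ^ 2 * g) * Λ ^ 2 := by
  have hk' : (2 : ℝ) ≤ k := by exact_mod_cast hk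
  have hT₁' : (T₁ : ℝ) ≤ 2 * (g * Λ) := by nlinarith
  have hgΛ : 12 ≤ g * Λ := by nlinarith
  have hk2 : (2 : ℝ) * k ≤ (k : ℝ) ^ 2 := by nlinarith
  have hrc : (roundCost k (k * k) T₁ : ℝ) ≤ 210 * ((k : ℝ) ^ 2 * (g * Λ)) := by
    unfold roundCost
    push_cast
    have e1 : (k : ℝ) * (36 * (k * k)) ≤ 6 * ((k : ℝ) ^ 2 * (g * Λ)) := by
      have : 6 * (k : ℝ) ≤ g * Λ := by nlinarith
      nlinarith [sq_nonneg (k : ℝ)]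
    have e2 : (T₁ : ℝ) ≤ (k : ℝ) ^ 2 * (g * Λ) / 2 := by nlinarith
    have e3 : (k : ℝ) * T₁ ≤ (k : ℝ) ^ 2 * (g * Λ) := by nlinarith
    have e4 : (k : ℝ) ^ 2 * T₁ ≤ 2 * ((k : ℝ) ^ 2 * (g * Λ)) := by nlinarith
    have e5 : 12 * (k : ℝ) ^ 2 ≤ (k : ℝ) ^ 2 * (g * Λ) := by nlinarith
    nlinarith
  unfold testCost
  push_cast
  have f1 : (48 : ℝ) ≤ (k : ℝ) ^ 2 * (g * Λ) := by nlinarith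
  have f2 : (T : ℝ) * (roundCost k (k * k) T₁ + 18) ≤ 3 * Λ * (211 * ((k : ℝ) ^ 2 * (g * Λ))) :=
    mul_le_mul hT (by linarith) (by positivity) (by linarith)
  have f3 : (k : ℝ) * 100 ≤ (k : ℝ) ^ 2 * (g * Λ) * Λ := by
    have : (k : ℝ) * 24 ≤ (k : ℝ) ^ 2 * (g * Λ) := by nlinarith
    nlinarith
  calc _ ≤ 3 * Λ * (211 * ((k : ℝ) ^ 2 * (g * Λ))) + (k + 1) * 40 + 60 := by linarith
    _ ≤ 3 * Λ * (211 * ((k : ℝ) ^ 2 * (g * Λ))) + 2 * ((k : ℝ) ^ 2 * (g * Λ) * Λ) := by linarith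
    _ = 635 * ((k : ℝ) ^ 2 * g) * Λ ^ 2 := by ring
    _ ≤ 700 * ((k : ℝ) ^ 2 * g) * Λ ^ 2 := by
      have : 0 ≤ g := by linarith
      gcongr
      norm_num

theorem testCmd_correct {n k : ℕ} {τ : ℝ} {e : Fin k → ℕ} {c : Fin k → ℝ} {m : ℂ} {r : ℝ}
    {O : ℕ → ℕ → ℤ} (h : IsNomial n k τ e c) (hr : 0 < r)
    (htail : TailAssumption n k (sparsePoly e c) m r) (hO : IsInputOracle c m r O) :
    ∃ (t : ℕ) (s : State), Exec O testCmd (initState n k e) t s ∧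
      (∀ l ≤ k, IsTestResult n k (sparsePoly e c) m r l s) ∧
      (t : ℝ) ≤ 700 * 2 ^ 21 * bitBound n k τ (sparsePoly e c) m r *
        Real.logb 2 (bitBound n k τ (sparsePoly e c) m r) ^ 4 := by
  have hn1 := h.one_le
  have hk2 := h.two_le
  have hf := h.natDegree_le
  have hM := maxCoeff_pos (m := m) hr h.sparsePoly_ne_zero hf
  obtain ⟨h1, h2, h3, h4, h5, h6⟩ := h.le_bitSize (sparsePoly e c) m r
  have h7 := h.sq_add_one_le_bitSize (sparsePoly e c) m r
  have hlog := h.logb_nonneg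
  rw [IsNomial.bitBound_eq]
  set f := sparsePoly e c with hfdef
  set β := bitSize n k τ f m r with hβ
  obtain ⟨b, hb, hb'⟩ : ∃ b : ℕ, β ≤ b ∧ (b : ℝ) ≤ β + 1 :=
    ⟨⌈β⌉₊, Nat.le_ceil β, (Nat.ceil_lt_add_one (by linarith)).le⟩
  have hb10 : 10 ≤ b := by exact_mod_cast h1.trans hb
  have hkk : k * k + 1 ≤ b := by
    have : (k : ℝ) ^ 2 + 1 ≤ b := h7.trans hb
    rw [pow_two] at this
    exact_mod_cast this
  have hk' : (2 : ℝ) ≤ k := by exact_mod_cast hk2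
  have hbpow : b < 2 ^ b := Nat.lt_two_pow_self
  have h1024 : 2 ^ 10 ≤ 2 ^ b := Nat.pow_le_pow_right (by norm_num) hb10
  have hnb : n ≤ 2 ^ b := by
    have : (n : ℝ) ^ 1 ≤ 2 ^ b := le_two_pow_of_mul_logb_le (by positivity) (by
      have : Real.logb 2 n ≤ (k : ℝ) ^ 2 * Real.logb 2 n :=
        le_mul_of_one_le_left hlog (by nlinarith)
      push_cast
      linarith)
    rw [pow_one] at this
    exact_mod_cast this
  have h22 : 2 ^ (2 * b) = 2 ^ b * 2 ^ b := by rw [← pow_add]; congr 1; ring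
  have hkkk : k ≤ k * k := Nat.le_mul_self k
  have hcount : ((2 * n + 2 * (k * k) + 2 : ℕ) : ℝ) ≤ 2 ^ (2 * b) := by
    have : 2 * n + 2 * (k * k) + 2 ≤ 2 ^ (2 * b) := by rw [h22]; nlinarith
    exact_mod_cast this
  have hbase : ((4 * k + 4 + 2 * (k * k) + 2 : ℕ) : ℝ) ≤ 2 ^ (2 * b) := by
    have : 4 * k + 4 + 2 * (k * k) + 2 ≤ 2 ^ (2 * b) := by rw [h22]; nlinarith
    exact_mod_cast this
  set T := Nat.size (400 * b + 3) with hTdef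
  have hT2 : 400 * b + 3 < 2 ^ T := Nat.lt_size_self _
  -- The same number bounds the binary digits of n in the powering and the Newton steps for operands
  -- of about v bits; a sum satisfies both conditions.
  set T₁ := Nat.size n + T with hT₁def
  have hnT : n < 2 ^ T₁ :=
    (Nat.lt_size_self n).trans_le (Nat.pow_le_pow_right (by norm_num) (by omega))
  have hW : SizeBound (400 * b) T (2 ^ (2 * b)) :=
    ⟨pow_le_pow_right₀ one_le_two (by omega),
      by rw [← pow_mul]; exact le_of_eq (by congr 1; ring),
      hT2.le.trans (Nat.pow_le_pow_right (by norm_num) (by omega))⟩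
  let e' : ℕ → ℕ := fun j => if hj : j < k then e ⟨j, hj⟩ else 0
  let c' : ℕ → ℝ := fun j => if hj : j < k then c ⟨j, hj⟩ else 0
  have he : ∀ j : Fin k, e' j = e j := fun j => by simp [e']
  have hc : ∀ j : Fin k, c' j = c j := fun j => by simp [c']
  have hcoeff := shiftCoeff_eq_diskCoeff he hc m r
  -- The precision bound is at most b and contains -2 log M, so M ≥ 2^(-b). This lower bound is what
  -- makes the rounds stop.
  have hMW : 1 / (2 : ℝ) ^ (2 * b) ≤ maxCoeff f m r n := by
    have e1 : -(b : ℝ) ≤ Real.logb 2 (maxCoeff f m r n) := by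
      have := le_max_right 1 (1 + Real.logb 2 n - Real.logb 2 (maxCoeff f m r n))
      have e2 : precisionBound n f m r ≤ b := h2.trans hb
      have e3 := ten_le_precisionBound n f m r
      unfold precisionBound at e2 e3
      linarith
    rw [Real.le_logb_iff_rpow_le one_lt_two hM, Real.rpow_neg (by norm_num),
      Real.rpow_natCast] at e1
    refine le_trans ?_ e1
    rw [one_div]
    exact inv_anti₀ (by positivity) (pow_le_pow_right₀ one_le_two (by omega))
  obtain ⟨t, s, hex, ht, hs⟩ := testCmd_spec (O := O) (c := c') (m := m) (r := r) (T₁ := T₁)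
    (e := e') (n := n) (k := k) (M := maxCoeff f m r n) (s := initState n k e) hW
    (fun κ hκ hκ₁ hκ₂ => h.setup hr hO he hc hb rfl hnT
      (hT2.le.trans (Nat.pow_le_pow_right (by norm_num) (by omega))) hκ hκ₁ hκ₂ hcount hbase)
    (by simp [initState]) (by simp [initState]) (by simp [initState])
    (fun j hj => by simp [initState, e', hj]) (by omega) hcount hbase hMW
    (by
      obtain ⟨i, hi, hiM⟩ := exists_norm_diskCoeff_eq_maxCoeff hf htail
      exact ⟨i, by rwa [← pow_two], by rw [hcoeff]; exact hiM⟩)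
    (fun i _ => by rw [hcoeff]; exact norm_diskCoeff_le_maxCoeff f m r hf)
  refine ⟨t, s, hex, fun l hl => ?_, ?_⟩
  · have := hs l hl
    simp only [hcoeff] at this
    exact this.isTestResult hn1 hf htail hM
  have hβF : 8 * β ≤ (k : ℝ) ^ 2 * (k + Real.logb 2 n) * β := by
    refine mul_le_mul_of_nonneg_right ?_ (by linarith)
    calc (8 : ℝ) = 2 ^ 2 * 2 := by norm_num
      _ ≤ (k : ℝ) ^ 2 * (k + Real.logb 2 n) := mul_le_mul
        (pow_le_pow_left₀ (by norm_num) hk' 2) (by linarith) (by norm_num) (by positivity)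
  set F := (k : ℝ) ^ 2 * (k + Real.logb 2 n) * β with hF
  set Λ := Real.logb 2 F with hΛdef
  -- Here F ≥ 8β ≥ 80 > 2^6; additive constants such as the 11 in T ≤ 11 + Λ can thus be absorbed
  -- into multiples of Λ.
  have hΛ : 6 ≤ Λ := by
    rw [hΛdef, Real.le_logb_iff_rpow_le one_lt_two (by linarith)]
    norm_num
    linarith
  have hβΛ : Real.logb 2 β ≤ Λ := Real.logb_le_logb_of_le one_lt_two (by linarith) (by linarith)
  have hU := unitCost_le hb10 (by linarith : (b : ℝ) ≤ 2 * β) hβΛ hΛ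
  have hTΛ : (T : ℝ) ≤ 11 + Λ := by
    have e1 := size_le_logb (400 * b + 3)
    have e2 : Real.logb 2 ((400 * b + 3 : ℕ) : ℝ) ≤ Real.logb 2 (2 ^ 10 * β) := by
      refine Real.logb_le_logb_of_le one_lt_two (by positivity) ?_
      push_cast; linarith
    rw [Real.logb_mul (by positivity) (by linarith), Real.logb_pow,
      Real.logb_self_eq_one one_lt_two] at e2
    push_cast at e1 e2
    linarith
  have hT₁Λ : (T₁ : ℝ) ≤ k + Real.logb 2 n + 3 * Λ := by
    have := size_le_logb n
    rw [hT₁def]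
    push_cast
    linarith
  have hN := testCost_le (T := T) hk2 (by linarith : (k : ℝ) ≤ k + Real.logb 2 n) hΛ (by linarith) hT₁Λ
  generalize testCost k (k * k) T T₁ = N at *
  generalize unitCost (opBits (400 * b)) = U at *
  have ht' : (t : ℝ) ≤ N * U := by exact_mod_cast ht
  -- Of the four logarithmic factors, two come from the cost of multiplication and two from the
  -- number of instructions.
  calc (t : ℝ) ≤ N * U := ht'
    _ ≤ 700 * ((k : ℝ) ^ 2 * (k + Real.logb 2 n)) * Λ ^ 2 * (2 ^ 21 * β * Λ ^ 2) :=
        mul_le_mul hN hU (by positivity) (by positivity)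
    _ = 700 * 2 ^ 21 * F * Λ ^ 4 := by rw [hF]; ring

end SparseRoots

theorem mainTheorem7 :
    -- precision and correctness of the test, for a single `l`
    (∀ (n k : ℕ) (τ : ℝ) (e : Fin k → ℕ) (c : Fin k → ℝ) (m : ℂ) (r : ℝ),
      SparseRoots.IsNomial n k τ e c → 0 < r →
      SparseRoots.TailAssumption n k (SparseRoots.sparsePoly e c) m r →
      ∀ l : ℕ, l ≤ k →
        -- some precision `L ≤ L(m,r,f)` always suffices to reach a verdict
        (∃ L : ℕ, 1 ≤ L ∧
          (L : ℝ) ≤ SparseRoots.precisionBound n (SparseRoots.sparsePoly e c) m r ∧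
          ∀ x y : ℝ,
            SparseRoots.IsBitApprox L x
              (SparseRoots.lhsExpr (SparseRoots.sparsePoly e c) m r l) →
            SparseRoots.IsBitApprox L y
              (SparseRoots.rhsExpr k (SparseRoots.sparsePoly e c) m r l) →
            ∃ v : SparseRoots.Verdict, SparseRoots.Certifies (1 / 128) L x y v) ∧
        -- every verdict that meets the specification of the soft predicate is sound, and is
        -- `True` whenever `T_l(Δ, 3/2, f)` succeeds
        (∀ v : SparseRoots.Verdict,
          SparseRoots.SoftSpec (1 / 128)
            (SparseRoots.lhsExpr (SparseRoots.sparsePoly e c) m r l)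
            (SparseRoots.rhsExpr k (SparseRoots.sparsePoly e c) m r l) v →
          (v = SparseRoots.Verdict.yes →
            SparseRoots.rootsInDisk (SparseRoots.sparsePoly e c) m r = l) ∧
          (SparseRoots.PelletSucceeds l m r (3 / 2)
              (SparseRoots.toComplex (SparseRoots.sparsePoly e c)) →
            v = SparseRoots.Verdict.yes))) ∧
    -- bit complexity of running the test for all `l ≤ k`
    (∃ (P : SparseRoots.Cmd) (K : ℝ) (d : ℕ),
      ∀ (n k : ℕ) (τ : ℝ) (e : Fin k → ℕ) (c : Fin k → ℝ) (m : ℂ) (r : ℝ) (O : ℕ → ℕ → ℤ),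
        SparseRoots.IsNomial n k τ e c → 0 < r →
        SparseRoots.TailAssumption n k (SparseRoots.sparsePoly e c) m r →
        SparseRoots.IsInputOracle c m r O →
        ∃ (t : ℕ) (s : SparseRoots.State),
          SparseRoots.Exec O P (SparseRoots.initState n k e) t s ∧
          (∀ l : ℕ, l ≤ k →
            SparseRoots.IsTestResult n k (SparseRoots.sparsePoly e c) m r l s) ∧
          (t : ℝ) ≤ K * SparseRoots.bitBound n k τ (SparseRoots.sparsePoly e c) m r *
            (Real.logb 2 (SparseRoots.bitBound n k τ (SparseRoots.sparsePoly e c) m r)) ^ d) := by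
  refine ⟨fun n k τ e c m r h hr htail l hl => ?_, SparseRoots.testCmd, 700 * 2 ^ 21, 4,
    fun n k τ e c m r O h hr htail hO => SparseRoots.testCmd_correct h hr htail hO⟩
  have hf := h.natDegree_le
  refine ⟨SparseRoots.exists_precision h.one_le hf htail
    (SparseRoots.maxCoeff_pos hr h.sparsePoly_ne_zero hf), fun v hv => ⟨fun hyes => ?_, fun hp =>
    hv.eq_yes_of_pelletSucceeds hp⟩⟩
  subst hyes
  exact SparseRoots.rootsInDisk_eq_of_rhsExpr_lt hr hf
    (hl.trans (Nat.le_self_pow (by norm_num) k)) htail hv
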